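/- **Setting.** For $n\ge 1$, an $n$-qubit circuit of depth $d\ge 0$ is a sequence of $d$ layers, each consisting of one-qubit and two-qubit unitary gates that act on pairwise disjoint sets of qubits; we denote its unitary also by $U$ (or $V$). "Classical algorithm" means a single program (one for all $n$, $d$, $\delta$ and all inputs) for a real random-access machine: real numbers are stored exactly, the operations $+,-,\times,\div,<$ on reals, conversion from integers to reals, and $+,-,<$ and memory access for integers cost one step each, and the only constants in the program are natural numbers. Its input consists of $\delta$, the layout of the circuit, and the real and imaginary parts of the entries of all gates (and of the operators $O_j$, where they occur). The runtime is the number of steps. $\tilde{\mathcal O}(f)$ stands for a bound $C\,f\,\log^k(2+f)$ with absolute constants $C$ and $k$. **Theorem.** 1. There is a classical algorithm which, given $\delta\in(0,1/2)$, a depth-$d$ circuit $U$ on $n$ qubits and one-qubit operators $O_1,\dots,O_n$ with operator norm $\|O_j\|=1$ for all $j$, computes a real number $E$ such that, with $O=O_1\otimes\cdots\otimes O_n$, $$\Bigl|E-\bigl|\langle 0^n|U^\dagger O U|0^n\rangle\bigr|\Bigr|\le\delta ,$$ in time at most $2^{\tilde{\mathcal O}\left(4^d\sqrt{n\log(\delta^{-1})}\right)}$.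 If in addition every $O_j$ is positive semidefinite, then $E$ is an additive approximation of the mean value itself: $\bigl|E-\langle 0^n|U^\dagger O U|0^n\rangle\bigr|\le\delta$. 2. There is a classical algorithm which, given $\delta\in(0,1/2)$ and a depth-$d$ circuit $V$ on $n$ qubits, computes a real number $q$ such that $$\Bigl|q-\bigl|\langle 0^n|V|0^n\rangle\bigr|^2\Bigr|\le\delta ,$$ in time at most $2^{\tilde{\mathcal O}\left(2^d\sqrt{n\log(\delta^{-1})}\right)}$. -/

import Mathlib

open scoped ComplexOrder

/-! ## The machine model: a real RAM with a step count

The memory consists of arrays of natural numbers and arrays of real numbers, named by numerals that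
are fixed in the program; cells are addressed by computed natural numbers.  Natural numbers admit
addition, truncated subtraction and comparison; real numbers admit the four field operations (exact),
comparison, and conversion from natural numbers.  A program is a finite text with natural-number
constants only.  Every operation, memory access, test and assignment costs one step. -/

namespace RealRAM

/-- The memory: `nat a i` and `real a i` are the contents of cell `i` of array `a`. -/
structure State where
  nat : ℕ → ℕ → ℕ
  real : ℕ → ℕ → ℝ

/-- Expressions with natural-number values. -/
inductive NExpr where
  | const (c : ℕ)
  | get (a : ℕ) (i : NExpr)
  | add (e e' : NExpr)
  | sub (e e' : NExpr)

/-- Expressions with real values. -/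
inductive RExpr where
  | ofNat (e : NExpr)
  | get (a : ℕ) (i : NExpr)
  | add (e e' : RExpr)
  | sub (e e' : RExpr)
  | mul (e e' : RExpr)
  | div (e e' : RExpr)

/-- Tests. -/
inductive BExpr where
  | ltN (e e' : NExpr)
  | ltR (e e' : RExpr)
  | not (b : BExpr)
  | and (b b' : BExpr)

def NExpr.eval (s : State) : NExpr → ℕ
  | .const c => c
  | .get a i => s.nat a (i.eval s)
  | .add e e' => e.eval s + e'.eval s
  | .sub e e' => e.eval s - e'.eval s

/-- Number of operations in an expression. -/
def NExpr.cost : NExpr → ℕ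
  | .const _ => 1
  | .get _ i => i.cost + 1
  | .add e e' => e.cost + e'.cost + 1
  | .sub e e' => e.cost + e'.cost + 1

noncomputable def RExpr.eval (s : State) : RExpr → ℝ
  | .ofNat e => (e.eval s : ℝ)
  | .get a i => s.real a (i.eval s)
  | .add e e' => e.eval s + e'.eval s
  | .sub e e' => e.eval s - e'.eval s
  | .mul e e' => e.eval s * e'.eval s
  | .div e e' => e.eval s / e'.eval s

/-- Number of operations in an expression. -/
def RExpr.cost : RExpr → ℕ
  | .ofNat e => e.cost + 1
  | .get _ i => i.cost + 1
  | .add e e' => e.cost + e'.cost + 1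
  | .sub e e' => e.cost + e'.cost + 1
  | .mul e e' => e.cost + e'.cost + 1
  | .div e e' => e.cost + e'.cost + 1

def BExpr.holds (s : State) : BExpr → Prop
  | .ltN e e' => e.eval s < e'.eval s
  | .ltR e e' => e.eval s < e'.eval s
  | .not b => ¬ b.holds s
  | .and b b' => b.holds s ∧ b'.holds s

/-- Number of operations in a test. -/
def BExpr.cost : BExpr → ℕ
  | .ltN e e' => e.cost + e'.cost + 1
  | .ltR e e' => e.cost + e'.cost + 1
  | .not b => b.cost + 1
  | .and b b' => b.cost + b'.cost + 1

/-- Programs. -/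
inductive Program where
  | skip
  | setN (a : ℕ) (i e : NExpr)
  | setR (a : ℕ) (i : NExpr) (e : RExpr)
  | seq (c c' : Program)
  | ite (b : BExpr) (c c' : Program)
  | while (b : BExpr) (c : Program)

/-- Write the natural number `v` into cell `i` of array `a`. -/
def State.setN (s : State) (a i v : ℕ) : State :=
  { s with nat := Function.update s.nat a (Function.update (s.nat a) i v) }

/-- Write the real number `v` into cell `i` of array `a`. -/
noncomputable def State.setR (s : State) (a i : ℕ) (v : ℝ) : State :=
  { s with real := Function.update s.real a (Function.update (s.real a) i v) }

/-- `Exec c s s' t`: started in memory `s`, the program `c` halts with memory `s'` after exactly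
`t` steps. -/
inductive Exec : Program → State → State → ℕ → Prop
  | skip (s : State) : Exec .skip s s 1
  | setN (s : State) (a : ℕ) (i e : NExpr) :
      Exec (.setN a i e) s (s.setN a (i.eval s) (e.eval s)) (i.cost + e.cost + 1)
  | setR (s : State) (a : ℕ) (i : NExpr) (e : RExpr) :
      Exec (.setR a i e) s (s.setR a (i.eval s) (e.eval s)) (i.cost + e.cost + 1)
  | seq {s s₁ s₂ : State} {c c' : Program} {t t' : ℕ} (h : Exec c s s₁ t) (h' : Exec c' s₁ s₂ t') :
      Exec (.seq c c') s s₂ (t + t')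
  | ite_true {s s₁ : State} {b : BExpr} {c c' : Program} {t : ℕ} (hb : b.holds s)
      (h : Exec c s s₁ t) : Exec (.ite b c c') s s₁ (b.cost + t + 1)
  | ite_false {s s₁ : State} {b : BExpr} {c c' : Program} {t : ℕ} (hb : ¬ b.holds s)
      (h : Exec c' s s₁ t) : Exec (.ite b c c') s s₁ (b.cost + t + 1)
  | while_false {s : State} {b : BExpr} {c : Program} (hb : ¬ b.holds s) :
      Exec (.while b c) s s (b.cost + 1)
  | while_true {s s₁ s₂ : State} {b : BExpr} {c : Program} {t t' : ℕ} (hb : b.holds s)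
      (h : Exec c s s₁ t) (h' : Exec (.while b c) s₁ s₂ t') :
      Exec (.while b c) s s₂ (b.cost + t + t' + 1)

/-- The initial memory: the two input lists fill array `0` of either kind, all else is zero. -/
noncomputable def initial (x : List ℕ) (y : List ℝ) : State where
  nat a i := if a = 0 then x.getD i 0 else 0
  real a i := if a = 0 then y.getD i 0 else 0

/-- On input `(x, y)` the program halts after exactly `t` steps and outputs the real number `E`
(in cell `0` of real array `0`). -/
def Outputs (P : Program) (x : List ℕ) (y : List ℝ) (E : ℝ) (t : ℕ) : Prop :=
  ∃ s : State, Exec P (initial x y) s t ∧ s.real 0 0 = E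

end RealRAM

/-! ## Quantum circuits

Operators on `n` qubits are matrices indexed by the computational basis `Fin n → Fin 2`. -/

namespace QCircuit

/-- Operators on `n` qubits. -/
abbrev Op (n : ℕ) : Type := Matrix (Fin n → Fin 2) (Fin n → Fin 2) ℂ

/-- A one-qubit gate on qubit `i`, or a two-qubit gate on distinct qubits `i` and `j`. -/
inductive Gate (n : ℕ) where
  | one (i : Fin n) (M : Matrix.unitaryGroup (Fin 2) ℂ)
  | two (i j : Fin n) (hij : i ≠ j) (M : Matrix.unitaryGroup (Fin 2 × Fin 2) ℂ)

variable {n d : ℕ}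

/-- The qubits a gate acts on. -/
def Gate.qubits : Gate n → Finset (Fin n)
  | .one i _ => {i}
  | .two i j _ _ => {i, j}

/-- The `n`-qubit operator of a gate: the gate on its qubits, tensored with the identity. -/
noncomputable def Gate.op : Gate n → Op n
  | .one i M => fun x y => if ∀ k, k ≠ i → x k = y k then M.1 (x i) (y i) else 0
  | .two i j _ M => fun x y =>
      if ∀ k, k ≠ i → k ≠ j → x k = y k then M.1 (x i, x j) (y i, y j) else 0

/-- A layer: gates that act on pairwise disjoint sets of qubits. -/
structure Layer (n : ℕ) where
  gates : List (Gate n)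
  disjoint : gates.Pairwise fun g h => Disjoint g.qubits h.qubits

/-- The operator of a layer (its gates commute, so their order is immaterial). -/
noncomputable def Layer.op (l : Layer n) : Op n := (l.gates.map Gate.op).prod

end QCircuit

/-- A depth-`d` circuit on `n` qubits: layer `0` is applied first. -/
abbrev QCircuit (n d : ℕ) : Type := Fin d → QCircuit.Layer n

namespace QCircuit

variable {n d : ℕ}

/-- The unitary implemented by the circuit, `U = U_{d-1} ⋯ U_1 U_0`. -/
noncomputable def op (U : QCircuit n d) : Op n :=
  (List.ofFn fun t => (U t).op).reverse.prod

/-- The tensor product of one-qubit operators. -/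
noncomputable def tensor (O : Fin n → Matrix (Fin 2) (Fin 2) ℂ) : Op n :=
  fun x y => ∏ j, O j (x j) (y j)

/-- The matrix element `⟨0ⁿ| A |0ⁿ⟩`. -/
def zeroElement (A : Op n) : ℂ := A 0 0

/-- The mean value `⟨0ⁿ| U† (O₁ ⊗ ⋯ ⊗ Oₙ) U |0ⁿ⟩`. -/
noncomputable def meanValue (U : QCircuit n d) (O : Fin n → Matrix (Fin 2) (Fin 2) ℂ) : ℂ :=
  zeroElement ((op U).conjTranspose * tensor O * op U)

/-- The operator norm of a one-qubit operator for the Euclidean norm on `ℂ²`. -/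
noncomputable def qubitNorm (A : Matrix (Fin 2) (Fin 2) ℂ) : ℝ :=
  ‖Matrix.toEuclideanCLM (n := Fin 2) (𝕜 := ℂ) A‖

/-! ### Inputs of the algorithms -/

/-- The entries of a matrix, row by row in the order of `idx`, each as real and imaginary part. -/
def entries {ι : Type} (idx : List ι) (M : Matrix ι ι ℂ) : List ℝ :=
  idx.flatMap fun a => idx.flatMap fun b => [(M a b).re, (M a b).im]

/-- Entries of a one-qubit operator. -/
def entriesOne (M : Matrix (Fin 2) (Fin 2) ℂ) : List ℝ := entries [0, 1] M

/-- Entries of a two-qubit operator. -/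
def entriesTwo (M : Matrix (Fin 2 × Fin 2) (Fin 2 × Fin 2) ℂ) : List ℝ :=
  entries [(0, 0), (0, 1), (1, 0), (1, 1)] M

/-- Kind and position of a gate. -/
def Gate.natCode : Gate n → List ℕ
  | .one i _ => [1, i]
  | .two i j _ _ => [2, i, j]

/-- Matrix entries of a gate. -/
def Gate.realCode : Gate n → List ℝ
  | .one _ M => entriesOne M.1
  | .two _ _ _ M => entriesTwo M.1

/-- The layout of a circuit: `n`, `d`, and for every layer the number of its gates followed by
their kinds and positions. -/
def natCode (U : QCircuit n d) : List ℕ :=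
  [n, d] ++ (List.ofFn U).flatMap fun l => l.gates.length :: l.gates.flatMap Gate.natCode

/-- The matrix entries of all gates of a circuit, in the order of `natCode`. -/
def realCode (U : QCircuit n d) : List ℝ :=
  (List.ofFn U).flatMap fun l => l.gates.flatMap Gate.realCode

/-- The entries of the observables, in order. -/
def obsCode (O : Fin n → Matrix (Fin 2) (Fin 2) ℂ) : List ℝ :=
  (List.ofFn O).flatMap entriesOne

end QCircuit

/-- `C · f · polylog(f)`, the bound meant by `Õ(f)`; the `2 +` keeps the logarithm bounded away
from zero for small `f`. -/
noncomputable def softO (C : ℝ) (k : ℕ) (f : ℝ) : ℝ := C * (f * Real.log (2 + f) ^ k)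

/-! Both quantities are probabilities of an all-zero bit string. The number `|⟨0|V|0⟩|²` is the
probability that measuring `V|0⟩` shows no ones. For the mean value, each `O j` is completed to a
channel with Kraus operators `O j` and `√(1 - (O j)ᴴ O j)`; if the bit `a j` records which of the
two acts, then the string `(z, a)` of `2n` bits has probability `|⟨z|Uᴴ K_a U|0⟩|²`, and at zero
this is the squared modulus of the mean value (`hasLaw_output`, `hasLaw_mean`). Because the norm is
exactly one, the defect `D = 1 - Oᴴ O` is positive and singular, so `D² = tr(D) D` and `√D = D /
√tr(D)`. Conjugation by `√D` therefore needs no square root (`isKraus_of_qubitNorm`).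

Let `H` be the number of ones among `N` bits. A polynomial with `p 0 = 1` and `|p x| ≤ ε` at `x = 1,
…, N` has an expectation `𝔼 p(H)` within `ε` of the probability of zero. The polynomial used is the
product of the factors `1 - x / k`, `k ≤ m`, and a Chebyshev polynomial that is bounded by one on
`[m, N]`, normalized at zero. With `m ≈ log ε⁻¹` roots the gap in the Chebyshev argument grows from
`1 / N` to `m / N`, so the value at zero is at least `(1 + √(m/N)) ^ D / 2`, and a degree `D` of
order `√(mN) log N` outweighs the factor `N ^ m` lost to the roots (`abs_polynomial_le`,
`rootBound_le_chebyshevT_mul`). The total degree is of order `√(n log δ⁻¹)` up to logarithms, where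
Chebyshev alone would give `√n log δ⁻¹`.

Since `H` is a sum of bits, `p(H)` expands into products of at most `m + D` projectors. In the
expectation of a product of `κ` projectors all gates outside its light cone cancel. What is left is
`2 ^ d * κ` gates for the output probability and `4 ^ d * 4 * κ` gates and channels for the mean
value, where the light cone spreads through two copies of the circuit (`touched_layers`). All
choices, namely the terms of the polynomial, matrix units, gate entries and Kraus operators, are
read as digits of one counter, so the expectation is a plain sum over the values of that counter
(`PathSum`, `Cfg.Sums`, `pathTotal_spec`).

The program evaluates this sum one counter value at a time. Each operation on configurations has a
program fragment and a lemma under `Rep` showing that the fragment performs it on the memory. The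
running time is polynomial in the number of paths (`time_le_pow`), whose logarithm is the degree
times the light cone factor times a logarithm (`natCast_le_rpow_softO`). For the mean value the
square is computed to precision `δ² / 4` and its root is found by bisection (`meanProgram_spec`). -/

namespace RealRAM

/-! ### Reasoning about programs: step bounds, loops and frames. -/

theorem State.nat_setN (s : State) (a i v a' i' : ℕ) :
    (s.setN a i v).nat a' i' = if a' = a ∧ i' = i then v else s.nat a' i' := by
  unfold State.setN
  by_cases h : a' = a
  · subst h
    by_cases h' : i' = i
    · subst h'; simp
    · simp [h']
  · simp [h]

theorem State.real_setR (s : State) (a i : ℕ) (v : ℝ) (a' i' : ℕ) :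
    (s.setR a i v).real a' i' = if a' = a ∧ i' = i then v else s.real a' i' := by
  unfold State.setR
  by_cases h : a' = a
  · subst h
    by_cases h' : i' = i
    · subst h'; simp
    · simp [h']
  · simp [h]

@[simp] theorem State.real_setN (s : State) (a i v : ℕ) : (s.setN a i v).real = s.real := rfl

@[simp] theorem State.nat_setR (s : State) (a i : ℕ) (v : ℝ) : (s.setR a i v).nat = s.nat := rfl

/-- The program halts within `T` steps in a memory that satisfies `Q`. -/
def Runs (c : Program) (s : State) (T : ℕ) (Q : State → Prop) : Prop :=
  ∃ s' t, Exec c s s' t ∧ t ≤ T ∧ Q s'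

theorem Runs.mono {c : Program} {s : State} {T T' : ℕ} {Q Q' : State → Prop} (h : Runs c s T Q)
    (hT : T ≤ T') (hQ : ∀ s', Q s' → Q' s') : Runs c s T' Q' := by
  obtain ⟨s', t, h1, h2, h3⟩ := h
  exact ⟨s', t, h1, h2.trans hT, hQ s' h3⟩

theorem Runs.seq {c c' : Program} {s : State} {T₁ T₂ : ℕ} {Q Q' : State → Prop}
    (h : Runs c s T₁ Q) (h' : ∀ s', Q s' → Runs c' s' T₂ Q') : Runs (.seq c c') s (T₁ + T₂) Q' := by
  obtain ⟨s', t, h1, h2, h3⟩ := h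
  obtain ⟨s'', t', h1', h2', h3'⟩ := h' s' h3
  exact ⟨s'', t + t', .seq h1 h1', by omega, h3'⟩

theorem Runs.ite {b : BExpr} {c c' : Program} {s : State} {T : ℕ} {Q : State → Prop}
    (h : b.holds s → Runs c s T Q) (h' : ¬ b.holds s → Runs c' s T Q) :
    Runs (.ite b c c') s (b.cost + T + 1) Q := by
  by_cases hb : b.holds s
  · obtain ⟨s', t, h1, h2, h3⟩ := h hb
    exact ⟨s', _, .ite_true hb h1, by omega, h3⟩
  · obtain ⟨s', t, h1, h2, h3⟩ := h' hb
    exact ⟨s', _, .ite_false hb h1, by omega, h3⟩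

/-- The index of `Inv` bounds the rounds that remain, so one invariant yields termination and the
step count together. The loop may stop before the bound is used up. -/
theorem Runs.while {b : BExpr} {c : Program} {T : ℕ} {Q : State → Prop} (Inv : ℕ → State → Prop)
    (hI : ∀ k s, Inv k s → (¬ b.holds s ∧ Q s) ∨
      (b.holds s ∧ ∃ k', k = k' + 1 ∧ Runs c s T (Inv k')))
    (k : ℕ) (s : State) (h : Inv k s) :
    Runs (.while b c) s (k * (b.cost + T + 1) + (b.cost + 1)) Q := by
  induction k generalizing s with
  | zero =>
    rcases hI 0 s h with ⟨h1, h2⟩ | ⟨_, k', h1, _⟩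
    · exact ⟨s, _, .while_false h1, by omega, h2⟩
    · omega
  | succ k ih =>
    rcases hI _ s h with ⟨h1, h2⟩ | ⟨hb, k', h1, h2⟩
    · exact ⟨s, _, .while_false h1, by omega, h2⟩
    · obtain rfl : k = k' := by omega
      obtain ⟨s', t, e1, e2, e3⟩ := h2
      obtain ⟨s'', t', f1, f2, f3⟩ := ih s' e3
      refine ⟨s'', _, .while_true hb e1 f1, ?_, f3⟩
      have : (k + 1) * (b.cost + T + 1) = k * (b.cost + T + 1) + (b.cost + T + 1) := by ring
      omega

/-- The program writes into the natural-number array `a`. -/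
def Program.writesN (a : ℕ) : Program → Bool
  | .skip => false
  | .setN a' _ _ => a' == a
  | .setR _ _ _ => false
  | .seq c c' => c.writesN a || c'.writesN a
  | .ite _ c c' => c.writesN a || c'.writesN a
  | .while _ c => c.writesN a

/-- The program writes into the real array `a`. -/
def Program.writesR (a : ℕ) : Program → Bool
  | .skip => false
  | .setN _ _ _ => false
  | .setR a' _ _ => a' == a
  | .seq c c' => c.writesR a || c'.writesR a
  | .ite _ c c' => c.writesR a || c'.writesR a
  | .while _ c => c.writesR a

/-- A frame rule decided on the program text: for a concrete program `writesN` evaluates by `rfl`,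
so a specification need mention only what its program changes. -/
theorem Exec.nat_eq {c : Program} {s s' : State} {t : ℕ} (h : Exec c s s' t) (a : ℕ)
    (ha : c.writesN a = false) : s'.nat a = s.nat a := by
  induction h with
  | skip => rfl
  | setN s a' i e =>
    have : a ≠ a' := by
      rintro rfl
      simp [Program.writesN] at ha
    funext j
    simp [State.nat_setN, this]
  | setR => rfl
  | seq _ _ ih ih' =>
    simp only [Program.writesN, Bool.or_eq_false_iff] at ha
    rw [ih' ha.2, ih ha.1]
  | ite_true _ _ ih =>
    simp only [Program.writesN, Bool.or_eq_false_iff] at ha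
    exact ih ha.1
  | ite_false _ _ ih =>
    simp only [Program.writesN, Bool.or_eq_false_iff] at ha
    exact ih ha.2
  | while_false => rfl
  | while_true _ _ _ ih ih' => rw [ih' ha, ih ha]

theorem Exec.real_eq {c : Program} {s s' : State} {t : ℕ} (h : Exec c s s' t) (a : ℕ)
    (ha : c.writesR a = false) : s'.real a = s.real a := by
  induction h with
  | skip => rfl
  | setR s a' i e =>
    have : a ≠ a' := by
      rintro rfl
      simp [Program.writesR] at ha
    funext j
    simp [State.real_setR, this]
  | setN => rfl
  | seq _ _ ih ih' =>
    simp only [Program.writesR, Bool.or_eq_false_iff] at ha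
    rw [ih' ha.2, ih ha.1]
  | ite_true _ _ ih =>
    simp only [Program.writesR, Bool.or_eq_false_iff] at ha
    exact ih ha.1
  | ite_false _ _ ih =>
    simp only [Program.writesR, Bool.or_eq_false_iff] at ha
    exact ih ha.2
  | while_false => rfl
  | while_true _ _ _ ih ih' => rw [ih' ha, ih ha]

/-- Arrays into which the program does not write are unchanged. -/
structure Frame (c : Program) (s s' : State) : Prop where
  nat (a : ℕ) (ha : c.writesN a = false := by rfl) : s'.nat a = s.nat a
  real (a : ℕ) (ha : c.writesR a = false := by rfl) : s'.real a = s.real a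

theorem Runs.frame {c : Program} {s : State} {T : ℕ} {Q : State → Prop} (h : Runs c s T Q) :
    Runs c s T fun s' => Q s' ∧ Frame c s s' := by
  obtain ⟨s', t, h1, h2, h3⟩ := h
  exact ⟨s', t, h1, h2, h3, fun a ha => h1.nat_eq a ha, fun a ha => h1.real_eq a ha⟩

/-- All writes go to natural-number arrays from `20` on and to real arrays from `10` on. -/
def Program.local : Program → Bool
  | .skip => true
  | .setN a _ _ => 20 ≤ a
  | .setR a _ _ => 10 ≤ a
  | .seq c c' => c.local && c'.local
  | .ite _ c c' => c.local && c'.local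
  | .while _ c => c.local

theorem Program.writesN_eq_false_of_local {c : Program} (h : c.local = true) {a : ℕ} (ha : a < 20) :
    c.writesN a = false := by
  induction c with
  | setN a' => simp only [Program.local, decide_eq_true_eq] at h; simp [writesN]; omega
  | skip | setR => rfl
  | seq _ _ ih ih' | ite _ _ _ ih ih' =>
    simp only [Program.local, Bool.and_eq_true] at h
    simp [writesN, ih h.1, ih' h.2]
  | _ _ _ ih => exact ih h

theorem Program.writesR_eq_false_of_local {c : Program} (h : c.local = true) {a : ℕ} (ha : a < 10) :
    c.writesR a = false := by
  induction c with
  | setR a' => simp only [Program.local, decide_eq_true_eq] at h; simp [writesR]; omega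
  | skip | setN => rfl
  | seq _ _ ih ih' | ite _ _ _ ih ih' =>
    simp only [Program.local, Bool.and_eq_true] at h
    simp [writesR, ih h.1, ih' h.2]
  | _ _ _ ih => exact ih h

/-- The two memories agree in natural-number arrays below `20` and in real arrays below `10`. -/
structure Pers (s s' : State) : Prop where
  nat (a : ℕ) (ha : a < 20 := by norm_num) : s'.nat a = s.nat a
  real (a : ℕ) (ha : a < 10 := by norm_num) : s'.real a = s.real a

theorem Pers.trans {s s' s'' : State} (h : Pers s s') (h' : Pers s' s'') : Pers s s'' :=
  ⟨fun a ha => (h'.nat a ha).trans (h.nat a ha), fun a ha => (h'.real a ha).trans (h.real a ha)⟩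

theorem Runs.pers {c : Program} {s : State} {T : ℕ} {Q : State → Prop} (h : Runs c s T Q)
    (hc : c.local = true := by rfl) : Runs c s T fun s' => Q s' ∧ Pers s s' :=
  h.frame.mono le_rfl fun _ hs => ⟨hs.1,
    fun a ha => hs.2.nat a (Program.writesN_eq_false_of_local hc ha),
    fun a ha => hs.2.real a (Program.writesR_eq_false_of_local hc ha)⟩

open Classical in
/-- The final memory of a loop-free program. -/
noncomputable def Program.run : Program → State → State
  | .skip, s => s
  | .setN a i e, s => s.setN a (i.eval s) (e.eval s)
  | .setR a i e, s => s.setR a (i.eval s) (e.eval s)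
  | .seq c c', s => c'.run (c.run s)
  | .ite b c c', s => if b.holds s then c.run s else c'.run s
  | .while _ _, s => s

/-- An upper bound for the running time of a loop-free program. -/
def Program.maxTime : Program → ℕ
  | .skip => 1
  | .setN _ i e => i.cost + e.cost + 1
  | .setR _ i e => i.cost + e.cost + 1
  | .seq c c' => c.maxTime + c'.maxTime
  | .ite b c c' => b.cost + (c.maxTime + c'.maxTime) + 1
  | .while _ _ => 0

def Program.loopFree : Program → Bool
  | .skip => true
  | .setN _ _ _ => true
  | .setR _ _ _ => true
  | .seq c c' => c.loopFree && c'.loopFree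
  | .ite _ c c' => c.loopFree && c'.loopFree
  | .while _ _ => false

/-- Loop-free code is executed symbolically: `run` is an explicit function of the memory that `simp`
can evaluate, and `maxTime` is read off the text. The values of both at `while` are junk that
`loopFree` excludes. -/
theorem Runs.of_loopFree {c : Program} {s : State} {T : ℕ} {Q : State → Prop}
    (hQ : Q (c.run s)) (h : c.loopFree = true := by rfl) (hT : c.maxTime ≤ T := by decide) :
    Runs c s T Q := by
  suffices h : ∃ t, Exec c s (c.run s) t ∧ t ≤ c.maxTime by
    obtain ⟨t, h1, h2⟩ := h
    exact ⟨_, t, h1, h2.trans hT, hQ⟩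
  clear hQ hT
  induction c generalizing s with
  | skip => exact ⟨_, .skip s, le_rfl⟩
  | setN a i e => exact ⟨_, .setN s a i e, le_rfl⟩
  | setR a i e => exact ⟨_, .setR s a i e, le_rfl⟩
  | seq c c' ih ih' =>
    simp only [Program.loopFree, Bool.and_eq_true] at h
    obtain ⟨t, h1, h2⟩ := ih (s := s) h.1
    obtain ⟨t', h1', h2'⟩ := ih' (s := c.run s) h.2
    exact ⟨_, .seq h1 h1', by simp only [Program.maxTime]; omega⟩
  | ite b c c' ih ih' =>
    simp only [Program.loopFree, Bool.and_eq_true] at h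
    simp only [Program.run, Program.maxTime]
    by_cases hb : b.holds s
    · obtain ⟨t, h1, h2⟩ := ih (s := s) h.1
      rw [if_pos hb]
      exact ⟨_, .ite_true hb h1, by omega⟩
    · obtain ⟨t, h1, h2⟩ := ih' (s := s) h.2
      rw [if_neg hb]
      exact ⟨_, .ite_false hb h1, by omega⟩
  | _ => simp [Program.loopFree] at h

/-! ### Program text -/

/-- Cell `0` of array `a`. -/
abbrev NExpr.v (a : ℕ) : NExpr := .get a (.const 0)

/-- Cell `0` of array `a`. -/
abbrev RExpr.v (a : ℕ) : RExpr := .get a (.const 0)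

abbrev RExpr.const (c : ℕ) : RExpr := .ofNat (.const c)

/-- Assignment to cell `0` of array `a`. -/
abbrev Program.letN (a : ℕ) (e : NExpr) : Program := .setN a (.const 0) e

/-- Assignment to cell `0` of array `a`. -/
abbrev Program.letR (a : ℕ) (e : RExpr) : Program := .setR a (.const 0) e

/-- Sequential composition of a list of programs. -/
def Program.block : List Program → Program
  | [] => .skip
  | [c] => c
  | c :: c' :: cs => .seq c (block (c' :: cs))

/-- Run the body for the values `e - 1, …, 0` of the counter `a`. -/
def Program.forDown (a : ℕ) (e : NExpr) (c : Program) : Program :=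
  .seq (.letN a e) (.while (.ltN (.const 0) (.v a)) (.seq (.letN a (.sub (.v a) (.const 1))) c))

/-- `Inv k` is what holds with `k` rounds to go. The counter drops before the body runs, so the body
can use it as an index; the `20` per round pays for the test and the decrement. -/
theorem Runs.forDown {a : ℕ} {e : NExpr} {c : Program} {s : State} {n T : ℕ}
    (Inv : ℕ → State → Prop) (he : e.eval s = n) (hw : c.writesN a = false)
    (hinit : Inv n (s.setN a 0 n))
    (hbody : ∀ k < n, ∀ s, Inv (k + 1) s → s.nat a 0 = k + 1 →
      Runs c (s.setN a 0 k) T (Inv k)) :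
    Runs (.forDown a e c) s (e.cost + n * (T + 20) + 20) (Inv 0) := by
  have h1 : Runs (.letN a e) s (e.cost + 2) (fun s' => s' = s.setN a 0 n) := by
    refine ⟨_, _, .setN _ _ _ _, by simp [NExpr.cost]; omega, by rw [he]; rfl⟩
  have h2 := Runs.while (b := .ltN (.const 0) (.v a))
    (c := .seq (.letN a (.sub (.v a) (.const 1))) c) (T := 6 + T) (Q := Inv 0)
    (fun k s => k ≤ n ∧ Inv k s ∧ s.nat a 0 = k) ?_ n (s.setN a 0 n)
    ⟨le_rfl, hinit, by simp [State.nat_setN]⟩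
  · refine (h1.seq (Q' := Inv 0) fun s' hs' => by rw [hs']; exact h2).mono ?_ fun _ h => h
    simp only [BExpr.cost, NExpr.cost]
    nlinarith
  · rintro k s ⟨hk, hI, ha⟩
    rcases k with _ | k
    · left
      exact ⟨by simp [BExpr.holds, NExpr.eval, ha], hI⟩
    · right
      refine ⟨by simp [BExpr.holds, NExpr.eval, ha], k, rfl, ?_⟩
      refine Runs.seq (Q := fun s' => s' = s.setN a 0 k) ?_ ?_
      · exact ⟨_, _, .setN _ _ _ _, by simp [NExpr.cost], by simp [NExpr.eval, ha]⟩
      · rintro _ rfl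
        refine (hbody k hk s hI ha).frame.mono le_rfl ?_
        rintro s' ⟨h1, h2⟩
        refine ⟨by omega, h1, ?_⟩
        rw [h2.nat a hw]
        simp [State.nat_setN]

end RealRAM

/-! ## Sums over the values of a counter -/

/-- `F` vanishes from `R` on and its values add up to `v`. -/
def PathSum (F : ℕ → ℂ) (R : ℕ) (v : ℂ) : Prop :=
  (∀ r, R ≤ r → F r = 0) ∧ ∑ r ∈ Finset.range R, F r = v

namespace PathSum

variable {F : ℕ → ℂ} {R R' : ℕ} {v : ℂ}

/-- Since the terms vanish from `R` on, any upper bound on the number of paths serves as well as the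
exact number. Branches that use different numbers of digits can thus share one range. -/
theorem mono (h : PathSum F R v) (hR : R ≤ R') : PathSum F R' v := by
  refine ⟨fun r hr => h.1 r (hR.trans hr), ?_⟩
  rw [← h.2]
  symm
  apply Finset.sum_subset
  · intro r hr
    simp only [Finset.mem_range] at *
    omega
  · intro r _ hr
    exact h.1 r (by simpa using hr)

theorem single (v : ℂ) : PathSum (fun r => if r = 0 then v else 0) 1 v :=
  ⟨fun r hr => if_neg (by omega), by simp⟩

theorem sum_range_mul (F : ℕ → ℂ) (b R : ℕ) :
    ∑ r ∈ Finset.range (b * R), F r =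
      ∑ a ∈ Finset.range b, ∑ q ∈ Finset.range R, F (b * q + a) := by
  induction R with
  | zero => simp
  | succ R ih =>
    rw [Nat.mul_succ, Finset.sum_range_add, ih, ← Finset.sum_add_distrib]
    refine Finset.sum_congr rfl fun a _ => ?_
    rw [Finset.sum_range_succ]

/-- The first digit in base `b` selects one of `b` sums. -/
theorem digit {b : ℕ} (hb : 0 < b) {G : ℕ → ℕ → ℂ} {w : ℕ → ℂ}
    (hF : ∀ r, F r = G (r % b) (r / b)) (h : ∀ a < b, PathSum (G a) R (w a)) :
    PathSum F (b * R) (∑ a ∈ Finset.range b, w a) := by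
  constructor
  · intro r hr
    rw [hF]
    exact (h _ (Nat.mod_lt _ hb)).1 _ ((Nat.le_div_iff_mul_le hb).2 (by rwa [mul_comm]))
  · rw [sum_range_mul]
    refine Finset.sum_congr rfl fun a ha => ?_
    rw [Finset.mem_range] at ha
    rw [← (h a ha).2]
    refine Finset.sum_congr rfl fun q _ => ?_
    rw [hF, Nat.mul_add_mod, Nat.mod_eq_of_lt ha, Nat.mul_add_div hb, Nat.div_eq_of_lt ha, add_zero]

/-- The first bit selects one of two sums. -/
theorem bit {G : Fin 2 → ℕ → ℂ} {w : Fin 2 → ℂ}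
    (hF : ∀ r, F r = G (Fin.ofNat 2 r) (r / 2)) (h : ∀ a, PathSum (G a) R (w a)) :
    PathSum F (2 * R) (∑ a, w a) := by
  have := digit (F := F) (R := R) two_pos (G := fun a => G (Fin.ofNat 2 a))
    (w := fun a => w (Fin.ofNat 2 a)) (fun r => by rw [hF]; congr 1; ext; simp)
    (fun a _ => h _)
  rw [Finset.sum_range, Fin.sum_univ_two] at this
  rwa [Fin.sum_univ_two]

end PathSum

/-! ### Configurations of the path sum and the operations on them. -/

namespace QCircuit

open Matrix

variable {n : ℕ}

/-- A configuration of the path sum: the remaining counter, the marked qubits, the row and column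
indices of the current matrix unit on the marked qubits, and the amplitude. -/
structure Cfg where
  r : ℕ
  mark : Finset ℕ
  x : ℕ → Fin 2
  y : ℕ → Fin 2
  amp : ℂ

namespace Cfg

/-- Mark a qubit; the identity is expanded into the sum of the two diagonal matrix units. -/
def fresh (k : ℕ) (c : Cfg) : Cfg :=
  if k ∈ c.mark then c else
    { r := c.r / 2, mark := insert k c.mark, x := Function.update c.x k (Fin.ofNat 2 c.r),
      y := Function.update c.y k (Fin.ofNat 2 c.r), amp := c.amp }

/-- Multiply the matrix unit by `Mᴴ` from the left. -/
def rowOne (M : Matrix (Fin 2) (Fin 2) ℂ) (k : ℕ) (c : Cfg) : Cfg :=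
  { c with r := c.r / 2, x := Function.update c.x k (Fin.ofNat 2 c.r),
           amp := c.amp * star (M (c.x k) (Fin.ofNat 2 c.r)) }

/-- Multiply the matrix unit by `M` from the right. -/
def colOne (M : Matrix (Fin 2) (Fin 2) ℂ) (k : ℕ) (c : Cfg) : Cfg :=
  { c with r := c.r / 2, y := Function.update c.y k (Fin.ofNat 2 c.r),
           amp := c.amp * M (c.y k) (Fin.ofNat 2 c.r) }

def rowTwo (M : Matrix (Fin 2 × Fin 2) (Fin 2 × Fin 2) ℂ) (i j : ℕ) (c : Cfg) : Cfg :=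
  { c with
    r := c.r / 2 / 2
    x := Function.update (Function.update c.x i (Fin.ofNat 2 c.r)) j (Fin.ofNat 2 (c.r / 2))
    amp := c.amp * star (M (c.x i, c.x j) (Fin.ofNat 2 c.r, Fin.ofNat 2 (c.r / 2))) }

def colTwo (M : Matrix (Fin 2 × Fin 2) (Fin 2 × Fin 2) ℂ) (i j : ℕ) (c : Cfg) : Cfg :=
  { c with
    r := c.r / 2 / 2
    y := Function.update (Function.update c.y i (Fin.ofNat 2 c.r)) j (Fin.ofNat 2 (c.r / 2))
    amp := c.amp * M (c.y i, c.y j) (Fin.ofNat 2 c.r, Fin.ofNat 2 (c.r / 2)) }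

/-- Conjugate the matrix unit by a gate; a gate that meets no marked qubit cancels. -/
def gate (g : Gate n) (c : Cfg) : Cfg :=
  match g with
  | .one i M => if (i : ℕ) ∈ c.mark then (c.rowOne M.1 i).colOne M.1 i else c
  | .two i j _ M =>
      if (i : ℕ) ∈ c.mark ∨ (j : ℕ) ∈ c.mark then
        (((c.fresh i).fresh j).rowTwo M.1 i j).colTwo M.1 i j
      else c

def scale (w : ℝ) (c : Cfg) : Cfg := { c with amp := c.amp * w }

/-- The defect `1 - Oᴴ O`. -/
noncomputable def _root_.QCircuit.defect (O : Matrix (Fin 2) (Fin 2) ℂ) : Matrix (Fin 2) (Fin 2) ℂ :=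
  1 - Oᴴ * O

/-- One qubit of the channel with Kraus operators `O` and `√(1 - Oᴴ O)`; if the ancilla `n + k` is
marked then only the second one is used. -/
noncomputable def kraus (n : ℕ) (O : Matrix (Fin 2) (Fin 2) ℂ) (k : ℕ) (c : Cfg) : Cfg :=
  if k ∈ c.mark ∨ n + k ∈ c.mark then
    let c₁ := c.fresh k
    if n + k ∈ c₁.mark then
      ((c₁.rowOne (defect O) k).colOne (defect O) k).scale (1 / (defect O).trace.re)
    else
      let c₂ : Cfg := { c₁ with r := c₁.r / 2 }
      if c₁.r % 2 = 0 then (c₂.rowOne O k).colOne O k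
      else ((c₂.rowOne (defect O) k).colOne (defect O) k).scale (1 / (defect O).trace.re)
  else c

/-- The contribution of a path: the `⟨0ⁿ|·|0ⁿ⟩` element of its matrix unit. -/
noncomputable def final (n : ℕ) (c : Cfg) : ℂ :=
  -- A nonzero rest of the counter means that its value lies beyond the digits this path consumes;
  -- counting it would repeat a path.
  if c.r = 0 then if ∀ k < n, k ∈ c.mark → c.x k = 0 ∧ c.y k = 0 then c.amp else 0 else 0

/-- Restrict to the event that bit `q` is one. -/
def project (q : ℕ) (c : Cfg) : Cfg :=
  { c with mark := insert q c.mark, x := Function.update c.x q 1, y := Function.update c.y q 1 }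

/-- One factor `1 - H / (k + 1)`, where `H` counts the ones among `N` bits. -/
noncomputable def linear (N k : ℕ) (c : Cfg) : Cfg :=
  -- Digit zero is the constant term, digit `q + 1` the contribution of bit `q` to `H`.
  let c₁ : Cfg := { c with r := c.r / (N + 1) }
  if c.r % (N + 1) = 0 then c₁ else (c₁.project (c.r % (N + 1) - 1)).scale (-1 / (k + 1))

/-- The Chebyshev polynomial of degree `k` at `y₀ - H / N`, by its three-term recurrence. -/
noncomputable def cheb (N : ℕ) (y₀ : ℝ) (k : ℕ) (c : Cfg) : Cfg :=
  if k = 0 then c else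
    let a := c.r % (N + 2)
    let c₁ : Cfg := { c with r := c.r / (N + 2) }
    -- From degree two on, the recurrence has the weights `2` and `1 - 2 = -1`. In degree one they
    -- are `1` and `0`, so that the truncated index `k - 2` in the last branch does no harm.
    let w : ℝ := if k < 2 then 1 else 2
    if a = 0 then cheb N y₀ (k - 1) (c₁.scale (w * y₀))
    else if a < N + 1 then cheb N y₀ (k - 1) ((c₁.project (a - 1)).scale (-w / N))
    else cheb N y₀ (k - 2) (c₁.scale (1 - w))
termination_by k

end Cfg

/-- The inverse gate. -/
noncomputable def Gate.inv : Gate n → Gate n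
  | .one i M => .one i (star M)
  | .two i j h M => .two i j h (star M)

end QCircuit

namespace QCircuit

open Matrix

variable {n : ℕ}

/-! ### Tensor products of one-qubit operators -/

theorem tensor_mul (A B : Fin n → Matrix (Fin 2) (Fin 2) ℂ) :
    tensor A * tensor B = tensor fun j => A j * B j := by
  ext u v
  simp only [Matrix.mul_apply, tensor]
  rw [Finset.prod_univ_sum, Fintype.piFinset_univ]
  exact Finset.sum_congr rfl fun z _ => Finset.prod_mul_distrib.symm

theorem tensor_one : tensor (fun _ : Fin n => (1 : Matrix (Fin 2) (Fin 2) ℂ)) = 1 := by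
  ext u v
  by_cases h : u = v
  · subst h; simp [tensor]
  · obtain ⟨j, hj⟩ := Function.ne_iff.1 h
    rw [Matrix.one_apply_ne h]
    exact Finset.prod_eq_zero (Finset.mem_univ j) (Matrix.one_apply_ne hj)

theorem tensor_conjTranspose (A : Fin n → Matrix (Fin 2) (Fin 2) ℂ) :
    (tensor A)ᴴ = tensor fun j => (A j)ᴴ := by
  ext u v
  simp [tensor, Matrix.conjTranspose_apply]

theorem tensor_update_apply (B : Fin n → Matrix (Fin 2) (Fin 2) ℂ) (k : Fin n)
    (b : Matrix (Fin 2) (Fin 2) ℂ) (u v : Fin n → Fin 2) :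
    tensor (Function.update B k b) u v =
      b (u k) (v k) * ∏ j ∈ Finset.univ.erase k, B j (u j) (v j) := by
  unfold tensor
  rw [← Finset.mul_prod_erase _ _ (Finset.mem_univ k)]
  simp only [Function.update_self]
  congr 1
  refine Finset.prod_congr rfl fun j hj => ?_
  rw [Function.update_of_ne (Finset.ne_of_mem_erase hj)]

/-- The tensor product as a linear function of its factor `k`. -/
noncomputable def tensorSlot (B : Fin n → Matrix (Fin 2) (Fin 2) ℂ) (k : Fin n) :
    Matrix (Fin 2) (Fin 2) ℂ →ₗ[ℂ] Op n where
  toFun b := tensor (Function.update B k b)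
  map_add' a b := by
    ext u v
    simp [tensor_update_apply, add_mul]
  map_smul' a b := by
    ext u v
    simp [tensor_update_apply, mul_assoc]

theorem tensorSlot_apply (B : Fin n → Matrix (Fin 2) (Fin 2) ℂ) (k : Fin n)
    (b : Matrix (Fin 2) (Fin 2) ℂ) : tensorSlot B k b = tensor (Function.update B k b) := rfl

theorem sum_piFinset_tensor (S : Fin n → Finset (Fin 2))
    (A : Fin n → Fin 2 → Matrix (Fin 2) (Fin 2) ℂ) :
    ∑ a ∈ Fintype.piFinset S, tensor (fun j => A j (a j)) = tensor fun j => ∑ a ∈ S j, A j a := by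
  ext u v
  simp only [Matrix.sum_apply, tensor]
  rw [Finset.prod_univ_sum]

theorem prod_erase_erase_congr {i j : Fin n} {f g : Fin n → ℂ}
    (h : ∀ k, k ≠ i → k ≠ j → f k = g k) :
    ∏ k ∈ (Finset.univ.erase i).erase j, f k = ∏ k ∈ (Finset.univ.erase i).erase j, g k :=
  Finset.prod_congr rfl fun k hk => by
    simp only [Finset.mem_erase] at hk
    exact h k hk.2.1 hk.1

theorem tensor_apply_two (F : Fin n → Matrix (Fin 2) (Fin 2) ℂ) {i j : Fin n} (hij : i ≠ j)
    (u v : Fin n → Fin 2) :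
    tensor F u v = F i (u i) (v i) * (F j (u j) (v j) *
      ∏ k ∈ (Finset.univ.erase i).erase j, F k (u k) (v k)) := by
  have h1 := Finset.mul_prod_erase Finset.univ (fun k => F k (u k) (v k)) (Finset.mem_univ i)
  have h2 := Finset.mul_prod_erase (Finset.univ.erase i) (fun k => F k (u k) (v k))
    (by simp [hij.symm] : j ∈ Finset.univ.erase i)
  exact (h1.symm.trans (congrArg _ h2.symm))

/-! ### Conjugation by gates -/

theorem op_one_eq (i : Fin n) (M : unitaryGroup (Fin 2) ℂ) :
    (Gate.one i M).op = tensor (Function.update (fun _ => 1) i M.1) := by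
  ext u v
  rw [tensor_update_apply]
  simp only [Gate.op]
  by_cases h : ∀ k, k ≠ i → u k = v k
  · rw [if_pos h, Finset.prod_eq_one, mul_one]
    intro k hk
    rw [h k (Finset.ne_of_mem_erase hk), Matrix.one_apply_eq]
  · rw [if_neg h]
    push Not at h
    obtain ⟨k, hk, hk'⟩ := h
    have h0 : (1 : Matrix (Fin 2) (Fin 2) ℂ) (u k) (v k) = 0 := Matrix.one_apply_ne hk'
    have := Finset.prod_eq_zero (f := fun k => (1 : Matrix (Fin 2) (Fin 2) ℂ) (u k) (v k))
      (Finset.mem_erase.2 ⟨hk, Finset.mem_univ k⟩) h0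
    rw [this, mul_zero]

theorem tensor_conj_update (F : Fin n → Matrix (Fin 2) (Fin 2) ℂ) (i : Fin n)
    (M : Matrix (Fin 2) (Fin 2) ℂ) :
    (tensor (Function.update (fun _ => 1) i M))ᴴ * tensor F *
      tensor (Function.update (fun _ => 1) i M) =
      tensor (Function.update F i (Mᴴ * F i * M)) := by
  rw [tensor_conjTranspose, tensor_mul, tensor_mul]
  congr 1
  funext k
  by_cases hk : k = i
  · subst hk; simp
  · simp [hk]

/-- Strings that agree with `v` off `i` and `j` are determined by two bits, which leaves four terms.
-/
theorem sum_agree_two {i j : Fin n} (hij : i ≠ j) (v : Fin n → Fin 2)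
    (f : (Fin n → Fin 2) → ℂ) :
    ∑ z, (if ∀ k, k ≠ i → k ≠ j → z k = v k then f z else 0) =
      ∑ t : Fin 2 × Fin 2, f (Function.update (Function.update v i t.1) j t.2) := by
  rw [← Finset.sum_filter]
  refine Finset.sum_nbij' (fun z => (z i, z j))
    (fun t => Function.update (Function.update v i t.1) j t.2) (by simp) ?_ ?_ ?_ ?_
  · intro t _
    simp only [Finset.mem_filter, Finset.mem_univ, true_and]
    intro k hi hj
    simp [hi, hj]
  · intro z hz
    simp only [Finset.mem_filter, Finset.mem_univ, true_and] at hz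
    funext k
    by_cases hj : k = j
    · subst hj; simp
    · by_cases hi : k = i
      · subst hi; simp [hj]
      · simp [hi, hj, hz k hi hj]
  · rintro ⟨a, b⟩ _
    simp [hij]
  · intro z hz
    simp only [Finset.mem_filter, Finset.mem_univ, true_and] at hz
    congr 1
    funext k
    by_cases hj : k = j
    · subst hj; simp
    · by_cases hi : k = i
      · subst hi; simp [hj]
      · simp [hi, hj, hz k hi hj]

/-- The gate entangles two slots, so the result is not a product operator; but each entry still
splits into a sum on the qubits `i`, `j` and the unchanged product over the others. -/
theorem conj_two_apply {i j : Fin n} (hij : i ≠ j) (M : unitaryGroup (Fin 2 × Fin 2) ℂ)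
    (F : Fin n → Matrix (Fin 2) (Fin 2) ℂ) (u v : Fin n → Fin 2) :
    ((Gate.two i j hij M).opᴴ * tensor F * (Gate.two i j hij M).op) u v =
      (∑ t : Fin 2 × Fin 2, ∑ s : Fin 2 × Fin 2, star (M.1 s (u i, u j)) *
        (F i s.1 t.1 * F j s.2 t.2) * M.1 t (v i, v j)) *
      ∏ k ∈ (Finset.univ.erase i).erase j, F k (u k) (v k) := by
  have h1 : ∀ (A : Op n) (w : Fin n → Fin 2), (A * (Gate.two i j hij M).op) w v =
      ∑ t : Fin 2 × Fin 2, A w (Function.update (Function.update v i t.1) j t.2) *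
        M.1 t (v i, v j) := by
    intro A w
    rw [Matrix.mul_apply]
    refine (Finset.sum_congr rfl fun z _ => ?_).trans
      ((sum_agree_two hij v fun z => A w z * M.1 (z i, z j) (v i, v j)).trans
        (Finset.sum_congr rfl fun t _ => ?_))
    · simp only [Gate.op]
      split_ifs <;> simp
    · simp [hij]
  have h2 : ∀ (A : Op n) (w : Fin n → Fin 2), ((Gate.two i j hij M).opᴴ * A) u w =
      ∑ s : Fin 2 × Fin 2, star (M.1 s (u i, u j)) *
        A (Function.update (Function.update u i s.1) j s.2) w := by
    intro A w
    rw [Matrix.mul_apply]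
    refine (Finset.sum_congr rfl fun z _ => ?_).trans
      ((sum_agree_two hij u fun z => star (M.1 (z i, z j) (u i, u j)) * A z w).trans
        (Finset.sum_congr rfl fun t _ => ?_))
    · rw [Matrix.conjTranspose_apply]
      simp only [Gate.op]
      split_ifs <;> simp
    · simp [hij]
  rw [h1, Finset.sum_mul]
  refine Finset.sum_congr rfl fun t _ => ?_
  rw [h2, Finset.sum_mul, Finset.sum_mul]
  refine Finset.sum_congr rfl fun s _ => ?_
  rw [tensor_apply_two F hij]
  simp only [Function.update_self, ne_eq, hij, not_false_eq_true, Function.update_of_ne]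
  rw [prod_erase_erase_congr (g := fun k => F k (u k) (v k))]
  · ring
  · intro k hi hj
    simp [hi, hj]

/-- A gate cancels if its qubits carry the identity. -/
theorem conj_untouched (g : Gate n) (F : Fin n → Matrix (Fin 2) (Fin 2) ℂ)
    (hF : ∀ k ∈ g.qubits, F k = 1) : g.opᴴ * tensor F * g.op = tensor F := by
  cases g with
  | one i M =>
    have hi : F i = 1 := hF i (by simp [Gate.qubits])
    rw [op_one_eq, tensor_conj_update, hi, mul_one]
    have : M.1ᴴ * M.1 = 1 := Matrix.mem_unitaryGroup_iff'.1 M.2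
    rw [this, ← hi, Function.update_eq_self]
  | two i j hij M =>
    have hi : F i = 1 := hF i (by simp [Gate.qubits])
    have hj : F j = 1 := hF j (by simp [Gate.qubits])
    ext u v
    rw [conj_two_apply, tensor_apply_two F hij, ← mul_assoc]
    congr 1
    have hM : M.1ᴴ * M.1 = 1 := Matrix.mem_unitaryGroup_iff'.1 M.2
    have := congrFun (congrFun hM (u i, u j)) (v i, v j)
    rw [Matrix.mul_apply] at this
    rw [hi, hj]
    have h3 : ∀ s t : Fin 2 × Fin 2, (1 : Matrix (Fin 2) (Fin 2) ℂ) s.1 t.1 *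
        (1 : Matrix (Fin 2) (Fin 2) ℂ) s.2 t.2 = if s = t then 1 else 0 := by
      rintro ⟨a, b⟩ ⟨c, d⟩
      simp only [Matrix.one_apply, Prod.mk.injEq]
      split_ifs <;> simp_all
    rw [h3 (u i, u j) (v i, v j), ← Matrix.one_apply, ← this]
    refine Finset.sum_congr rfl fun t _ => ?_
    rw [Finset.sum_eq_single t]
    · rw [h3]; simp [Matrix.conjTranspose_apply]
    · intro s _ hs
      rw [h3, if_neg hs]; simp
    · simp

theorem op_gate_unitary (g : Gate n) : g.opᴴ * g.op = 1 := by
  have := conj_untouched g (fun _ => 1) fun _ _ => rfl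
  rwa [tensor_one, mul_one] at this

theorem op_inv (g : Gate n) : g.inv.op = g.opᴴ := by
  cases g with
  | one i M =>
    ext u v
    rw [Matrix.conjTranspose_apply]
    simp only [Gate.inv, Gate.op, eq_comm (a := u _)]
    split_ifs <;> simp [Unitary.coe_star, Matrix.star_apply]
  | two i j h M =>
    ext u v
    rw [Matrix.conjTranspose_apply]
    simp only [Gate.inv, Gate.op, eq_comm (a := u _)]
    split_ifs <;> simp [Unitary.coe_star, Matrix.star_apply]

theorem qubits_inv (g : Gate n) : g.inv.qubits = g.qubits := by
  cases g <;> rfl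

/-! ### Path sums of configurations -/

namespace Cfg

/-- The tensor factors of the operator of a configuration. -/
noncomputable def slots (n : ℕ) (c : Cfg) (k : Fin n) : Matrix (Fin 2) (Fin 2) ℂ :=
  if (k : ℕ) ∈ c.mark then Matrix.single (c.x k) (c.y k) 1 else 1

/-- The matrix unit on the marked qubits, tensored with the identity. -/
noncomputable def op (n : ℕ) (c : Cfg) : Op n := tensor (c.slots n)

/-- The values of `K` over all values of the counter of `c` add up to `v`. -/
def Sums (K : Cfg → ℂ) (R : ℕ) (c : Cfg) (v : ℂ) : Prop :=
  PathSum (fun r => K { c with r := r }) R v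

theorem Sums.mono {K : Cfg → ℂ} {R R' : ℕ} {c : Cfg} {v : ℂ} (h : Sums K R c v) (hR : R ≤ R') :
    Sums K R' c v := PathSum.mono h hR

variable {K : Cfg → ℂ} {R : ℕ} {c : Cfg}

theorem op_final (n : ℕ) (c : Cfg) :
    c.op n 0 0 = if ∀ k < n, k ∈ c.mark → c.x k = 0 ∧ c.y k = 0 then 1 else 0 := by
  unfold op tensor
  split_ifs with h0
  · refine Finset.prod_eq_one fun k _ => ?_
    unfold slots
    split_ifs with hk
    · obtain ⟨h1, h2⟩ := h0 k k.2 hk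
      simp [h1, h2]
    · simp
  · push Not at h0
    obtain ⟨k, hk, hk', hne⟩ := h0
    refine Finset.prod_eq_zero (Finset.mem_univ (⟨k, hk⟩ : Fin n)) ?_
    simp only [slots, hk', if_true]
    rw [Matrix.single_apply, if_neg]
    rintro ⟨h1, h2⟩
    exact hne h1 h2

/-- Mark qubit `k` with the diagonal matrix unit `b`. -/
def diag (k : ℕ) (b : Fin 2) (c : Cfg) : Cfg :=
  { c with
    mark := insert k c.mark
    x := Function.update c.x k b
    y := Function.update c.y k b }

/-- An unmarked slot carries the identity, which is the sum of two diagonal matrix units, so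
additivity of `L` in that one slot suffices. A slot that is already marked consumes no bit; the
range is then merely too large. A general `L` is needed because the channels act slot by slot before
any functional of the whole operator is applied. -/
theorem Sums.fresh {k : ℕ} (hk : k < n) {L : (Fin n → Matrix (Fin 2) (Fin 2) ℂ) → ℂ}
    (hL : ∀ B b b', L (Function.update B ⟨k, hk⟩ (b + b')) =
      L (Function.update B ⟨k, hk⟩ b) + L (Function.update B ⟨k, hk⟩ b'))
    (h : ∀ c' : Cfg, c'.mark = insert k c.mark → c'.amp = c.amp →
      Sums K R c' (c'.amp * L (c'.slots n))) :
    Sums (fun c => K (c.fresh k)) (2 * R) c (c.amp * L (c.slots n)) := by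
  by_cases hm : k ∈ c.mark
  · have : Sums K R c (c.amp * L (c.slots n)) := h c (by simp [hm]) rfl
    simpa [Cfg.fresh, hm, Sums] using this.mono (by omega)
  · have e : c.amp * L (c.slots n) = ∑ b : Fin 2, c.amp * L ((c.diag k b).slots n) := by
      rw [Fin.sum_univ_two, ← mul_add]
      congr 1
      have hs : ∀ b : Fin 2, (c.diag k b).slots n = Function.update (c.slots n) ⟨k, hk⟩ (Matrix.single b b 1) := by
        intro b
        funext j
        by_cases hj : j = ⟨k, hk⟩
        · subst hj; simp [slots, diag]
        · have : (j : ℕ) ≠ k := fun h => hj (Fin.ext h)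
          simp [slots, diag, hj, this]
      rw [hs, hs, ← hL]
      congr 1
      have : (Matrix.single 0 0 1 + Matrix.single 1 1 1 : Matrix (Fin 2) (Fin 2) ℂ) =
          c.slots n ⟨k, hk⟩ := by
        simp only [slots, hm, if_false]
        ext a b
        fin_cases a <;> fin_cases b <;> simp
      rw [this, Function.update_eq_self]
    rw [e]
    refine PathSum.bit (G := fun b q => K { c.diag k b with r := q }) ?_ fun b =>
      h (c.diag k b) rfl rfl
    intro r
    simp [Cfg.fresh, Cfg.diag, hm]

theorem Sums.rowOne {M : Matrix (Fin 2) (Fin 2) ℂ} {k : ℕ} {w : Fin 2 → ℂ}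
    (h : ∀ b, Sums K R { c with x := Function.update c.x k b, amp := c.amp * star (M (c.x k) b) }
      (w b)) : Sums (fun c => K (c.rowOne M k)) (2 * R) c (∑ b, w b) :=
  PathSum.bit (G := fun b q => K { c with
    r := q, x := Function.update c.x k b, amp := c.amp * star (M (c.x k) b) }) (fun _ => rfl) h

theorem Sums.colOne {M : Matrix (Fin 2) (Fin 2) ℂ} {k : ℕ} {w : Fin 2 → ℂ}
    (h : ∀ b, Sums K R { c with y := Function.update c.y k b, amp := c.amp * M (c.y k) b }
      (w b)) : Sums (fun c => K (c.colOne M k)) (2 * R) c (∑ b, w b) :=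
  PathSum.bit (G := fun b q => K { c with
    r := q, y := Function.update c.y k b, amp := c.amp * M (c.y k) b }) (fun _ => rfl) h

theorem Sums.rowTwo {M : Matrix (Fin 2 × Fin 2) (Fin 2 × Fin 2) ℂ} {i j : ℕ}
    {w : Fin 2 → Fin 2 → ℂ}
    (h : ∀ a b, Sums K R { c with
      x := Function.update (Function.update c.x i a) j b
      amp := c.amp * star (M (c.x i, c.x j) (a, b)) } (w a b)) :
    Sums (fun c => K (c.rowTwo M i j)) (4 * R) c (∑ a, ∑ b, w a b) := by
  rw [show 4 * R = 2 * (2 * R) by ring]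
  exact PathSum.bit (G := fun a q => K { c with
      r := q / 2
      x := Function.update (Function.update c.x i a) j (Fin.ofNat 2 q)
      amp := c.amp * star (M (c.x i, c.x j) (a, Fin.ofNat 2 q)) }) (fun _ => rfl) fun a =>
    PathSum.bit (G := fun b q => K { c with
      r := q
      x := Function.update (Function.update c.x i a) j b
      amp := c.amp * star (M (c.x i, c.x j) (a, b)) }) (fun _ => rfl) fun b => h a b

theorem Sums.colTwo {M : Matrix (Fin 2 × Fin 2) (Fin 2 × Fin 2) ℂ} {i j : ℕ}
    {w : Fin 2 → Fin 2 → ℂ}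
    (h : ∀ a b, Sums K R { c with
      y := Function.update (Function.update c.y i a) j b
      amp := c.amp * M (c.y i, c.y j) (a, b) } (w a b)) :
    Sums (fun c => K (c.colTwo M i j)) (4 * R) c (∑ a, ∑ b, w a b) := by
  rw [show 4 * R = 2 * (2 * R) by ring]
  exact PathSum.bit (G := fun a q => K { c with
      r := q / 2
      y := Function.update (Function.update c.y i a) j (Fin.ofNat 2 q)
      amp := c.amp * M (c.y i, c.y j) (a, Fin.ofNat 2 q) }) (fun _ => rfl) fun a =>
    PathSum.bit (G := fun b q => K { c with
      r := q
      y := Function.update (Function.update c.y i a) j b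
      amp := c.amp * M (c.y i, c.y j) (a, b) }) (fun _ => rfl) fun b => h a b

theorem mul_single_mul (M M' : Matrix (Fin 2) (Fin 2) ℂ) (x y : Fin 2) :
    Mᴴ * Matrix.single x y 1 * M' =
      ∑ a, ∑ b, (star (M x a) * M' y b) • Matrix.single a b (1 : ℂ) := by
  ext s t
  fin_cases x <;> fin_cases y <;> fin_cases s <;> fin_cases t <;>
    simp [Matrix.mul_apply, Fin.sum_univ_two, Matrix.single_apply]

/-- Conjugation of a marked qubit by a one-qubit operator. -/
theorem Sums.conjOne {M : Matrix (Fin 2) (Fin 2) ℂ} {k : ℕ} (hk : k < n) (hm : k ∈ c.mark)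
    {L : (Fin n → Matrix (Fin 2) (Fin 2) ℂ) → ℂ}
    (l : Matrix (Fin 2) (Fin 2) ℂ →ₗ[ℂ] ℂ)
    (hl : ∀ b, l b = L (Function.update (c.slots n) ⟨k, hk⟩ b))
    (h : ∀ c' : Cfg, c'.mark = c.mark → (∀ j, j ≠ k → c'.x j = c.x j ∧ c'.y j = c.y j) →
      Sums K R c' (c'.amp * L (c'.slots n))) :
    Sums (fun c => K ((c.rowOne M k).colOne M k)) (4 * R) c
      (c.amp * l (Mᴴ * c.slots n ⟨k, hk⟩ * M)) := by
  have hs : c.slots n ⟨k, hk⟩ = Matrix.single (c.x k) (c.y k) 1 := by simp [slots, hm]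
  rw [hs, mul_single_mul, map_sum, Finset.mul_sum, show 4 * R = 2 * (2 * R) by ring]
  refine Sums.rowOne (K := fun c => K (c.colOne M k)) fun a => ?_
  rw [map_sum, Finset.mul_sum]
  refine Sums.colOne fun b => ?_
  rw [map_smul, hl, smul_eq_mul, ← mul_assoc, ← mul_assoc]
  have := h { c with
    x := Function.update c.x k a
    y := Function.update c.y k b
    amp := c.amp * star (M (c.x k) a) * M (c.y k) b } rfl
    (by intro j hj; simp [hj])
  convert this using 3
  funext j
  by_cases hj : j = ⟨k, hk⟩
  · subst hj; simp [slots, hm]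
  · have : (j : ℕ) ≠ k := fun h => hj (Fin.ext h)
    simp [slots, hj, this]

/-- The qubits of a gate as natural numbers. -/
def _root_.QCircuit.Gate.support (g : Gate n) : Finset ℕ := g.qubits.map Fin.valEmbedding

theorem _root_.QCircuit.Gate.mem_support {g : Gate n} {k : ℕ} :
    k ∈ g.support ↔ ∃ h : k < n, (⟨k, h⟩ : Fin n) ∈ g.qubits := by
  simp only [Gate.support, Finset.mem_map, Fin.valEmbedding_apply]
  constructor
  · rintro ⟨a, ha, rfl⟩
    exact ⟨a.2, ha⟩
  · rintro ⟨h, hk⟩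
    exact ⟨_, hk, rfl⟩

theorem gate_eq_self (g : Gate n) (h : Disjoint g.support c.mark) : c.gate g = c := by
  rw [Finset.disjoint_left] at h
  cases g with
  | one i M =>
    have hi : (i : ℕ) ∉ c.mark := h (Gate.mem_support.2 ⟨i.2, by simp [Gate.qubits]⟩)
    simp [gate, hi]
  | two i j hij M =>
    have hi : (i : ℕ) ∉ c.mark := h (Gate.mem_support.2 ⟨i.2, by simp [Gate.qubits]⟩)
    have hj : (j : ℕ) ∉ c.mark := h (Gate.mem_support.2 ⟨j.2, by simp [Gate.qubits]⟩)
    simp [gate, hi, hj]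

theorem conj_op_untouched (g : Gate n) (h : Disjoint g.support c.mark) :
    g.opᴴ * c.op n * g.op = c.op n := by
  refine conj_untouched g _ fun k hk => ?_
  have : (k : ℕ) ∉ c.mark := Finset.disjoint_left.1 h (Gate.mem_support.2 ⟨k.2, hk⟩)
  simp [slots, this]

/-- The tests are nested so that the variable of the innermost sum is tested outermost, the shape
that `Finset.sum_ite_eq` collapses. -/
theorem mul_ite_and_mul {p q p' q' : Prop} [Decidable p] [Decidable q] [Decidable p']
    [Decidable q'] (a : ℂ) :
    a * (if p ∧ q then 1 else 0) * (if p' ∧ q' then 1 else 0) =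
      if p' then if p then if q' then if q then a else 0 else 0 else 0 else 0 := by
  by_cases p <;> by_cases q <;> by_cases p' <;> by_cases q' <;> simp [*]

/-- With both qubits marked, conjugation of a matrix unit gives a combination of sixteen matrix
units whose coefficients factor into a row entry and a column entry. This is what lets rows and
columns be chosen by separate digits. -/
theorem conj_two_op {i j : Fin n} (hij : i ≠ j) (M : unitaryGroup (Fin 2 × Fin 2) ℂ)
    (hi : (i : ℕ) ∈ c.mark) (hj : (j : ℕ) ∈ c.mark) :
    (Gate.two i j hij M).opᴴ * c.op n * (Gate.two i j hij M).op =
      ∑ a, ∑ b, ∑ a', ∑ b', (star (M.1 (c.x i, c.x j) (a, b)) * M.1 (c.y i, c.y j) (a', b')) •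
        ({ c with
          x := Function.update (Function.update c.x i a) j b
          y := Function.update (Function.update c.y i a') j b' } : Cfg).op n := by
  ext u v
  have hij' : (i : ℕ) ≠ j := fun h => hij (Fin.ext h)
  unfold op
  rw [conj_two_apply]
  simp only [Matrix.sum_apply, Matrix.smul_apply, smul_eq_mul]
  have hr : ∀ a b a' b' : Fin 2, tensor (({ c with
          x := Function.update (Function.update c.x i a) j b
          y := Function.update (Function.update c.y i a') j b' } : Cfg).slots n) u v =
      (if (a = u i ∧ a' = v i) ∧ (b = u j ∧ b' = v j) then 1 else 0) *
        ∏ k ∈ (Finset.univ.erase i).erase j, c.slots n k (u k) (v k) := by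
    intro a b a' b'
    rw [tensor_apply_two _ hij, prod_erase_erase_congr (g := fun k => c.slots n k (u k) (v k)),
      ← mul_assoc]
    · congr 1
      simp only [slots, hi, hj, if_true, Function.update_self, ne_eq, hij', not_false_eq_true,
        Function.update_of_ne, Matrix.single_apply]
      split_ifs <;> simp_all
    · intro k hki hkj
      have h1 : (k : ℕ) ≠ i := fun h => hki (Fin.ext h)
      have h2 : (k : ℕ) ≠ j := fun h => hkj (Fin.ext h)
      simp [slots, h1, h2]
  simp only [hr, ← mul_assoc, ← Finset.sum_mul]
  congr 1
  simp only [slots, hi, hj, if_true, Fintype.sum_prod_type, Matrix.single_apply]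
  generalize c.x i = x₁
  generalize c.x j = x₂
  generalize c.y i = y₁
  generalize c.y j = y₂
  generalize u i = u₁
  generalize u j = u₂
  generalize v i = v₁
  generalize v j = v₂
  have e2 : ∀ a b a' b' : Fin 2, star (M.1 (x₁, x₂) (a, b)) * M.1 (y₁, y₂) (a', b') *
      (if (a = u₁ ∧ a' = v₁) ∧ b = u₂ ∧ b' = v₂ then 1 else 0) =
      if b' = v₂ then if a' = v₁ then if b = u₂ then if a = u₁ then
        star (M.1 (x₁, x₂) (a, b)) * M.1 (y₁, y₂) (a', b') else 0 else 0 else 0 else 0 := by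
    intro a b a' b'
    generalize star (M.1 (x₁, x₂) (a, b)) * M.1 (y₁, y₂) (a', b') = w
    by_cases h1 : a = u₁ <;> by_cases h2 : b = u₂ <;> by_cases h3 : a' = v₁ <;>
      by_cases h4 : b' = v₂ <;> simp [h1, h2, h3, h4]
  simp only [e2, mul_ite_and_mul]
  simp only [Finset.sum_ite_eq, Finset.sum_ite_eq', Finset.mem_univ, if_true, ite_mul, zero_mul]

/-- Conjugation by a gate that meets a marked qubit. -/
theorem Sums.gate (ρ : Op n →ₗ[ℂ] ℂ) (g : Gate n) (hg : ¬ Disjoint g.support c.mark)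
    (h : ∀ c' : Cfg, c'.mark = g.support ∪ c.mark → Sums K R c' (c'.amp * ρ (c'.op n))) :
    Sums (fun c => K (c.gate g)) (64 * R) c (c.amp * ρ (g.opᴴ * c.op n * g.op)) := by
  cases g with
  | one i M =>
    have hi : (i : ℕ) ∈ c.mark := by
      rw [Finset.not_disjoint_iff] at hg
      obtain ⟨k, h1, h2⟩ := hg
      obtain ⟨hk, h1⟩ := Gate.mem_support.1 h1
      simp only [Gate.qubits, Finset.mem_singleton] at h1
      rw [← h1]
      exact h2
    have hs : (Gate.one i M).support ∪ c.mark = c.mark := by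
      simp [Gate.support, Gate.qubits, hi]
    rw [hs] at h
    have := Sums.conjOne (K := K) (R := R) (M := M.1) i.2 hi
      (L := fun B => ρ (tensor B)) (ρ ∘ₗ tensorSlot (c.slots n) i)
      (fun b => rfl) fun c' h1 _ => h c' h1
    simp only [Sums, Cfg.gate, hi, if_true]
    rw [op_one_eq]
    unfold op
    rw [tensor_conj_update]
    exact PathSum.mono this (by omega)
  | two i j hij M =>
    have hi : (i : ℕ) ∈ c.mark ∨ (j : ℕ) ∈ c.mark := by
      rw [Finset.not_disjoint_iff] at hg
      obtain ⟨k, h1, h2⟩ := hg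
      obtain ⟨hk, h1⟩ := Gate.mem_support.1 h1
      simp only [Gate.qubits, Finset.mem_singleton, Finset.mem_insert] at h1
      rcases h1 with h1 | h1 <;> rw [← h1]
      · exact Or.inl h2
      · exact Or.inr h2
    have hs : (Gate.two i j hij M).support ∪ c.mark = insert (j : ℕ) (insert (i : ℕ) c.mark) := by
      ext k
      simp only [Gate.support, Gate.qubits, Finset.mem_union, Finset.mem_map, Finset.mem_insert,
        Finset.mem_singleton, Fin.valEmbedding_apply]
      constructor
      · rintro (⟨a, rfl | rfl, rfl⟩ | h) <;> simp_all
      · rintro (rfl | rfl | h)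
        · exact Or.inl ⟨j, by simp, rfl⟩
        · exact Or.inl ⟨i, by simp, rfl⟩
        · exact Or.inr h
    rw [hs] at h
    simp only [Sums, Cfg.gate, hi, if_true]
    -- One bit for each qubit that may have to be marked, two bits for the new row indices and two
    -- for the new column indices.
    rw [show 64 * R = 2 * (2 * (4 * (4 * R))) by ring]
    set g := Gate.two i j hij M
    have hL : ∀ (k : Fin n) (B : Fin n → Matrix (Fin 2) (Fin 2) ℂ) b b',
        (fun B => ρ (g.opᴴ * tensor B * g.op)) (Function.update B k (b + b')) =
        (fun B => ρ (g.opᴴ * tensor B * g.op)) (Function.update B k b) +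
        (fun B => ρ (g.opᴴ * tensor B * g.op)) (Function.update B k b') := by
      intro k B b b'
      simp only [← tensorSlot_apply, map_add, mul_add, add_mul]
    refine Sums.fresh (K := fun c => K (((c.fresh j).rowTwo M.1 i j).colTwo M.1 i j)) i.2
      (L := fun B => ρ (g.opᴴ * tensor B * g.op)) (hL _) fun c₁ hc₁ _ => ?_
    refine Sums.fresh (K := fun c => K ((c.rowTwo M.1 i j).colTwo M.1 i j)) j.2
      (L := fun B => ρ (g.opᴴ * tensor B * g.op)) (hL _) fun c₂ hc₂ _ => ?_
    rw [hc₁] at hc₂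
    have := conj_two_op (c := c₂) hij M (by simp [hc₂]) (by simp [hc₂])
    unfold op at this
    rw [this]
    simp only [map_sum, Finset.mul_sum]
    refine Sums.rowTwo (K := fun c => K (c.colTwo M.1 i j)) fun a b => ?_
    refine Sums.colTwo fun a' b' => ?_
    rw [map_smul, smul_eq_mul, ← mul_assoc, ← mul_assoc]
    exact h _ hc₂

end Cfg

end QCircuit

namespace QCircuit

open Matrix

variable {n : ℕ}

namespace Cfg

variable {K : Cfg → ℂ} {R : ℕ} {c : Cfg}

/-! ### Lists of gates and their light cones -/

/-- Conjugation by the gates of a list, the first one first. -/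
def gates (gs : List (Gate n)) (c : Cfg) : Cfg := gs.foldl (fun c g => c.gate g) c

/-- The marked qubits after conjugation by the gates of a list. -/
def cone (gs : List (Gate n)) (A : Finset ℕ) : Finset ℕ :=
  gs.foldl (fun A g => if Disjoint g.support A then A else g.support ∪ A) A

/-- The number of gates that meet the light cone. -/
def touched : List (Gate n) → Finset ℕ → ℕ
  | [], _ => 0
  | g :: gs, A => if Disjoint g.support A then touched gs A else touched gs (g.support ∪ A) + 1

@[simp] theorem cone_nil (A : Finset ℕ) : cone ([] : List (Gate n)) A = A := rfl

theorem cone_cons (g : Gate n) (gs : List (Gate n)) (A : Finset ℕ) :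
    cone (g :: gs) A = cone gs (if Disjoint g.support A then A else g.support ∪ A) := rfl

theorem touched_append (gs gs' : List (Gate n)) (A : Finset ℕ) :
    touched (gs ++ gs') A = touched gs A + touched gs' (cone gs A) := by
  induction gs generalizing A with
  | nil => simp [touched]
  | cons g gs ih =>
    simp only [List.cons_append, touched, cone_cons]
    split_ifs with h
    · rw [ih]
    · rw [ih]; omega

theorem card_support_le (g : Gate n) : g.support.card ≤ 2 := by
  rw [Gate.support, Finset.card_map]
  cases g with
  | one => simp [Gate.qubits]
  | two => exact Finset.card_le_two

/-- A gate that meets the cone shares a qubit with it and has at most two, so it adds at most one.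
-/
theorem card_cone_le (gs : List (Gate n)) (A : Finset ℕ) :
    (cone gs A).card ≤ A.card + touched gs A := by
  induction gs generalizing A with
  | nil => simp [touched]
  | cons g gs ih =>
    rw [cone_cons, touched]
    split_ifs with h
    · exact ih A
    · refine (ih _).trans ?_
      have h1 := Finset.card_union_add_card_inter g.support A
      have h2 : 0 < (g.support ∩ A).card :=
        Finset.card_pos.2 (Finset.not_disjoint_iff_nonempty_inter.1 h)
      have := card_support_le g
      omega

theorem disjoint_support {g h : Gate n} (hd : Disjoint g.qubits h.qubits) :
    Disjoint g.support h.support := (Finset.disjoint_map _).2 hd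

/-- Each touched gate of a layer is charged to a qubit of `B` on its support, which is then removed.
Qubits added to the cone by a gate of the layer cannot make another gate of the same layer touched,
since the supports are disjoint; so only the cone at the start of the layer matters. -/
theorem touched_le_card_inter {gs : List (Gate n)}
    (hp : gs.Pairwise fun g h => Disjoint g.qubits h.qubits) (A B : Finset ℕ)
    (hB : ∀ g ∈ gs, ∀ k ∈ g.support, k ∈ A → k ∈ B) : touched gs A ≤ B.card := by
  induction gs generalizing A B with
  | nil => simp [touched]
  | cons g gs ih =>
    rw [List.pairwise_cons] at hp
    rw [touched]
    split_ifs with h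
    · exact ih hp.2 A B fun g' hg' => hB g' (List.mem_cons_of_mem _ hg')
    · obtain ⟨k, h1, h2⟩ := Finset.not_disjoint_iff.1 h
      have hk := hB g List.mem_cons_self k h1 h2
      have := ih hp.2 (g.support ∪ A) (B.erase k) ?_
      · rw [Finset.card_erase_of_mem hk] at this
        have : 0 < B.card := Finset.card_pos.2 ⟨k, hk⟩
        omega
      · intro g' hg' j hj hj'
        have hd := disjoint_support (hp.1 g' hg')
        have hjg : j ∉ g.support := fun h => Finset.disjoint_left.1 hd h hj
        rw [Finset.mem_erase]
        refine ⟨fun hjk => hjg (hjk ▸ h1), hB g' (List.mem_cons_of_mem _ hg') j hj ?_⟩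
        simpa [hjg] using hj'

/-- The light cone grows by a factor of at most two in each layer. -/
theorem touched_layers {ls : List (List (Gate n))}
    (hp : ∀ l ∈ ls, l.Pairwise fun g h => Disjoint g.qubits h.qubits) (A : Finset ℕ) :
    touched ls.flatten A + A.card ≤ 2 ^ ls.length * A.card := by
  induction ls generalizing A with
  | nil => simp [touched]
  | cons l ls ih =>
    rw [List.flatten_cons, touched_append, List.length_cons, pow_succ]
    have h1 := ih (fun l hl => hp l (List.mem_cons_of_mem _ hl)) (cone l A)
    have h2 := touched_le_card_inter (hp l List.mem_cons_self) A A fun _ _ _ _ h => h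
    have h3 := card_cone_le l A
    have h4 : 0 < 2 ^ ls.length := by positivity
    generalize 2 ^ ls.length = p at *
    generalize (cone l A).card = a at *
    generalize A.card = b at *
    -- The claim is `(2 ^ length - 1) * card` in additive form: the layer touches at most `b` gates
    -- and leaves a cone of at most `2 * b` qubits for the others.
    have h5 : touched ls.flatten (cone l A) ≤ (p - 1) * a := by
      rw [Nat.sub_mul, one_mul]; omega
    have h6 : (p - 1) * a ≤ (p - 1) * (2 * b) := Nat.mul_le_mul_left _ (by omega)
    have h7 : (p - 1) * (2 * b) + 2 * b = p * 2 * b := by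
      obtain ⟨q, rfl⟩ : ∃ q, p = q + 1 := ⟨p - 1, by omega⟩
      simp; ring
    omega

theorem card_cone_layers {ls : List (List (Gate n))}
    (hp : ∀ l ∈ ls, l.Pairwise fun g h => Disjoint g.qubits h.qubits) (A : Finset ℕ) :
    (cone ls.flatten A).card ≤ 2 ^ ls.length * A.card := by
  have := touched_layers hp A
  have := card_cone_le ls.flatten A
  omega

/-- Conjugation by an operator as a linear map. -/
noncomputable def _root_.QCircuit.conjMap (G : Op n) : Op n →ₗ[ℂ] Op n :=
  LinearMap.mulRight ℂ G ∘ₗ LinearMap.mulLeft ℂ Gᴴ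

theorem _root_.QCircuit.conjMap_apply (G A : Op n) : conjMap G A = Gᴴ * A * G := rfl

/-- A gate off the cone cancels by unitarity and consumes no digit, so only touched gates enlarge
the range, by the factor of `Sums.gate` each. -/
theorem Sums.gates (ρ : Op n →ₗ[ℂ] ℂ) (gs : List (Gate n))
    (h : ∀ c' : Cfg, c'.mark = cone gs c.mark → Sums K R c' (c'.amp * ρ (c'.op n))) :
    Sums (fun c => K (c.gates gs)) (64 ^ touched gs c.mark * R) c
      (c.amp * ρ (conjMap (gs.map Gate.op).prod (c.op n))) := by
  induction gs generalizing c with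
  | nil =>
    simp only [List.map_nil, List.prod_nil, conjMap_apply, touched, pow_zero, one_mul]
    simpa [Sums, Cfg.gates] using h c rfl
  | cons g gs ih =>
    have e : conjMap ((g :: gs).map Gate.op).prod (c.op n) =
        conjMap (gs.map Gate.op).prod (g.opᴴ * c.op n * g.op) := by
      simp only [conjMap_apply, List.map_cons, List.prod_cons, Matrix.conjTranspose_mul,
        Matrix.mul_assoc]
    rw [e, touched]
    split_ifs with hd
    · rw [conj_op_untouched g hd]
      rw [cone_cons, if_pos hd] at h
      have := ih h
      simpa only [Sums, Cfg.gates, List.foldl_cons,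
        fun r => gate_eq_self (c := { c with r := r }) g hd] using this
    · rw [cone_cons, if_neg hd] at h
      rw [pow_succ, mul_comm (64 ^ _) 64, mul_assoc]
      refine Sums.gate (K := fun c => K (c.gates gs)) (ρ ∘ₗ conjMap (gs.map Gate.op).prod) g hd
        fun c' hc' => ?_
      rw [← hc']
      refine ih fun c'' hc'' => h c'' ?_
      rw [hc'', hc']

theorem Sums.final (c : Cfg) : Sums (final n) 1 c (c.amp * c.op n 0 0) := by
  rw [op_final, mul_ite, mul_one, mul_zero]
  exact PathSum.single (if ∀ k < n, k ∈ c.mark → c.x k = 0 ∧ c.y k = 0 then c.amp else 0)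

/-! ### The channel -/

/-- The Kraus operators `O` and `√(1 - Oᴴ O)`; the second one is exact if the defect has rank at
most one. -/
noncomputable def _root_.QCircuit.krausOp (O : Matrix (Fin 2) (Fin 2) ℂ) (a : Fin 2) :
    Matrix (Fin 2) (Fin 2) ℂ :=
  if a = 0 then O else ((1 / √(defect O).trace.re : ℝ) : ℂ) • defect O

/-- The outcomes of the ancilla of qubit `k` that are compatible with the marks. -/
def outcomes (n : ℕ) (A : Finset ℕ) (k : ℕ) : Finset (Fin 2) :=
  if n + k ∈ A then {1} else Finset.univ

/-- The channel of qubit `k`. -/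
noncomputable def channel (O : Matrix (Fin 2) (Fin 2) ℂ) (S : Finset (Fin 2)) :
    Matrix (Fin 2) (Fin 2) ℂ →ₗ[ℂ] Matrix (Fin 2) (Fin 2) ℂ :=
  ∑ a ∈ S, LinearMap.mulRight ℂ (krausOp O a) ∘ₗ LinearMap.mulLeft ℂ (krausOp O a)ᴴ

theorem channel_apply (O : Matrix (Fin 2) (Fin 2) ℂ) (S : Finset (Fin 2))
    (b : Matrix (Fin 2) (Fin 2) ℂ) :
    channel O S b = ∑ a ∈ S, (krausOp O a)ᴴ * b * krausOp O a := by
  simp [channel, LinearMap.sum_apply]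

/-- The two Kraus operators define a channel. -/
structure _root_.QCircuit.IsKraus (O : Matrix (Fin 2) (Fin 2) ℂ) : Prop where
  trace_nonneg : 0 ≤ (defect O).trace.re
  complete : ∑ a, (krausOp O a)ᴴ * krausOp O a = 1

/-- The normalization occurs twice in a conjugation, so its square root disappears and field
operations are enough to compute the result. -/
theorem krausOp_one_conj {O : Matrix (Fin 2) (Fin 2) ℂ} (hO : 0 ≤ (defect O).trace.re)
    (b : Matrix (Fin 2) (Fin 2) ℂ) :
    (krausOp O 1)ᴴ * b * krausOp O 1 =
      ((1 / (defect O).trace.re : ℝ) : ℂ) • ((defect O)ᴴ * b * defect O) := by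
  simp only [krausOp, one_ne_zero, if_false, Matrix.conjTranspose_smul, Matrix.smul_mul,
    Matrix.mul_smul, smul_smul]
  congr 1
  simp only [Complex.star_def, Complex.conj_ofReal, ← Complex.ofReal_mul]
  congr 1
  rw [div_mul_div_comm, one_mul, Real.mul_self_sqrt hO]

theorem Sums.krausOne {O : Matrix (Fin 2) (Fin 2) ℂ} (hO : 0 ≤ (defect O).trace.re) {k : ℕ}
    (hk : k < n) (hm : k ∈ c.mark) {L : (Fin n → Matrix (Fin 2) (Fin 2) ℂ) → ℂ}
    (l : Matrix (Fin 2) (Fin 2) ℂ →ₗ[ℂ] ℂ)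
    (hl : ∀ b, l b = L (Function.update (c.slots n) ⟨k, hk⟩ b))
    (h : ∀ c' : Cfg, c'.mark = c.mark → Sums K R c' (c'.amp * L (c'.slots n))) :
    Sums (fun c => K (((c.rowOne (defect O) k).colOne (defect O) k).scale
      (1 / (defect O).trace.re))) (4 * R) c
      (c.amp * l ((krausOp O 1)ᴴ * c.slots n ⟨k, hk⟩ * krausOp O 1)) := by
  rw [krausOp_one_conj hO, map_smul, ← LinearMap.smul_apply]
  refine Sums.conjOne (K := fun c => K (c.scale _)) (M := defect O) hk hm
    (L := fun B => ((1 / (defect O).trace.re : ℝ) : ℂ) • L B)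
    (((1 / (defect O).trace.re : ℝ) : ℂ) • l) (fun b => by simp [hl]) fun c' hc' _ => ?_
  have := h (c'.scale (1 / (defect O).trace.re)) hc'
  simp only [scale, mul_assoc] at this
  exact this

/-- If neither the qubit nor its ancilla is marked, the channel maps the identity to itself and
costs nothing. The factor `64` is larger than needed, so that channels and gates can be counted by
one exponent. -/
theorem Sums.kraus {O : Matrix (Fin 2) (Fin 2) ℂ} (hO : IsKraus O) {k : ℕ}
    (hk : k < n) {L : (Fin n → Matrix (Fin 2) (Fin 2) ℂ) → ℂ}
    (l : (Fin n → Matrix (Fin 2) (Fin 2) ℂ) → Matrix (Fin 2) (Fin 2) ℂ →ₗ[ℂ] ℂ)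
    (hl : ∀ B b, l B b = L (Function.update B ⟨k, hk⟩ b))
    (h : ∀ c' : Cfg, c'.mark = (if k ∈ c.mark ∨ n + k ∈ c.mark then insert k c.mark else c.mark) →
      Sums K R c' (c'.amp * L (c'.slots n))) :
    Sums (fun c => K (c.kraus n O k)) ((if k ∈ c.mark ∨ n + k ∈ c.mark then 64 else 1) * R) c
      (c.amp * L (Function.update (c.slots n) ⟨k, hk⟩
        (channel O (outcomes n c.mark k) (c.slots n ⟨k, hk⟩)))) := by
  by_cases ht : k ∈ c.mark ∨ n + k ∈ c.mark
  · simp only [ht, if_true] at h ⊢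
    rw [show 64 * R = 2 * (32 * R) by ring]
    -- At most sixteen values are used: a bit for marking, a bit for the Kraus operator, and two for
    -- the matrix unit.
    refine Sums.mono (R := 2 * (8 * R)) ?_ (by omega)
    simp only [Sums, Cfg.kraus, ht, if_true]
    refine Sums.fresh (K := fun c₁ => K (if n + k ∈ c₁.mark then
      ((c₁.rowOne (defect O) k).colOne (defect O) k).scale (1 / (defect O).trace.re)
    else if c₁.r % 2 = 0 then (({ c₁ with r := c₁.r / 2 } : Cfg).rowOne O k).colOne O k
      else ((({ c₁ with r := c₁.r / 2 } : Cfg).rowOne (defect O) k).colOne (defect O) k).scale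
        (1 / (defect O).trace.re))) hk (L := fun B => L (Function.update B ⟨k, hk⟩
        (channel O (outcomes n c.mark k) (B ⟨k, hk⟩)))) ?_ ?_
    · intro B b b'
      simp only [Function.update_self, Function.update_idem, ← hl, map_add]
    · intro c₁ hc₁ _
      rw [← hc₁] at h
      have hm : k ∈ c₁.mark := by simp [hc₁]
      have hnk : n + k ∈ c.mark ↔ n + k ∈ c₁.mark := by
        rw [hc₁, Finset.mem_insert]
        constructor
        · exact Or.inr
        · rintro (h | h)
          · omega
          · exact h
      simp only [outcomes, hnk]
      by_cases ha : n + k ∈ c₁.mark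
      · simp only [Sums, ha, if_true, channel_apply, Finset.sum_singleton, ← hl]
        exact PathSum.mono (Sums.krausOne hO.1 hk hm (l (c₁.slots n)) (fun b => hl _ b)
          fun c' hc' => h c' hc') (by omega)
      · simp only [Sums, ha, if_false, channel_apply, ← hl, map_sum, Finset.mul_sum]
        rw [show 8 * R = 2 * (4 * R) by ring]
        refine PathSum.bit (G := fun a q => if a = 0 then
          K ((({ c₁ with r := q } : Cfg).rowOne O k).colOne O k)
          else K (((({ c₁ with r := q } : Cfg).rowOne (defect O) k).colOne (defect O) k).scale
            (1 / (defect O).trace.re))) ?_ ?_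
        · intro r
          have : Fin.ofNat 2 r = 0 ↔ r % 2 = 0 := by simp [Fin.ext_iff]
          simp only [this]
          split_ifs <;> rfl
        · intro a
          by_cases ha0 : a = 0
          · subst ha0
            simp only [if_true]
            have := Sums.conjOne (K := K) (R := R) (c := c₁) (M := O) hk hm (l (c₁.slots n))
              (fun b => hl _ b) fun c' hc' _ => h c' hc'
            simpa [krausOp, Sums] using this
          · simp only [ha0, if_false]
            obtain rfl : a = 1 := by omega
            exact Sums.krausOne hO.1 hk hm (l (c₁.slots n)) (fun b => hl _ b)
              fun c' hc' => h c' hc'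
  · simp only [ht, if_false] at h
    have h' := h c rfl
    have hs : c.slots n ⟨k, hk⟩ = 1 := by
      push Not at ht
      simp [slots, ht.1]
    have hout : outcomes n c.mark k = Finset.univ := by
      push Not at ht
      simp [outcomes, ht.2]
    rw [hs, hout, channel_apply]
    simp only [mul_one, hO.2]
    rw [← hs, Function.update_eq_self]
    simpa [Sums, Cfg.kraus, ht] using h'

/-- The channels of the qubits in a list. -/
noncomputable def channels (O : Fin n → Matrix (Fin 2) (Fin 2) ℂ) (ks : List (Fin n)) (c : Cfg) :
    Cfg :=
  ks.foldl (fun c k => c.kraus n (O k) k) c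

/-- The marks after the channels of the qubits in a list. -/
def krausCone : List (Fin n) → Finset ℕ → Finset ℕ
  | [], A => A
  | k :: ks, A => krausCone ks (if (k : ℕ) ∈ A ∨ n + k ∈ A then insert (k : ℕ) A else A)

/-- The number of channels that do not cancel. -/
def krausTouched : List (Fin n) → Finset ℕ → ℕ
  | [], _ => 0
  | k :: ks, A => if (k : ℕ) ∈ A ∨ n + k ∈ A then krausTouched ks (insert (k : ℕ) A) + 1
      else krausTouched ks A

theorem card_krausCone_le (ks : List (Fin n)) (A : Finset ℕ) :
    (krausCone ks A).card ≤ A.card + krausTouched ks A := by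
  induction ks generalizing A with
  | nil => simp [krausTouched, krausCone]
  | cons k ks ih =>
    rw [krausCone, krausTouched]
    split_ifs with h
    · have := ih (insert (k : ℕ) A)
      have := Finset.card_insert_le (k : ℕ) A
      omega
    · exact ih A

/-- Each channel that acts is charged to a mark of its own, `k` or `n + k`; distinct qubits have
disjoint pairs. -/
theorem krausTouched_le {ks : List (Fin n)} (hks : ks.Nodup) (A B : Finset ℕ)
    (hB : ∀ k ∈ ks, ((k : ℕ) ∈ A → (k : ℕ) ∈ B) ∧ (n + k ∈ A → n + k ∈ B)) :
    krausTouched ks A ≤ B.card := by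
  induction ks generalizing A B with
  | nil => simp [krausTouched]
  | cons k ks ih =>
    rw [List.nodup_cons] at hks
    have hne : ∀ k' ∈ ks, (k' : ℕ) ≠ k := fun k' hk' h => hks.1 (Fin.ext h ▸ hk')
    rw [krausTouched]
    split_ifs with h
    · obtain ⟨j, hj, hj'⟩ : ∃ j ∈ B, j = (k : ℕ) ∨ j = n + k := by
        have := hB k List.mem_cons_self
        rcases h with h | h
        · exact ⟨_, this.1 h, Or.inl rfl⟩
        · exact ⟨_, this.2 h, Or.inr rfl⟩
      have := ih hks.2 (insert (k : ℕ) A) (B.erase j) ?_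
      · rw [Finset.card_erase_of_mem hj] at this
        have : 0 < B.card := Finset.card_pos.2 ⟨j, hj⟩
        omega
      · intro k' hk'
        have h1 := hne k' hk'
        have h2 := hB k' (List.mem_cons_of_mem _ hk')
        have h3 := k'.2
        have h4 := k.2
        simp only [Finset.mem_insert, Finset.mem_erase]
        constructor
        · rintro (h | h)
          · omega
          · exact ⟨by omega, h2.1 h⟩
        · rintro (h | h)
          · omega
          · exact ⟨by omega, h2.2 h⟩
    · exact ih hks.2 A B fun k' hk' => hB k' (List.mem_cons_of_mem _ hk')

/-- The channels only add marks below `n`, so the outcomes allowed for the ancillas can be read from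
the marks at the start. -/
theorem Sums.channels {O : Fin n → Matrix (Fin 2) (Fin 2) ℂ} (hO : ∀ k, IsKraus (O k))
    (ρ : Op n →ₗ[ℂ] ℂ) {ks : List (Fin n)} (hks : ks.Nodup)
    (h : ∀ c' : Cfg, c'.mark = krausCone ks c.mark → Sums K R c' (c'.amp * ρ (c'.op n))) :
    Sums (fun c => K (c.channels O ks)) (64 ^ krausTouched ks c.mark * R) c
      (c.amp * ρ (tensor fun j => if j ∈ ks then
        channel (O j) (outcomes n c.mark j) (c.slots n j) else c.slots n j)) := by
  induction ks generalizing c with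
  | nil => simpa [Cfg.channels, krausTouched, Sums, op] using h c rfl
  | cons k ks ih =>
    rw [List.nodup_cons] at hks
    have hout : ∀ j : Fin n, outcomes n (if (k : ℕ) ∈ c.mark ∨ n + k ∈ c.mark then
        insert (k : ℕ) c.mark else c.mark) j = outcomes n c.mark j := by
      intro j
      have : n + (j : ℕ) ≠ k := by have := k.2; omega
      unfold outcomes
      split_ifs <;> simp_all
    let E (B : Fin n → Matrix (Fin 2) (Fin 2) ℂ) (j : Fin n) : Matrix (Fin 2) (Fin 2) ℂ :=
      if j ∈ ks then channel (O j) (outcomes n c.mark j) (B j) else B j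
    have hE : ∀ B b, E (Function.update B k b) = Function.update (E B) k b := by
      intro B b
      funext j
      by_cases hj : j = k
      · subst hj; simp [E, hks.1]
      · simp [E, hj]
    have key := Sums.kraus (K := fun c => K (c.channels O ks)) (c := c)
      (R := 64 ^ krausTouched ks (if (k : ℕ) ∈ c.mark ∨ n + k ∈ c.mark then
        insert (k : ℕ) c.mark else c.mark) * R) (hO k) k.2 (L := fun B => ρ (tensor (E B)))
      (fun B => ρ ∘ₗ tensorSlot (E B) k) (fun B b => by
        rw [hE]; rfl) fun c' hc' => by
          rw [krausCone, ← hc'] at h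
          rw [← hc'] at hout ⊢
          have := ih hks.2 h
          simpa only [hout] using this
    refine Sums.mono (R := (if (k : ℕ) ∈ c.mark ∨ n + k ∈ c.mark then 64 else 1) *
      (64 ^ krausTouched ks (if (k : ℕ) ∈ c.mark ∨ n + k ∈ c.mark then
        insert (k : ℕ) c.mark else c.mark) * R)) ?_ ?_
    · have e : (fun j => if j ∈ k :: ks then channel (O j) (outcomes n c.mark j) (c.slots n j)
          else c.slots n j) = E (Function.update (c.slots n) k
            (channel (O k) (outcomes n c.mark k) (c.slots n k))) := ?_
      · rw [e]; exact key
      rw [hE]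
      funext j
      by_cases hj : j = k
      · subst hj; simp
      · simp [E, hj]
    · rw [krausTouched]
      split_ifs
      · rw [pow_succ]; apply le_of_eq; ring
      · simp

/-! ### Outcome distributions -/

/-- The product of projectors onto the outcome one is diagonal. -/
theorem op_diagonal (h : ∀ k ∈ c.mark, c.x k = 1 ∧ c.y k = 1) (u v : Fin n → Fin 2) :
    c.op n u v = if u = v then if ∀ k : Fin n, (k : ℕ) ∈ c.mark → u k = 1 then 1 else 0 else 0 := by
  have hs : ∀ k : Fin n, c.slots n k (u k) (v k) =
      if u k = v k ∧ ((k : ℕ) ∈ c.mark → u k = 1) then 1 else 0 := by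
    intro k
    unfold slots
    by_cases hk : (k : ℕ) ∈ c.mark
    · rw [if_pos hk, (h k hk).1, (h k hk).2, Matrix.single_apply]
      simp only [hk, forall_const]
      congr 1
      ext
      constructor
      · rintro ⟨h1, h2⟩; simp [← h1, ← h2]
      · rintro ⟨h1, h2⟩; simp [← h1, h2]
    · simp [hk, Matrix.one_apply]
  unfold op tensor
  simp only [hs]
  rw [Finset.prod_ite_zero]
  simp only [Finset.mem_univ, forall_const, Finset.prod_const_one, forall_and, ← funext_iff]
  by_cases h1 : u = v <;> simp [h1]

/-- Born's rule: the expectation of a product of projectors in the state `G|0⟩` is the weight of the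
outcomes that pass all of them. -/
theorem conj_diagonal_apply (h : ∀ k ∈ c.mark, c.x k = 1 ∧ c.y k = 1) (G : Op n) :
    conjMap G (c.op n) 0 0 =
      ∑ z, if ∀ k : Fin n, (k : ℕ) ∈ c.mark → z k = 1 then ((‖G z 0‖ ^ 2 : ℝ) : ℂ) else 0 := by
  rw [conjMap_apply, Matrix.mul_apply]
  refine Finset.sum_congr rfl fun z _ => ?_
  rw [Matrix.mul_apply, Finset.sum_eq_single z]
  · rw [op_diagonal h, if_pos rfl, Matrix.conjTranspose_apply]
    split_ifs
    · rw [mul_one, Complex.ofReal_pow, ← Complex.conj_mul']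
      rfl
    · simp
  · intro b _ hb
    rw [op_diagonal h, if_neg hb, mul_zero]
  · simp

end Cfg

end QCircuit

/-- Chebyshev polynomials of the first kind. -/
def chebyshevT : ℕ → ℝ → ℝ
  | 0, _ => 1
  | 1, y => y
  | k + 2, y => 2 * y * chebyshevT (k + 1) y - chebyshevT k y

theorem chebyshevT_eq {k : ℕ} (hk : k ≠ 0) (y : ℝ) :
    chebyshevT k y = (if k < 2 then 1 else 2) * y * chebyshevT (k - 1) y +
      (1 - if k < 2 then 1 else 2) * chebyshevT (k - 2) y := by
  match k with
  | 0 => exact absurd rfl hk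
  | 1 => simp [chebyshevT]
  | k + 2 =>
    simp only [chebyshevT, Nat.not_lt.2 (Nat.le_add_left 2 k), if_false, Nat.add_sub_cancel]
    rw [show k + 2 - 1 = k + 1 by omega]
    ring

namespace QCircuit

open Matrix

variable {n : ℕ}

/-! ### Polynomials of the number of ones -/

/-- The expectation of `φ (#S)` over the outcomes that contain `A`. -/
noncomputable def expectOn {Ω : Type} [Fintype Ω] (P : Ω → ℝ) (S : Ω → Finset ℕ) (φ : ℕ → ℝ)
    (A : Finset ℕ) : ℝ :=
  ∑ ω, if A ⊆ S ω then P ω * φ (S ω).card else 0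

section

variable {Ω : Type} [Fintype Ω] {P : Ω → ℝ} {S : Ω → Finset ℕ} {N : ℕ}

theorem expectOn_linear (φ ψ : ℕ → ℝ) (a b : ℝ) (A : Finset ℕ) :
    expectOn P S (fun x => a * φ x + b * ψ x) A =
      a * expectOn P S φ A + b * expectOn P S ψ A := by
  simp only [expectOn, Finset.mul_sum, ← Finset.sum_add_distrib]
  refine Finset.sum_congr rfl fun ω _ => ?_
  split_ifs <;> ring

/-- Multiplication by the number of ones is the sum over all bits of the projection onto that bit.
This is how a polynomial in `H` becomes a combination of products of projectors, one more per
degree. -/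
theorem sum_expectOn_insert (hS : ∀ ω, S ω ⊆ Finset.range N) (φ : ℕ → ℝ) (A : Finset ℕ) :
    ∑ q ∈ Finset.range N, expectOn P S φ (insert q A) = expectOn P S (fun x => x * φ x) A := by
  simp only [expectOn]
  rw [Finset.sum_comm]
  refine Finset.sum_congr rfl fun ω _ => ?_
  split_ifs with h
  · have : ∀ q ∈ Finset.range N, (if insert q A ⊆ S ω then P ω * φ (S ω).card else 0) =
        if q ∈ S ω then P ω * φ (S ω).card else 0 := by
      intro q _
      simp [Finset.insert_subset_iff, h]
    rw [Finset.sum_congr rfl this, ← Finset.sum_filter, Finset.filter_mem_eq_inter,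
      Finset.inter_eq_right.2 (hS ω), Finset.sum_const, nsmul_eq_mul]
    ring
  · refine Finset.sum_eq_zero fun q _ => if_neg fun h' => h ?_
    exact (Finset.subset_insert q A).trans h'

end

namespace Cfg

/-- At most `κ` of the first `N` bits are marked, all of them with the projector onto one. -/
structure Good (N κ : ℕ) (c : Cfg) : Prop where
  subset : c.mark ⊆ Finset.range N
  ones : ∀ k ∈ c.mark, c.x k = 1 ∧ c.y k = 1
  card : c.mark.card ≤ κ

variable {N κ : ℕ} {c : Cfg}

theorem Good.mono (h : Good N κ c) {κ' : ℕ} (hκ : κ ≤ κ') : Good N κ' c :=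
  ⟨h.1, h.2, h.3.trans hκ⟩

theorem Good.project (h : Good N κ c) {q : ℕ} (hq : q < N) : Good N (κ + 1) (c.project q) := by
  refine ⟨Finset.insert_subset (by simpa using hq) h.1, ?_, ?_⟩
  · intro k hk
    by_cases hkq : k = q
    · subst hkq; simp [Cfg.project]
    · have := h.2 k (by simpa [Cfg.project, hkq] using hk)
      simpa [Cfg.project, hkq] using this
  · exact (Finset.card_insert_le _ _).trans (by have := h.3; omega)

theorem Good.scale (h : Good N κ c) (w : ℝ) : Good N κ (c.scale w) := ⟨h.1, h.2, h.3⟩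

variable {Ω : Type} [Fintype Ω] {P : Ω → ℝ} {S : Ω → Finset ℕ} {K : Cfg → ℂ} {R : ℕ}

/-- The function `φ` stands for the factors still to be expanded. Each linear factor may mark one
more bit, hence the budget `κ + 1`. -/
theorem Sums.linear (hS : ∀ ω, S ω ⊆ Finset.range N) {φ : ℕ → ℝ} (k : ℕ)
    (h : ∀ c', Good N (κ + 1) c' → Sums K R c' (c'.amp * (expectOn P S φ c'.mark : ℝ)))
    (hc : Good N κ c) :
    Sums (fun c => K (c.linear N k)) ((N + 1) * R) c
      (c.amp * (expectOn P S (fun x => (1 - x / (k + 1)) * φ x) c.mark : ℝ)) := by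
  have e : c.amp * (expectOn P S (fun x => (1 - x / (k + 1)) * φ x) c.mark : ℝ) =
      ∑ a ∈ Finset.range (N + 1), if a = 0 then c.amp * (expectOn P S φ c.mark : ℝ) else
        c.amp * (-1 / (k + 1) : ℝ) * (expectOn P S φ (insert (a - 1) c.mark) : ℝ) := by
    rw [Finset.sum_range_succ']
    simp only [Nat.add_eq_zero_iff, one_ne_zero, and_false, if_false, if_true,
      Nat.add_sub_cancel]
    rw [← Finset.mul_sum, ← Complex.ofReal_sum, sum_expectOn_insert hS]
    have : (fun x : ℕ => (1 - (x : ℝ) / (k + 1)) * φ x) =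
        fun x : ℕ => 1 * φ x + (-1 / (k + 1) : ℝ) * (x * φ x) := by
      funext x; ring
    rw [this, expectOn_linear]
    push_cast
    ring
  rw [e]
  refine PathSum.digit (Nat.succ_pos N) (G := fun a q => if a = 0 then K { c with r := q } else
    K ((({ c with r := q } : Cfg).project (a - 1)).scale (-1 / (k + 1)))) ?_ ?_
  · intro r
    simp only [Cfg.linear]
    split_ifs <;> rfl
  · intro a ha
    by_cases h0 : a = 0
    · simp only [h0, if_true]
      exact h c (hc.mono (by omega))
    · simp only [h0, if_false]
      exact h _ ((hc.project (by omega : a - 1 < N)).scale _)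

/-- The factors `1 - H / j` for `j ≤ m`. -/
noncomputable def linears (N : ℕ) : ℕ → Cfg → Cfg
  | 0, c => c
  | m + 1, c => linears N m (c.linear N m)

theorem Sums.linears (hS : ∀ ω, S ω ⊆ Finset.range N) {φ : ℕ → ℝ} (m : ℕ)
    (h : ∀ c', Good N (κ + m) c' → Sums K R c' (c'.amp * (expectOn P S φ c'.mark : ℝ)))
    (hc : Good N κ c) :
    Sums (fun c => K (c.linears N m)) ((N + 1) ^ m * R) c
      (c.amp * (expectOn P S (fun x => (∏ k ∈ Finset.range m, (1 - (x : ℝ) / (k + 1))) * φ x)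
        c.mark : ℝ)) := by
  induction m generalizing c κ with
  | zero => simpa [Cfg.linears, Sums] using h c hc
  | succ m ih =>
    have := Sums.linear (K := fun c => K (c.linears N m)) (R := (N + 1) ^ m * R) hS m
      (fun c' hc' => ih (κ := κ + 1) (fun c'' hc'' => h c'' (hc''.mono (by omega))) hc') hc
    rw [pow_succ, mul_comm (_ ^ m), mul_assoc]
    have e : (fun x : ℕ => (∏ k ∈ Finset.range (m + 1), (1 - (x : ℝ) / (k + 1))) * φ x) = fun x : ℕ =>
        (1 - (x : ℝ) / (m + 1)) * ((∏ k ∈ Finset.range m, (1 - (x : ℝ) / (k + 1))) * φ x) := by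
      funext x
      rw [Finset.prod_range_succ]
      ring
    rw [e]
    exact this

/-- The `N + 2` digits are the constant part of the argument, its `N` bits, and the second term of
the recurrence. That term drops two degrees and so consumes fewer digits; its range is padded by
`PathSum.mono`. -/
theorem Sums.cheb (hS : ∀ ω, S ω ⊆ Finset.range N) {φ : ℕ → ℝ} (y₀ : ℝ) (k : ℕ)
    (h : ∀ c', Good N (κ + k) c' → Sums K R c' (c'.amp * (expectOn P S φ c'.mark : ℝ)))
    (hc : Good N κ c) :
    Sums (fun c => K (c.cheb N y₀ k)) ((N + 2) ^ k * R) c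
      (c.amp * (expectOn P S (fun x => chebyshevT k (y₀ - x / N) * φ x) c.mark : ℝ)) := by
  induction k using Nat.strong_induction_on generalizing c κ with
  | _ k ih =>
  by_cases hk : k = 0
  · subst hk
    simpa [Cfg.cheb, Sums, chebyshevT] using h c hc
  set w : ℝ := if k < 2 then 1 else 2 with hw
  set ψ : ℕ → ℝ := fun x => chebyshevT (k - 1) (y₀ - x / N) * φ x with hψ
  set χ : ℕ → ℝ := fun x => chebyshevT (k - 2) (y₀ - x / N) * φ x with hχ
  have e : c.amp * (expectOn P S (fun x => chebyshevT k (y₀ - x / N) * φ x) c.mark : ℝ) =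
      ∑ a ∈ Finset.range (N + 2),
        if a = 0 then c.amp * (w * y₀ : ℝ) * (expectOn P S ψ c.mark : ℝ)
        else if a < N + 1 then
          c.amp * (-w / N : ℝ) * (expectOn P S ψ (insert (a - 1) c.mark) : ℝ)
        else c.amp * (1 - w : ℝ) * (expectOn P S χ c.mark : ℝ) := by
    rw [Finset.sum_range_succ, Finset.sum_range_succ']
    simp only [Nat.add_eq_zero_iff, one_ne_zero, and_false, if_false, if_true,
      Nat.add_sub_cancel, lt_irrefl]
    rw [Finset.sum_congr rfl (g := fun q => c.amp * (-w / N : ℝ) *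
      (expectOn P S ψ (insert q c.mark) : ℝ)) fun q hq => by
        rw [if_pos (by simpa using hq)]]
    rw [← Finset.mul_sum, ← Complex.ofReal_sum, sum_expectOn_insert hS]
    have : (fun x : ℕ => chebyshevT k (y₀ - x / N) * φ x) = fun x : ℕ => 1 *
        (w * y₀ * ψ x + (-w / N : ℝ) * (x * ψ x)) + (1 - w) * χ x := by
      funext x
      rw [chebyshevT_eq hk, ← hw, hψ, hχ]
      ring
    rw [this, expectOn_linear, expectOn_linear]
    push_cast
    ring
  have hp : ∀ j, j < k → (N + 2) ^ j * R ≤ (N + 2) ^ (k - 1) * R := fun j hj =>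
    Nat.mul_le_mul_right _ (Nat.pow_le_pow_right (by omega) (by omega))
  rw [e, show (N + 2) ^ k = (N + 2) * (N + 2) ^ (k - 1) by
    rw [← pow_succ']; congr 1; omega, mul_assoc]
  refine PathSum.digit (by omega) (G := fun a q =>
    if a = 0 then K ((({ c with r := q } : Cfg).scale (w * y₀)).cheb N y₀ (k - 1))
    else if a < N + 1 then
      K (((({ c with r := q } : Cfg).project (a - 1)).scale (-w / N)).cheb N y₀ (k - 1))
    else K ((({ c with r := q } : Cfg).scale (1 - w)).cheb N y₀ (k - 2))) ?_ ?_
  · intro r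
    change K (Cfg.cheb N y₀ k { c with r := r }) = _
    rw [Cfg.cheb]
    simp only [hk, if_false, ← hw]
    split_ifs <;> rfl
  · intro a ha
    by_cases h0 : a = 0
    · simp only [h0, if_true]
      exact ih (k - 1) (by omega) (κ := κ) (c := c.scale (w * y₀))
        (fun c' hc' => h c' (hc'.mono (by omega))) (hc.scale _)
    · simp only [h0, if_false]
      by_cases h1 : a < N + 1
      · simp only [h1, if_true]
        exact ih (k - 1) (by omega) (κ := κ + 1) (c := (c.project (a - 1)).scale (-w / N))
          (fun c' hc' => h c' (hc'.mono (by omega)))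
          ((hc.project (by omega : a - 1 < N)).scale _)
      · simp only [h1, if_false]
        exact PathSum.mono (ih (k - 2) (by omega) (κ := κ) (c := c.scale (1 - w))
          (fun c' hc' => h c' (hc'.mono (by omega))) (hc.scale _)) (hp _ (by omega))

end Cfg

end QCircuit

/-! ### The defect of a one-qubit operator of norm one. -/

namespace QCircuit

open Matrix

/-- A contraction has a positive defect. The norm of the positive element `T* T` belongs to its
spectrum, and this norm is one, so `1 - T* T` cannot be invertible. -/
theorem defect_posSemidef_and_det {O : Matrix (Fin 2) (Fin 2) ℂ} (hO : qubitNorm O = 1) :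
    (defect O).PosSemidef ∧ (defect O).det = 0 := by
  set T := Matrix.toEuclideanCLM (n := Fin 2) (𝕜 := ℂ) O with hT
  have hnorm : ‖T‖ = 1 := hO
  have hstar : Matrix.toEuclideanCLM (n := Fin 2) (𝕜 := ℂ) (defect O) = 1 - star T * T := by
    rw [defect, map_sub, map_mul, map_one, ← Matrix.star_eq_conjTranspose, map_star]
  constructor
  · refine Matrix.PosSemidef.of_dotProduct_mulVec_nonneg ?_ fun x => ?_
    · simp [defect, Matrix.IsHermitian, Matrix.conjTranspose_sub, Matrix.conjTranspose_mul]
    · rw [defect, Matrix.sub_mulVec, dotProduct_sub, Matrix.one_mulVec, ← Matrix.mulVec_mulVec,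
        Matrix.dotProduct_mulVec, ← Matrix.star_mulVec, sub_nonneg]
      have h1 : ∀ v : Fin 2 → ℂ, star v ⬝ᵥ v = ((‖WithLp.toLp 2 v‖ ^ 2 : ℝ) : ℂ) := by
        intro v
        rw [EuclideanSpace.norm_sq_eq]
        simp [dotProduct, Fin.sum_univ_two, Complex.conj_mul']
      rw [h1, h1, Complex.real_le_real]
      have h2 := T.le_opNorm (WithLp.toLp 2 x)
      rw [hnorm, one_mul] at h2
      exact pow_le_pow_left₀ (norm_nonneg _) h2 2
  · by_contra hdet
    have h1 : IsUnit (defect O) := (Matrix.isUnit_iff_isUnit_det _).2 (isUnit_iff_ne_zero.2 hdet)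
    have h2 : IsUnit (1 - star T * T) := hstar ▸ h1.map (Matrix.toEuclideanCLM (n := Fin 2) (𝕜 := ℂ))
    have h3 : ‖star T * T‖ = 1 := by
      have := ContinuousLinearMap.norm_adjoint_comp_self T
      rw [hnorm, one_mul] at this
      exact this
    have h4 := CStarAlgebra.norm_mem_spectrum_of_nonneg (a := star T * T) (star_mul_self_nonneg T)
    rw [h3, spectrum.mem_iff, map_one] at h4
    exact h4 h2

/-- For a singular matrix of size two, Cayley–Hamilton reads `D² = tr(D) D`. Hence `D / √tr(D)`
squares to `D`, and the two Kraus operators add up to `Oᴴ O + D = 1`. -/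
theorem isKraus_of_qubitNorm {O : Matrix (Fin 2) (Fin 2) ℂ} (hO : qubitNorm O = 1) : IsKraus O := by
  obtain ⟨hp, hdet⟩ := defect_posSemidef_and_det hO
  have htr := hp.trace_nonneg
  have h0 : 0 ≤ (defect O).trace.re := (Complex.le_def.1 htr).1
  have him : (((defect O).trace.re : ℝ) : ℂ) = (defect O).trace :=
    Complex.ext rfl (Complex.le_def.1 htr).2
  refine ⟨h0, ?_⟩
  have h1 := Cfg.krausOp_one_conj h0 1
  rw [mul_one, mul_one] at h1
  rw [Fin.sum_univ_two, h1]
  have hD : (defect O)ᴴ = defect O := hp.1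
  have hsq : (defect O)ᴴ * defect O = (defect O).trace • defect O := by
    rw [hD]
    generalize defect O = D at hdet
    rw [Matrix.det_fin_two] at hdet
    ext a b
    fin_cases a <;> fin_cases b <;>
      simp [Matrix.mul_apply, Fin.sum_univ_two, Matrix.trace_fin_two] <;>
      first | linear_combination (-1 : ℂ) * hdet | ring
  have hc : ((1 / (defect O).trace.re : ℝ) : ℂ) * (defect O).trace =
      ((1 / (defect O).trace.re * (defect O).trace.re : ℝ) : ℂ) := by
    rw [Complex.ofReal_mul, him]
  rw [hsq, smul_smul, hc]
  have hk : krausOp O 0 = O := by simp [krausOp]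
  rw [hk]
  -- A positive matrix of trace zero vanishes; then `Oᴴ O = 1`, and the convention `1 / 0 = 0`
  -- correctly removes the second Kraus operator.
  by_cases ht : (defect O).trace.re = 0
  · have hz : (defect O).trace = 0 := by rw [← him, ht, Complex.ofReal_zero]
    rw [hp.trace_eq_zero_iff.1 hz, smul_zero, add_zero]
    have := hp.trace_eq_zero_iff.1 hz
    rw [defect, sub_eq_zero] at this
    exact this.symm
  · rw [one_div, inv_mul_cancel₀ ht, Complex.ofReal_one, one_smul, defect]
    abel

end QCircuit

namespace QCircuit

open Matrix

variable {n d : ℕ}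

/-! ### The gates of a circuit -/

/-- Reduces statements that are linear in a gate to product operators, for which `conj_untouched` is
available. -/
theorem op_mem_span (g : Gate n) : g.op ∈ Submodule.span ℂ
    {A | ∃ F : Fin n → Matrix (Fin 2) (Fin 2) ℂ, (∀ k ∉ g.qubits, F k = 1) ∧ A = tensor F} := by
  cases g with
  | one i M =>
    refine Submodule.subset_span ⟨_, ?_, op_one_eq i M⟩
    intro k hk
    rw [Function.update_of_ne]
    simpa [Gate.qubits] using hk
  | two i j hij M =>
    have e : (Gate.two i j hij M).op = ∑ s : Fin 2 × Fin 2, ∑ t : Fin 2 × Fin 2, M.1 s t •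
        tensor (Function.update (Function.update (fun _ => 1) i (Matrix.single s.1 t.1 1)) j
          (Matrix.single s.2 t.2 1)) := by
      ext u v
      simp only [Matrix.sum_apply, Matrix.smul_apply, smul_eq_mul]
      have hr : ∀ s t : Fin 2 × Fin 2, tensor (Function.update (Function.update (fun _ => 1) i
          (Matrix.single s.1 t.1 1)) j (Matrix.single s.2 t.2 (1 : ℂ))) u v =
          (if s = (u i, u j) then if t = (v i, v j) then 1 else 0 else 0) *
            if ∀ k, k ≠ i → k ≠ j → u k = v k then 1 else 0 := by
        rintro ⟨s₁, s₂⟩ ⟨t₁, t₂⟩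
        rw [tensor_apply_two _ hij, ← mul_assoc]
        congr 1
        · simp only [Function.update_self, ne_eq, hij, not_false_eq_true, Function.update_of_ne,
            Matrix.single_apply, Prod.mk.injEq]
          split_ifs <;> simp_all
        · rw [prod_erase_erase_congr (g := fun k => if u k = v k then 1 else 0)]
          · rw [Finset.prod_ite_zero]
            simp only [Finset.prod_const_one]
            congr 1
            simp only [Finset.mem_erase, Finset.mem_univ, and_true, eq_iff_iff]
            exact ⟨fun h k hi hj => h k ⟨hj, hi⟩, fun h k hk => h k hk.2 hk.1⟩
          · intro k hi hj
            simp [hi, hj, Matrix.one_apply]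
      simp only [hr, mul_ite, mul_one, mul_zero]
      simp [Gate.op]
    rw [e]
    refine Submodule.sum_mem _ fun s _ => Submodule.sum_mem _ fun t _ =>
      Submodule.smul_mem _ _ (Submodule.subset_span ⟨_, ?_, rfl⟩)
    intro k hk
    simp only [Gate.qubits, Finset.mem_insert, Finset.mem_singleton, not_or] at hk
    simp [hk.1, hk.2]

/-- Conjugation by `g` fixes every product operator that is the identity on the qubits of `g`, and
`h` is a combination of such operators. -/
theorem commute_of_disjoint {g h : Gate n} (hd : Disjoint g.qubits h.qubits) :
    Commute g.op h.op := by
  have key : g.opᴴ * h.op * g.op = h.op := by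
    have h1 : Set.EqOn (conjMap g.op) (LinearMap.id : Op n →ₗ[ℂ] Op n)
        {A | ∃ F, (∀ k ∉ h.qubits, F k = 1) ∧ A = tensor F} := by
      rintro _ ⟨F, hF, rfl⟩
      rw [conjMap_apply, LinearMap.id_apply]
      exact conj_untouched g F fun k hk => hF k (Finset.disjoint_left.1 hd hk)
    have h2 := LinearMap.eqOn_span h1 (op_mem_span h)
    rwa [conjMap_apply, LinearMap.id_apply] at h2
  have hu : g.op * g.opᴴ = 1 := mul_eq_one_comm.1 (op_gate_unitary g)
  rw [commute_iff_eq]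
  calc g.op * h.op = g.op * (g.opᴴ * h.op * g.op) := by rw [key]
    _ = (g.op * g.opᴴ) * (h.op * g.op) := by simp only [Matrix.mul_assoc]
    _ = h.op * g.op := by rw [hu, one_mul]

/-- Allows the circuit to be traversed by reversing the whole list of gates, without regard to the
boundaries of layers. -/
theorem Layer.op_eq_reverse (l : Layer n) : l.op = (l.gates.reverse.map Gate.op).prod := by
  refine List.Perm.prod_eq' ((List.reverse_perm _).symm.map _) ?_
  rw [List.pairwise_map]
  exact l.disjoint.imp commute_of_disjoint

/-- All gates of a circuit in the order of the input. -/
def gateList (U : QCircuit n d) : List (Gate n) := (List.ofFn U).flatMap Layer.gates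

theorem gateList_reverse (U : QCircuit n d) :
    (gateList U).reverse = ((List.ofFn U).reverse.map fun l => l.gates.reverse).flatten := by
  rw [gateList, List.reverse_flatMap, List.flatMap_def]
  rfl

theorem op_eq (U : QCircuit n d) : op U = ((gateList U).reverse.map Gate.op).prod := by
  rw [gateList_reverse, List.map_flatten, List.prod_flatten, op, List.ofFn_comp' U Layer.op,
    ← List.map_reverse]
  congr 1
  simp only [List.map_map]
  refine List.map_congr_left fun l _ => ?_
  exact l.op_eq_reverse

theorem op_conjTranspose (U : QCircuit n d) :
    (op U)ᴴ = (((gateList U).map Gate.inv).map Gate.op).prod := by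
  rw [op_eq, Matrix.conjTranspose_list_prod, List.map_map, List.map_reverse,
    List.reverse_reverse, List.map_map]
  congr 1
  refine List.map_congr_left fun g _ => ?_
  exact (op_inv g).symm

theorem op_unitary (U : QCircuit n d) : (op U)ᴴ * op U = 1 := by
  rw [op_eq]
  induction (gateList U).reverse with
  | nil => simp
  | cons g gs ih =>
    rw [List.map_cons, List.prod_cons, Matrix.conjTranspose_mul, Matrix.mul_assoc,
      ← Matrix.mul_assoc g.opᴴ, op_gate_unitary, one_mul, ih]

theorem op_unitary' (U : QCircuit n d) : op U * (op U)ᴴ = 1 := mul_eq_one_comm.1 (op_unitary U)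

theorem sum_norm_sq_of_unitary {G : Op n} (hG : Gᴴ * G = 1) : ∑ z, ‖G z 0‖ ^ 2 = 1 := by
  have h := congrFun (congrFun hG 0) 0
  rw [Matrix.mul_apply, Matrix.one_apply_eq] at h
  have h2 : ∑ z, ((‖G z 0‖ ^ 2 : ℝ) : ℂ) = 1 := by
    rw [← h]
    refine Finset.sum_congr rfl fun z _ => ?_
    rw [Matrix.conjTranspose_apply, Complex.ofReal_pow, ← Complex.conj_mul']
    rfl
  rw [← Complex.ofReal_sum] at h2
  exact_mod_cast h2

theorem layers_reverse_pairwise (U : QCircuit n d) :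
    ∀ l ∈ (List.ofFn U).reverse.map fun l => l.gates.reverse,
      l.Pairwise fun g h => Disjoint g.qubits h.qubits := by
  intro l hl
  obtain ⟨a, _, rfl⟩ := List.mem_map.1 hl
  rw [List.pairwise_reverse]
  exact a.disjoint.imp fun h => h.symm

theorem gateList_inv (U : QCircuit n d) :
    (gateList U).map Gate.inv = ((List.ofFn U).map fun l => l.gates.map Gate.inv).flatten := by
  rw [gateList, List.map_flatMap, List.flatMap_def]

theorem layers_inv_pairwise (U : QCircuit n d) :
    ∀ l ∈ (List.ofFn U).map fun l => l.gates.map Gate.inv,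
      l.Pairwise fun g h => Disjoint g.qubits h.qubits := by
  intro l hl
  obtain ⟨a, _, rfl⟩ := List.mem_map.1 hl
  rw [List.pairwise_map]
  exact a.disjoint.imp fun h => by simpa only [qubits_inv] using h

/-! ### Distributions on bit strings -/

/-- The path sums of `K` that start from a product of projectors compute the probability that the
projected bits are all one, for a distribution on `N`-bit strings with `p₀` the probability of
zero. -/
def HasLaw (N E : ℕ) (K : Cfg → ℂ) (p₀ : ℝ) : Prop :=
  ∃ (Ω : Type) (_ : Fintype Ω) (P : Ω → ℝ) (S : Ω → Finset ℕ) (ω₀ : Ω),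
    (∀ ω, 0 ≤ P ω) ∧ ∑ ω, P ω = 1 ∧ (∀ ω, S ω ⊆ Finset.range N) ∧ (∀ ω, S ω = ∅ ↔ ω = ω₀) ∧
    P ω₀ = p₀ ∧ ∀ κ c, Cfg.Good N κ c →
      Cfg.Sums K (64 ^ (E * κ)) c (c.amp * (expectOn P S (fun _ => 1) c.mark : ℝ))

/-- The positions of the ones of a bit string. -/
def ones (z : Fin n → Fin 2) : Finset ℕ :=
  (Finset.univ.filter fun k => z k = 1).map Fin.valEmbedding

theorem mem_ones {z : Fin n → Fin 2} {k : ℕ} : k ∈ ones z ↔ ∃ h : k < n, z ⟨k, h⟩ = 1 := by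
  simp only [ones, Finset.mem_map, Finset.mem_filter, Finset.mem_univ, true_and,
    Fin.valEmbedding_apply]
  constructor
  · rintro ⟨a, ha, rfl⟩
    exact ⟨a.2, ha⟩
  · rintro ⟨h, hk⟩
    exact ⟨_, hk, rfl⟩

theorem ones_eq_empty {z : Fin n → Fin 2} : ones z = ∅ ↔ z = 0 := by
  constructor
  · intro h
    funext k
    have : (k : ℕ) ∉ ones z := by simp [h]
    rw [mem_ones] at this
    push Not at this
    have := this k.2
    change z k = 0
    simp only [Fin.eta] at this
    omega
  · rintro rfl
    simp [ones]

/-- The path sum of a circuit. -/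
noncomputable def pathOutput (V : QCircuit n d) (c : Cfg) : ℂ :=
  (c.gates (gateList V).reverse).final n

/-- The law is that of measuring `V|0⟩`. Conjugating a product of `κ` projectors by `V` touches at
most `2 ^ d * κ` gates, by `Cfg.touched_layers`. -/
theorem hasLaw_output (V : QCircuit n d) :
    HasLaw n (2 ^ d) (pathOutput V) (‖zeroElement (op V)‖ ^ 2) := by
  refine ⟨Fin n → Fin 2, inferInstance, fun z => ‖op V z 0‖ ^ 2, ones, 0, fun _ => by positivity,
    sum_norm_sq_of_unitary (op_unitary V), ?_, fun z => ones_eq_empty, rfl, ?_⟩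
  · intro z k hk
    obtain ⟨h, _⟩ := mem_ones.1 hk
    simpa using h
  · intro κ c hc
    have key := Cfg.Sums.gates (K := Cfg.final n) (R := 1) (c := c)
      (Matrix.entryLinearMap ℂ ℂ 0 0) (gateList V).reverse fun c' _ => Cfg.Sums.final c'
    rw [← op_eq, Matrix.entryLinearMap_apply, Cfg.conj_diagonal_apply hc.ones] at key
    have e : (∑ z : Fin n → Fin 2, if ∀ k : Fin n, (k : ℕ) ∈ c.mark → z k = 1 then
        ((‖op V z 0‖ ^ 2 : ℝ) : ℂ) else 0) =
        (expectOn (fun z => ‖op V z 0‖ ^ 2) ones (fun _ => 1) c.mark : ℝ) := by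
      rw [expectOn, Complex.ofReal_sum]
      refine Finset.sum_congr rfl fun z _ => ?_
      have : (∀ k : Fin n, (k : ℕ) ∈ c.mark → z k = 1) ↔ c.mark ⊆ ones z := by
        constructor
        · intro h k hk
          have hkn : k < n := by simpa using hc.subset hk
          exact mem_ones.2 ⟨hkn, h ⟨k, hkn⟩ hk⟩
        · intro h k hk
          obtain ⟨_, h1⟩ := mem_ones.1 (h hk)
          exact h1
      simp only [this]
      split_ifs <;> simp
    rw [e] at key
    refine key.mono ?_
    rw [mul_one]
    refine Nat.pow_le_pow_right (by norm_num) ?_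
    have h1 := Cfg.touched_layers (layers_reverse_pairwise V) c.mark
    rw [← gateList_reverse] at h1
    simp only [List.length_map, List.length_reverse, List.length_ofFn] at h1
    have := Nat.mul_le_mul_left (2 ^ d) hc.card
    omega

/-- The path sum of a mean value. -/
noncomputable def pathMean (U : QCircuit n d) (O : Fin n → Matrix (Fin 2) (Fin 2) ℂ) (c : Cfg) :
    ℂ :=
  (((c.gates ((gateList U).map Gate.inv)).channels O (List.finRange n).reverse).gates
    (gateList U).reverse).final n

/-- The Kraus operator of a bit string of ancilla outcomes. -/
noncomputable def krausTensor (O : Fin n → Matrix (Fin 2) (Fin 2) ℂ) (a : Fin n → Fin 2) : Op n :=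
  tensor fun j => krausOp (O j) (a j)

/-- Multilinearity: a product of sums over one outcome each is a sum over strings of outcomes. -/
theorem tensor_channel (O : Fin n → Matrix (Fin 2) (Fin 2) ℂ) (S : Fin n → Finset (Fin 2))
    (B : Fin n → Matrix (Fin 2) (Fin 2) ℂ) :
    tensor (fun j => Cfg.channel (O j) (S j) (B j)) =
      (∑ a ∈ Fintype.piFinset S, conjMap (krausTensor O a)) (tensor B) := by
  simp only [Cfg.channel_apply]
  rw [← sum_piFinset_tensor S fun j a => (krausOp (O j) a)ᴴ * B j * krausOp (O j) a,
    LinearMap.sum_apply]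
  refine Finset.sum_congr rfl fun a _ => ?_
  rw [conjMap_apply, krausTensor, tensor_conjTranspose, tensor_mul, tensor_mul]

/-- The outcome `(z, a)` has the amplitude `⟨z|Uᴴ K_a U|0⟩`; completeness of the Kraus operators
makes this a distribution, and the outcome zero selects all the `O j`. A product of projectors is
conjugated in three stages, by `Uᴴ`, by the channels and by `U`, where a projector on an ancilla
acts by restricting the channel of its qubit. -/
theorem hasLaw_mean (U : QCircuit n d) {O : Fin n → Matrix (Fin 2) (Fin 2) ℂ}
    (hO : ∀ j, IsKraus (O j)) :
    HasLaw (n + n) (4 ^ d * 4) (pathMean U O) (‖meanValue U O‖ ^ 2) := by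
  set G : (Fin n → Fin 2) → Op n := fun a => (op U)ᴴ * krausTensor O a * op U with hG
  have hGsum : ∑ a, (G a)ᴴ * G a = 1 := by
    have h1 : ∀ a, (G a)ᴴ * G a = (op U)ᴴ * ((krausTensor O a)ᴴ * krausTensor O a) * op U := by
      intro a
      simp only [hG, Matrix.conjTranspose_mul, Matrix.conjTranspose_conjTranspose]
      calc _ = (op U)ᴴ * (krausTensor O a)ᴴ * (op U * (op U)ᴴ) * krausTensor O a * op U := by
            simp only [Matrix.mul_assoc]
        _ = _ := by rw [op_unitary', mul_one]; simp only [Matrix.mul_assoc]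
    simp only [h1, ← Finset.sum_mul, ← Finset.mul_sum]
    have h2 := tensor_channel O (fun _ => Finset.univ) fun _ => 1
    simp only [Cfg.channel_apply, mul_one, (hO _).complete, tensor_one, Fintype.piFinset_univ,
      LinearMap.sum_apply, conjMap_apply] at h2
    rw [← h2, mul_one, op_unitary]
  refine ⟨(Fin n → Fin 2) × (Fin n → Fin 2), inferInstance, fun ω => ‖G ω.2 ω.1 0‖ ^ 2,
    fun ω => ones ω.1 ∪ (ones ω.2).map (addLeftEmbedding n), 0, fun _ => by positivity,
    ?_, ?_, ?_, ?_, ?_⟩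
  · rw [Fintype.sum_prod_type_right]
    have h := congrFun (congrFun hGsum 0) 0
    rw [Matrix.sum_apply, Matrix.one_apply_eq] at h
    have h2 : ∑ a, ∑ z, ((‖G a z 0‖ ^ 2 : ℝ) : ℂ) = 1 := by
      rw [← h]
      refine Finset.sum_congr rfl fun a _ => ?_
      rw [Matrix.mul_apply]
      refine Finset.sum_congr rfl fun z _ => ?_
      rw [Matrix.conjTranspose_apply, Complex.ofReal_pow, ← Complex.conj_mul']
      rfl
    simp only [← Complex.ofReal_sum] at h2
    exact_mod_cast h2
  · rintro ⟨z, a⟩ k hk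
    simp only [Finset.mem_union, Finset.mem_map, addLeftEmbedding_apply] at hk
    rw [Finset.mem_range]
    rcases hk with hk | ⟨k, hk, rfl⟩
    · obtain ⟨h, _⟩ := mem_ones.1 hk
      omega
    · obtain ⟨h, _⟩ := mem_ones.1 hk
      omega
  · rintro ⟨z, a⟩
    rw [Finset.union_eq_empty, Finset.map_eq_empty, ones_eq_empty, ones_eq_empty]
    exact (Prod.ext_iff (x := (z, a)) (y := 0)).symm
  · simp only [hG, meanValue, zeroElement, krausTensor, Prod.snd_zero, Prod.fst_zero]
    simp [krausOp]
  · intro κ c hc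
    set S : Fin n → Finset (Fin 2) := fun j => Cfg.outcomes n c.mark j with hS
    set ρ₀ : Op n →ₗ[ℂ] ℂ := Matrix.entryLinearMap ℂ ℂ 0 0 with hρ₀
    set ρ₁ : Op n →ₗ[ℂ] ℂ := ρ₀ ∘ₗ conjMap (op U) with hρ₁
    set ρ₂ : Op n →ₗ[ℂ] ℂ :=
      ρ₁ ∘ₗ ∑ a ∈ Fintype.piFinset S, conjMap (krausTensor O a) with hρ₂
    set A₁ := Cfg.cone ((gateList U).map Gate.inv) c.mark with hA₁
    set A₂ := Cfg.krausCone (List.finRange n).reverse A₁ with hA₂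
    -- Gates act on the first `n` bits only, so the first stage leaves the marks of the ancillas
    -- alone.
    have hmem : ∀ gs : List (Gate n), ∀ A : Finset ℕ, ∀ j : ℕ,
        n + j ∈ Cfg.cone gs A ↔ n + j ∈ A := by
      intro gs
      induction gs with
      | nil => intro A j; rfl
      | cons g gs ih =>
        intro A j
        rw [Cfg.cone_cons, ih]
        split_ifs
        · rfl
        · rw [Finset.mem_union, Gate.mem_support]
          constructor
          · rintro (⟨h, _⟩ | h)
            · omega
            · exact h
          · exact Or.inr
    have key := Cfg.Sums.gates (c := c) (R := 64 ^ Cfg.krausTouched (List.finRange n).reverse A₁ *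
        (64 ^ Cfg.touched (gateList U).reverse A₂ * 1)) (K := fun c =>
      ((c.channels O (List.finRange n).reverse).gates (gateList U).reverse).final n)
      ρ₂ ((gateList U).map Gate.inv) fun c₁ hc₁ => by
        have h2 := Cfg.Sums.channels (c := c₁) (R := 64 ^ Cfg.touched (gateList U).reverse A₂ * 1)
          (K := fun c => (c.gates (gateList U).reverse).final n) hO ρ₁ (ks := (List.finRange n).reverse)
          (List.nodup_reverse.2 (List.nodup_finRange n)) fun c₂ hc₂ => by
            have h3 := Cfg.Sums.gates (c := c₂) (K := Cfg.final n) (R := 1) ρ₀ (gateList U).reverse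
              fun c₃ _ => Cfg.Sums.final c₃
            rw [← op_eq] at h3
            rw [hc₁, ← hA₁, ← hA₂] at hc₂
            rw [← hc₂]
            exact h3
        rw [hc₁, ← hA₁] at h2
        have hS' : ∀ j : Fin n, Cfg.outcomes n A₁ j = S j := by
          intro j
          simp only [hS, Cfg.outcomes, hA₁, hmem]
        simp only [List.mem_reverse, List.mem_finRange, if_true, hS', tensor_channel] at h2
        exact h2
    have hval : ρ₂ (conjMap (((gateList U).map Gate.inv).map Gate.op).prod (c.op n)) =
        (expectOn (fun ω : (Fin n → Fin 2) × (Fin n → Fin 2) => ‖G ω.2 ω.1 0‖ ^ 2)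
          (fun ω => ones ω.1 ∪ (ones ω.2).map (addLeftEmbedding n)) (fun _ => 1) c.mark : ℝ) := by
      rw [← op_conjTranspose, hρ₂, LinearMap.comp_apply, LinearMap.sum_apply, map_sum]
      have h1 : ∀ a, ρ₁ (conjMap (krausTensor O a) (conjMap (op U)ᴴ (c.op n))) =
          conjMap (G a) (c.op n) 0 0 := by
        intro a
        simp only [hρ₁, hρ₀, LinearMap.comp_apply, Matrix.entryLinearMap_apply, conjMap_apply, hG,
          Matrix.conjTranspose_mul, Matrix.conjTranspose_conjTranspose, Matrix.mul_assoc]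
      simp only [h1, Cfg.conj_diagonal_apply hc.ones]
      -- Strings of outcomes that disagree with a marked ancilla contribute nothing, so the sum over
      -- compatible strings extends to all of them.
      rw [expectOn, Complex.ofReal_sum, Fintype.sum_prod_type_right,
        ← Finset.sum_subset (Finset.subset_univ (Fintype.piFinset S))]
      · refine Finset.sum_congr rfl fun a ha => Finset.sum_congr rfl fun z _ => ?_
        rw [Fintype.mem_piFinset] at ha
        have : (∀ k : Fin n, (k : ℕ) ∈ c.mark → z k = 1) ↔
            c.mark ⊆ ones z ∪ (ones a).map (addLeftEmbedding n) := by
          constructor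
          · intro h k hk
            have hkn : k < n + n := by simpa using hc.subset hk
            rw [Finset.mem_union]
            by_cases hlt : k < n
            · exact Or.inl (mem_ones.2 ⟨hlt, h ⟨k, hlt⟩ hk⟩)
            · right
              have hk' : k = n + (k - n) := by omega
              have hj : k - n < n := by omega
              refine Finset.mem_map.2 ⟨k - n, mem_ones.2 ⟨hj, ?_⟩, hk'.symm⟩
              have := ha ⟨k - n, hj⟩
              simp only [hS, Cfg.outcomes, ← hk', hk, if_true, Finset.mem_singleton] at this
              exact this
          · intro h k hk
            have := h hk
            rw [Finset.mem_union] at this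
            rcases this with h1 | h1
            · obtain ⟨_, h2⟩ := mem_ones.1 h1
              exact h2
            · obtain ⟨j, _, hj⟩ := Finset.mem_map.1 h1
              simp only [addLeftEmbedding_apply] at hj
              omega
        simp only [this]
        split_ifs <;> simp
      · intro a _ ha
        refine Finset.sum_eq_zero fun z _ => ?_
        rw [Fintype.mem_piFinset] at ha
        push Not at ha
        obtain ⟨j, hj⟩ := ha
        rw [if_neg, Complex.ofReal_zero]
        intro hsub
        apply hj
        simp only [hS, Cfg.outcomes]
        split_ifs with hm
        · have := hsub hm
          rw [Finset.mem_union] at this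
          rcases this with h1 | h1
          · obtain ⟨h2, _⟩ := mem_ones.1 h1
            omega
          · obtain ⟨i, h2, hi⟩ := Finset.mem_map.1 h1
            simp only [addLeftEmbedding_apply, add_right_inj] at hi
            subst hi
            obtain ⟨_, h3⟩ := mem_ones.1 h2
            rw [Finset.mem_singleton]
            exact h3
        · exact Finset.mem_univ _
    rw [hval] at key
    refine Cfg.Sums.mono key ?_
    rw [mul_one, ← pow_add, ← pow_add]
    refine Nat.pow_le_pow_right (by norm_num) ?_
    have h1 := Cfg.touched_layers (layers_inv_pairwise U) c.mark
    have h1' := Cfg.card_cone_layers (layers_inv_pairwise U) c.mark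
    rw [← gateList_inv] at h1 h1'
    have h2 := Cfg.krausTouched_le (List.nodup_reverse.2 (List.nodup_finRange n)) A₁ A₁
      fun k _ => ⟨id, id⟩
    have h2' := Cfg.card_krausCone_le (List.finRange n).reverse A₁
    have h3 := Cfg.touched_layers (layers_reverse_pairwise U) A₂
    rw [← gateList_reverse] at h3
    simp only [List.length_map, List.length_reverse, List.length_ofFn] at h1 h1' h3
    rw [← hA₁] at h1'
    rw [← hA₂] at h2'
    have hp : (4 : ℕ) ^ d = 2 ^ d * 2 ^ d := by rw [← mul_pow]; norm_num
    rw [hp]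
    have hp1 : 0 < 2 ^ d := by positivity
    have h4 := hc.card
    generalize 2 ^ d = p at *
    generalize A₁.card = a₁ at *
    generalize A₂.card = a₂ at *
    generalize c.mark.card = a at *
    generalize Cfg.touched (List.map Gate.inv (gateList U)) c.mark = t₁ at *
    generalize Cfg.krausTouched (List.finRange n).reverse A₁ = t₂ at *
    generalize Cfg.touched (gateList U).reverse A₂ = t₃ at *
    -- With `p = 2 ^ d`, the first stage touches at most `p κ` gates and leaves at most `p κ` marks.
    -- At most `p κ` channels act and at most double the marks, so the last stage touches at most `2
    -- p² κ` gates. The total is at most `4 p² κ`.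
    have g1 : p * a ≤ p * κ := Nat.mul_le_mul_left _ h4
    have g2 : p * a₂ ≤ p * (2 * (p * κ)) := Nat.mul_le_mul_left _ (by omega)
    have g3 : p * (2 * (p * κ)) + 2 * (p * (p * κ)) = p * p * 4 * κ := by ring
    have g4 : p * κ ≤ p * (p * κ) := Nat.le_mul_of_pos_left _ hp1
    omega

end QCircuit

/-! ### Bounds for Chebyshev polynomials and for the approximating polynomial. -/

theorem chebyshevT_cos (k : ℕ) (θ : ℝ) : chebyshevT k (Real.cos θ) = Real.cos (k * θ) := by
  induction k using Nat.twoStepInduction with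
  | zero => simp [chebyshevT]
  | one => simp [chebyshevT]
  | more k ih ih' =>
    rw [chebyshevT, ih, ih']
    have h1 : ((k + 2 : ℕ) : ℝ) * θ = ((k + 1 : ℕ) : ℝ) * θ + θ := by push_cast; ring
    have h2 : (k : ℝ) * θ = ((k + 1 : ℕ) : ℝ) * θ - θ := by push_cast; ring
    rw [h1, h2, Real.cos_add, Real.cos_sub]
    ring

theorem abs_chebyshevT_le_one (k : ℕ) {y : ℝ} (h₁ : -1 ≤ y) (h₂ : y ≤ 1) : |chebyshevT k y| ≤ 1 := by
  rw [← Real.cos_arccos h₁ h₂, chebyshevT_cos]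
  exact Real.abs_cos_le_one _

theorem one_le_chebyshevT (k : ℕ) {y : ℝ} (hy : 1 ≤ y) :
    1 ≤ chebyshevT k y ∧ chebyshevT k y ≤ chebyshevT (k + 1) y := by
  induction k with
  | zero => simp [chebyshevT, hy]
  | succ k ih =>
    refine ⟨ih.1.trans ih.2, ?_⟩
    rw [chebyshevT]
    nlinarith [ih.1, ih.2]

/-- To the right of one, the polynomial is the mean of the `k`-th powers of `y ± √(y² - 1)`. At `y =
1 + e` the larger base is at least `1 + √e` and the smaller one is nonnegative. -/
theorem pow_le_chebyshevT (k : ℕ) {e : ℝ} (he : 0 ≤ e) :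
    (1 + √e) ^ k / 2 ≤ chebyshevT k (1 + e) := by
  set s := √((1 + e) ^ 2 - 1) with hs
  have hnn : 0 ≤ (1 + e) ^ 2 - 1 := by nlinarith
  have hss : s * s = (1 + e) ^ 2 - 1 := Real.mul_self_sqrt hnn
  have hs0 : 0 ≤ s := Real.sqrt_nonneg _
  have hlt : s ≤ 1 + e := by
    nlinarith [abs_le_of_sq_le_sq' (by nlinarith : s ^ 2 ≤ (1 + e) ^ 2) (by linarith)]
  have key : ∀ k, chebyshevT k (1 + e) = ((1 + e + s) ^ k + (1 + e - s) ^ k) / 2 := by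
    intro k
    induction k using Nat.twoStepInduction with
    | zero => simp [chebyshevT]
    | one => simp [chebyshevT]
    | more k ih ih' =>
      rw [chebyshevT, ih, ih']
      have h1 : (1 + e + s) ^ 2 = 2 * (1 + e) * (1 + e + s) - 1 := by linear_combination hss
      have h2 : (1 + e - s) ^ 2 = 2 * (1 + e) * (1 + e - s) - 1 := by linear_combination hss
      rw [pow_add _ k 2, pow_add _ k 2, h1, h2]
      ring
  rw [key]
  have h3 : √e ≤ s := Real.sqrt_le_sqrt (by nlinarith)
  have h4 : (1 + √e) ^ k ≤ (1 + e + s) ^ k :=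
    pow_le_pow_left₀ (by positivity) (by linarith) k
  have h5 : 0 ≤ (1 + e - s) ^ k := pow_nonneg (by linarith) k
  linarith

/-- The maximum of `|∏ (1 - x / k)|`, `1 ≤ k ≤ m`, over the integers `x` from `1` to `N`. -/
noncomputable def rootBound (N m : ℕ) : ℝ := ∏ k ∈ Finset.range m, ((N : ℝ) / (k + 1) - 1)

section

variable {N m : ℕ}

theorem rootBound_factor_nonneg (hm : m ≤ N) {k : ℕ} (hk : k ∈ Finset.range m) :
    0 ≤ (N : ℝ) / (k + 1) - 1 := by
  rw [Finset.mem_range] at hk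
  have h1 : (k : ℝ) + 1 ≤ N := by exact_mod_cast (by omega : k + 1 ≤ N)
  have h2 : (0 : ℝ) < k + 1 := by positivity
  rw [sub_nonneg, le_div_iff₀ h2]
  linarith

theorem rootBound_nonneg (hm : m ≤ N) : 0 ≤ rootBound N m :=
  Finset.prod_nonneg fun _ hk => rootBound_factor_nonneg hm hk

/-- With `m = N` the linear factors vanish at all the points in question and the approximation is
exact. This settles the case of very small precision. -/
theorem rootBound_self (hN : 0 < N) : rootBound N N = 0 := by
  refine Finset.prod_eq_zero (i := N - 1) (by simp; omega) ?_
  have h : ((N - 1 : ℕ) : ℝ) + 1 = N := by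
    rw [Nat.cast_pred hN]; ring
  rw [h, div_self (by positivity), sub_self]

theorem rootBound_le (hm : m ≤ N) : rootBound N m ≤ (N : ℝ) ^ m := by
  calc rootBound N m ≤ ∏ _k ∈ Finset.range m, (N : ℝ) := by
        refine Finset.prod_le_prod (fun _ hk => rootBound_factor_nonneg hm hk) fun k _ => ?_
        have : (N : ℝ) / (k + 1) ≤ N := div_le_self (by positivity) (by
          have : (0 : ℝ) ≤ k := by positivity
          linarith)
        linarith
    _ = _ := by simp

/-- At `x ≤ m` a linear factor vanishes. For larger `x` the Chebyshev argument `1 - (x - m) / N`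
lies in `[0, 1]`, and every linear factor is largest in modulus at `x = N`. -/
theorem abs_polynomial_le (hm : m ≤ N) (D : ℕ) {x : ℕ} (hx : 1 ≤ x) (hxN : x ≤ N) :
    |(∏ k ∈ Finset.range m, (1 - (x : ℝ) / (k + 1))) * chebyshevT D (1 + (m : ℝ) / N - x / N)| ≤
      rootBound N m := by
  by_cases hxm : x ≤ m
  · rw [Finset.prod_eq_zero (i := x - 1) (by simp; omega), zero_mul, abs_zero]
    · exact rootBound_nonneg hm
    · rw [Nat.cast_pred hx, sub_add_cancel, div_self (by positivity), sub_self]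
  · push Not at hxm
    have hN : (0 : ℝ) < N := by exact_mod_cast (by omega : 0 < N)
    have hxR : (x : ℝ) ≤ N := by exact_mod_cast hxN
    have hmx : (m : ℝ) ≤ x := by exact_mod_cast hxm.le
    have hm0 : (0 : ℝ) ≤ m := by positivity
    have e : 1 + (m : ℝ) / N - x / N = 1 - (x - m) / N := by ring
    have h1 : (x - m : ℝ) / N ≤ 1 := by rw [div_le_one hN]; linarith
    have h2 : 0 ≤ (x - m : ℝ) / N := div_nonneg (by linarith) hN.le
    rw [abs_mul, Finset.abs_prod]
    have h3 : |chebyshevT D (1 + (m : ℝ) / N - x / N)| ≤ 1 :=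
      abs_chebyshevT_le_one D (by rw [e]; linarith) (by rw [e]; linarith)
    have h4 : ∏ k ∈ Finset.range m, |1 - (x : ℝ) / (k + 1)| ≤ rootBound N m := by
      refine Finset.prod_le_prod (fun _ _ => abs_nonneg _) fun k hk => ?_
      rw [Finset.mem_range] at hk
      have h5 : (0 : ℝ) < k + 1 := by positivity
      have h6 : (k : ℝ) + 1 ≤ x := by exact_mod_cast (by omega : k + 1 ≤ x)
      have h7 : 1 ≤ (x : ℝ) / (k + 1) := by rw [le_div_iff₀ h5]; linarith
      have h8 : (x : ℝ) / (k + 1) ≤ N / (k + 1) := by gcongr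
      rw [abs_sub_comm, abs_of_nonneg (by linarith)]
      linarith
    calc _ ≤ rootBound N m * 1 := mul_le_mul h4 h3 (abs_nonneg _) (rootBound_nonneg hm)
      _ = _ := mul_one _

end

/-! ### The path sum approximates the probability of zero. -/

namespace QCircuit

/-- The path sum for the approximating polynomial, started with the counter at `r`. -/
noncomputable def pathTotal (N m D : ℕ) (K : Cfg → ℂ) (r : ℕ) : ℂ :=
  K (((⟨r, ∅, 0, 0, 1⟩ : Cfg).linears N m).cheb N (1 + (m : ℝ) / N) D)

/-- The sum is the expectation of the polynomial before normalization. Its value at zero is `u`, so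
the outcome `ω₀` contributes `u * p₀`, and all others together contribute at most `rootBound N m`;
division by `u` gives the estimate. -/
theorem pathTotal_spec {N E : ℕ} {K : Cfg → ℂ} {p₀ : ℝ} (hK : HasLaw N E K p₀) {m D : ℕ}
    (hm : m ≤ N) {ε : ℝ} (hε : rootBound N m ≤ chebyshevT D (1 + (m : ℝ) / N) * ε) :
    ∃ v : ℝ, PathSum (pathTotal N m D K) ((N + 2) ^ (m + D) * 64 ^ (E * (m + D))) v ∧
      |v / chebyshevT D (1 + (m : ℝ) / N) - p₀| ≤ ε := by
  obtain ⟨Ω, _, P, S, ω₀, hP, hsum, hS, hω₀, hp₀, hKs⟩ := hK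
  set u := chebyshevT D (1 + (m : ℝ) / N) with hu
  set p : ℕ → ℝ := fun x =>
    (∏ k ∈ Finset.range m, (1 - (x : ℝ) / (k + 1))) * chebyshevT D (1 + (m : ℝ) / N - x / N) with hp
  have hu1 : 1 ≤ u := (one_le_chebyshevT D (by
    have : 0 ≤ (m : ℝ) / N := by positivity
    linarith)).1
  refine ⟨∑ ω, P ω * p (S ω).card, ?_, ?_⟩
  · have h := Cfg.Sums.linears (K := fun c => K (c.cheb N (1 + (m : ℝ) / N) D)) (κ := 0)
      (c := ⟨0, ∅, 0, 0, 1⟩) hS m (fun c' hc' =>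
        Cfg.Sums.cheb (K := K) hS (1 + (m : ℝ) / N) D (fun c'' hc'' => hKs _ c'' hc'') hc')
      ⟨by simp, by simp, by simp⟩
    have e : expectOn P S (fun x => (∏ k ∈ Finset.range m, (1 - (x : ℝ) / (k + 1))) *
        (chebyshevT D (1 + (m : ℝ) / N - x / N) * 1)) ∅ = ∑ ω, P ω * p (S ω).card := by
      simp [expectOn, hp]
    simp only [e, one_mul, zero_add] at h
    refine PathSum.mono h ?_
    rw [pow_add, ← mul_assoc]
    gcongr
    omega
  · rw [div_sub' (by positivity), abs_div, abs_of_nonneg (by linarith : 0 ≤ u),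
      div_le_iff₀ (by linarith)]
    have h0 : p 0 = u := by simp [hp, hu]
    classical
    have e : ∑ ω, P ω * p (S ω).card - u * p₀ =
        ∑ ω, P ω * (if ω = ω₀ then 0 else p (S ω).card) := by
      rw [← Finset.add_sum_erase _ _ (Finset.mem_univ ω₀),
        ← Finset.add_sum_erase _ (fun ω => P ω * _) (Finset.mem_univ ω₀)]
      rw [(hω₀ ω₀).2 rfl, Finset.card_empty, h0, hp₀, if_pos rfl, mul_zero, zero_add,
        mul_comm p₀, add_sub_cancel_left]
      refine Finset.sum_congr rfl fun ω hω => ?_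
      rw [if_neg (Finset.ne_of_mem_erase hω)]
    rw [e]
    calc |∑ ω, P ω * (if ω = ω₀ then 0 else p (S ω).card)|
        ≤ ∑ ω, |P ω * (if ω = ω₀ then 0 else p (S ω).card)| := Finset.abs_sum_le_sum_abs _ _
      _ ≤ ∑ ω, P ω * rootBound N m := by
        refine Finset.sum_le_sum fun ω _ => ?_
        rw [abs_mul, abs_of_nonneg (hP ω)]
        refine mul_le_mul_of_nonneg_left ?_ (hP ω)
        split_ifs with h
        · rw [abs_zero]; exact rootBound_nonneg hm
        · refine abs_polynomial_le hm D ?_ ?_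
          · rw [Nat.one_le_iff_ne_zero]
            exact fun h' => h ((hω₀ ω).1 (Finset.card_eq_zero.1 h'))
          · simpa using Finset.card_le_card (hS ω)
      _ = rootBound N m := by rw [← Finset.sum_mul, hsum, one_mul]
      _ ≤ ε * u := by rw [mul_comm]; exact hε

end QCircuit

/-! ## The program

Natural-number arrays: `0` input, `1` number of bits, `2` number of gates, `3` and `4` positions of
the gates in the two inputs, `5` and `6` degrees of the two polynomial factors, `7` counter of the
paths, `8` position of the observables, `9`–`11` parsing; `20` remaining counter of a path, `21`,
`22`, `34` division with remainder, `23` marks, `24` and `25` row and column indices, `26`–`38`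
scratch.  Real arrays: `0` input, `1` precision, `2` threshold, `3` and `4` consecutive Chebyshev
values, `5` number of paths, `6` path sum, `7` power of two, `8` evaluation point; `10` and `11`
amplitude, `12`–`14` scratch. -/

namespace RealRAM

open QCircuit

/-- Twice an expression. -/
abbrev NExpr.dbl (e : NExpr) : NExpr := .add e e

namespace Program

/-- Divide the counter of the path by `b` and put the remainder into array `22`. -/
def digit (b : NExpr) : Program :=
  .seq (block [.letN 34 b, .letN 21 (.const 0)]) (.seq
    (.while (.not (.ltN (.v 20) (.v 34)))
      (block [.letN 20 (.sub (.v 20) (.v 34)), .letN 21 (.add (.v 21) (.const 1))]))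
    (block [.letN 22 (.v 20), .letN 20 (.v 21)]))

end Program

/-- The machine can only add and subtract natural numbers, so division is repeated subtraction, at a
cost linear in the counter. Over all paths this at most squares the number of paths, up to small
factors. -/
theorem runs_digit {b : NExpr} {s : State} {B r : ℕ} (hb : b.eval s = B) (hB : 0 < B)
    (hr : s.nat 20 0 = r) : Runs (.digit b) s (b.cost + 20 * r + 20)
      fun s' => s'.nat 20 0 = r / B ∧ s'.nat 22 0 = r % B := by
  have h1 : Runs (.block [.letN 34 b, .letN 21 (.const 0)]) s (b.cost + 5)
      fun s' => s'.nat 20 0 = r ∧ s'.nat 34 0 = B ∧ s'.nat 21 0 = 0 := by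
    refine Runs.of_loopFree ?_ (hT := ?_)
    · simp [Program.block, Program.run, State.nat_setN, NExpr.eval, hb, hr]
    · simp only [Program.block, Program.maxTime, NExpr.cost]; omega
  refine (h1.seq (T₂ := 20 * r + 15) fun s₁ hs₁ => ?_).mono (by omega) fun _ h => h
  have h2 := Runs.while (b := .not (.ltN (.v 20) (.v 34)))
    (c := .block [.letN 20 (.sub (.v 20) (.v 34)), .letN 21 (.add (.v 21) (.const 1))]) (T := 13)
    (Q := fun s' => s'.nat 20 0 = r % B ∧ s'.nat 21 0 = r / B)
    (fun k s => s.nat 20 0 ≤ k ∧ s.nat 34 0 = B ∧ s.nat 20 0 % B = r % B ∧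
      s.nat 21 0 + s.nat 20 0 / B = r / B) ?_ r s₁
    ⟨hs₁.1.le, hs₁.2.1, by rw [hs₁.1], by rw [hs₁.1, hs₁.2.2, zero_add]⟩
  · refine (h2.seq (T₂ := 8) (Q' := fun s' => s'.nat 20 0 = r / B ∧ s'.nat 22 0 = r % B)
      fun s₂ hs₂ => ?_).mono ?_ fun _ h => h
    · refine Runs.of_loopFree ?_
      simp [Program.block, Program.run, State.nat_setN, NExpr.eval, hs₂]
    · simp only [BExpr.cost, NExpr.cost]; omega
  · rintro k s ⟨h1, h2, h3, h4⟩
    by_cases hlt : s.nat 20 0 < B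
    · left
      rw [Nat.mod_eq_of_lt hlt] at h3
      rw [Nat.div_eq_of_lt hlt] at h4
      exact ⟨by simp [BExpr.holds, NExpr.eval, h2, hlt], h3, by omega⟩
    · right
      push Not at hlt
      refine ⟨by simp [BExpr.holds, NExpr.eval, h2, hlt], k - 1, by omega, ?_⟩
      refine Runs.of_loopFree ?_
      simp only [Program.block, Program.run, State.nat_setN, NExpr.eval, h2]
      refine ⟨by simp; omega, by simp, ?_, ?_⟩
      · simp [← h3, Nat.mod_eq_sub_mod hlt]
      · have := Nat.div_eq_sub_div hB hlt
        simp; omega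

/-- The memory holds the configuration `c` on the first `N` bits. -/
structure Rep (N ρ : ℕ) (s : State) (c : Cfg) : Prop where
  r : s.nat 20 0 = c.r
  le : c.r ≤ ρ
  mark : ∀ k < N, s.nat 23 k = if k ∈ c.mark then 1 else 0
  x : ∀ k < N, s.nat 24 k = (c.x k : ℕ)
  y : ∀ k < N, s.nat 25 k = (c.y k : ℕ)
  re : s.real 10 0 = c.amp.re
  im : s.real 11 0 = c.amp.im

variable {N ρ : ℕ} {s : State} {c : Cfg}

theorem Rep.of_frame {s' : State} (h : Rep N ρ s c) (h20 : s'.nat 20 = s.nat 20)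
    (h23 : s'.nat 23 = s.nat 23) (h24 : s'.nat 24 = s.nat 24) (h25 : s'.nat 25 = s.nat 25)
    (h10 : s'.real 10 = s.real 10) (h11 : s'.real 11 = s.real 11) : Rep N ρ s' c :=
  ⟨by rw [h20, h.r], h.le, by rw [h23]; exact h.mark, by rw [h24]; exact h.x,
    by rw [h25]; exact h.y, by rw [h10, h.re], by rw [h11, h.im]⟩

/-- The counter only decreases, so its initial bound `ρ` prices every digit of a path. The frame may
name the fixed divisor `2` because it depends only on the arrays written. -/
theorem Rep.digit (h : Rep N ρ s c) {b : NExpr} {B : ℕ} (hb : b.eval s = B) (hB : 0 < B)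
    (hc : b.cost ≤ 10 := by decide) :
    Runs (.digit b) s (30 * (ρ + 1)) fun s' => (Rep N ρ s' { c with r := c.r / B } ∧
      s'.nat 22 0 = c.r % B) ∧ Frame (.digit (.const 2)) s s' := by
  refine (runs_digit hb hB h.r).frame.mono ?_ ?_
  · have := h.le
    omega
  · rintro s' ⟨⟨h1, h2⟩, h3⟩
    have h3' : Frame (.digit (.const 2)) s s' := ⟨fun a ha => h3.nat a ha, fun a ha => h3.real a ha⟩
    refine ⟨⟨⟨h1, (Nat.div_le_self _ _).trans h.le, ?_, ?_, ?_, ?_, ?_⟩, h2⟩, h3'⟩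
    · rw [h3'.nat 23]; exact h.mark
    · rw [h3'.nat 24]; exact h.x
    · rw [h3'.nat 25]; exact h.y
    · rw [h3'.real 10]; exact h.re
    · rw [h3'.real 11]; exact h.im

theorem Rep.bit (h : Rep N ρ s c) :
    Runs (.digit (.const 2)) s (30 * (ρ + 1)) fun s' => (Rep N ρ s' { c with r := c.r / 2 } ∧
      s'.nat 22 0 = (Fin.ofNat 2 c.r : ℕ)) ∧ Frame (.digit (.const 2)) s s' :=
  h.digit rfl two_pos

namespace Program

/-- Mark the qubit in register `a`. -/
def fresh (a : ℕ) : Program :=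
  .ite (.ltN (.const 0) (.get 23 (.v a))) .skip (.seq (digit (.const 2))
    (block [.setN 23 (.v a) (.const 1), .setN 24 (.v a) (.v 22), .setN 25 (.v a) (.v 22)]))

end Program

theorem Rep.fresh (h : Rep N ρ s c) {a k : ℕ} (ha : a = 26 ∨ a = 27) (hk : s.nat a 0 = k)
    (hkN : k < N) : Runs (.fresh a) s (60 * (ρ + 1)) fun s' => Rep N ρ s' (c.fresh k) := by
  refine (Runs.ite (T := 30 * (ρ + 1) + 15) (fun hb => ?_) fun hb => ?_).mono
    (by simp only [BExpr.cost, NExpr.cost]; omega) fun _ h => h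
  · have hm : k ∈ c.mark := by
      by_contra hm
      simp [BExpr.holds, NExpr.eval, hk, h.mark k hkN, hm] at hb
    refine Runs.of_loopFree ?_ (hT := by simp only [Program.maxTime]; omega)
    simpa [Program.run, Cfg.fresh, hm] using h
  · have hm : k ∉ c.mark := by
      intro hm
      simp [BExpr.holds, NExpr.eval, hk, h.mark k hkN, hm] at hb
    refine h.bit.seq fun s₁ hs₁ => Runs.of_loopFree ?_
      (hT := by simp [Program.block, Program.maxTime, NExpr.cost])
    obtain ⟨⟨h1, h2⟩, hf⟩ := hs₁
    have hk₁ : s₁.nat a 0 = k := by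
      rcases ha with rfl | rfl
      · rw [hf.nat 26, hk]
      · rw [hf.nat 27, hk]
    simp only [Program.run, Program.block, NExpr.eval, Cfg.fresh, hm, if_false]
    have ha' : a ≠ 23 ∧ a ≠ 24 ∧ a ≠ 25 := by omega
    refine ⟨?_, ?_, ?_, ?_, ?_, ?_, ?_⟩
    · simp [State.nat_setN, h1.r]
    · exact h1.le
    · intro j hj
      have := h1.mark j hj
      by_cases hjk : j = k <;> simp [State.nat_setN, ha', hk₁, this, hjk]
    · intro j hj
      have := h1.x j hj
      by_cases hjk : j = k <;> simp [State.nat_setN, ha', hk₁, this, hjk, h2]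
    · intro j hj
      have := h1.y j hj
      by_cases hjk : j = k <;> simp [State.nat_setN, ha', hk₁, this, hjk, h2]
    · exact h1.re
    · exact h1.im

end RealRAM

/-! ### Programs for multiplying a matrix unit by a stored operator. -/

namespace RealRAM

open QCircuit

/-- The entries of a one-qubit operator are stored from `b` on. -/
def MatOne (f : ℕ → ℝ) (b : ℕ) (M : Matrix (Fin 2) (Fin 2) ℂ) : Prop :=
  ∀ p q : Fin 2, f (b + (4 * p + 2 * q)) = (M p q).re ∧ f (b + (4 * p + 2 * q) + 1) = (M p q).im

/-- The entries of a two-qubit operator are stored from `b` on. -/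
def MatTwo (f : ℕ → ℝ) (b : ℕ) (M : Matrix (Fin 2 × Fin 2) (Fin 2 × Fin 2) ℂ) : Prop :=
  ∀ p q : Fin 2 × Fin 2,
    f (b + (8 * (2 * p.1 + p.2) + 2 * (2 * q.1 + q.2))) = (M p q).re ∧
      f (b + (8 * (2 * p.1 + p.2) + 2 * (2 * q.1 + q.2)) + 1) = (M p q).im

namespace Program

/-- The address of an entry of the matrix at position `v 28`; `30` and `31` hold its indices. -/
def entryAddr (two transp : Bool) : NExpr :=
  let P : NExpr := .dbl (.dbl (.v (bif transp then 31 else 30)))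
  .add (.v 28) (.add (bif two then .dbl P else P) (.dbl (.v (bif transp then 30 else 31))))

/-- Multiply the amplitude by a matrix entry or its conjugate. -/
def mulEntry (ra : ℕ) (two transp conj : Bool) : Program :=
  let a : RExpr := .get ra (.v 32)
  let b : RExpr := .get ra (.add (.v 32) (.const 1))
  -- The old real part is saved because the new imaginary part needs it after cell `10` has been
  -- overwritten.
  block [.letN 32 (entryAddr two transp), .letR 12 (.v 10),
    .letR 10 (bif conj then .add (.mul (.v 10) a) (.mul (.v 11) b)
      else .sub (.mul (.v 10) a) (.mul (.v 11) b)),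
    .letR 11 (bif conj then .sub (.mul (.v 11) a) (.mul (.v 12) b)
      else .add (.mul (.v 11) a) (.mul (.v 12) b))]

/-- Multiply the matrix unit by a one-qubit operator from the side of the index array `arr`. -/
def sideOne (arr ra : ℕ) (transp conj : Bool) : Program :=
  .seq (.letN 30 (.get arr (.v 26))) (.seq (digit (.const 2)) (.seq
    (block [.setN arr (.v 26) (.v 22), .letN 31 (.v 22)]) (mulEntry ra false transp conj)))

/-- Multiply the matrix unit by a two-qubit operator from the side of the index array `arr`. -/
def sideTwo (arr : ℕ) (transp conj : Bool) : Program :=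
  .seq (.letN 30 (.add (.dbl (.get arr (.v 26))) (.get arr (.v 27)))) (.seq (digit (.const 2)) (.seq
    (block [.setN arr (.v 26) (.v 22), .letN 31 (.v 22)]) (.seq (digit (.const 2)) (.seq
      (block [.setN arr (.v 27) (.v 22), .letN 31 (.add (.dbl (.v 31)) (.v 22))])
      (mulEntry 0 true transp conj)))))

end Program

variable {N ρ : ℕ} {s : State} {c : Cfg}

theorem entryAddr_eval {two transp : Bool} {b p q : ℕ} (hb : s.nat 28 0 = b)
    (hp : s.nat (bif transp then 31 else 30) 0 = p)
    (hq : s.nat (bif transp then 30 else 31) 0 = q) :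
    (Program.entryAddr two transp).eval s = b + ((bif two then 8 else 4) * p + 2 * q) := by
  cases two <;> simp only [Program.entryAddr, NExpr.eval, hb, hp, hq, cond_true, cond_false] <;> ring

/-- Matrices come either from the input, array `0`, or from the computed defect, array `13`; neither
is overwritten here. -/
theorem Rep.mulEntry (h : Rep N ρ s c) {ra : ℕ} (hra : ra = 0 ∨ ra = 13)
    {two transp conj : Bool} {A : ℕ} {z : ℂ} (hA : (Program.entryAddr two transp).eval s = A)
    (h1 : s.real ra A = z.re) (h2 : s.real ra (A + 1) = z.im) :
    Runs (.mulEntry ra two transp conj) s 90 fun s' =>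
      Rep N ρ s' { c with amp := c.amp * bif conj then star z else z } := by
  have hra' : ra ≠ 10 ∧ ra ≠ 11 ∧ ra ≠ 12 := by omega
  refine Runs.of_loopFree ?_ (hT := ?_)
  · simp only [Program.mulEntry, Program.block, Program.run]
    refine ⟨h.r, h.le, h.mark, h.x, h.y, ?_, ?_⟩
    · cases conj <;> simp [State.real_setR, State.nat_setN, RExpr.eval, NExpr.eval, hA, h1, h2, hra',
        h.re, h.im]
    · cases conj <;> simp [State.real_setR, State.nat_setN, RExpr.eval, NExpr.eval, hA, h1, h2, hra',
        h.re, h.im] <;> ring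
  · cases two <;> cases transp <;> cases conj <;>
      simp [Program.mulEntry, Program.entryAddr, Program.block, Program.maxTime, NExpr.cost,
        RExpr.cost]

theorem Rep.setX (h : Rep N ρ s c) {i a : ℕ} (hi : s.nat 26 0 = i ∧ a = 26 ∨ s.nat 27 0 = i ∧ a = 27)
    {v : Fin 2} (hv : s.nat 22 0 = v) {e : NExpr} (he : e.cost ≤ 20) :
    Runs (.block [.setN 24 (.v a) (.v 22), .letN 31 e]) s 30 fun s' =>
      (Rep N ρ s' { c with x := Function.update c.x i v }) ∧
        s'.nat 31 0 = e.eval (s.setN 24 i v) := by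
  have hi' : s.nat a 0 = i := by rcases hi with ⟨h, rfl⟩ | ⟨h, rfl⟩ <;> exact h
  refine Runs.of_loopFree ?_ (hT := by simp [Program.block, Program.maxTime, NExpr.cost]; omega)
  simp only [Program.run, Program.block, NExpr.eval, hi', hv]
  refine ⟨⟨h.r, h.le, h.mark, fun j hj => ?_, h.y, h.re, h.im⟩, by simp [State.nat_setN]⟩
  by_cases hjk : j = i <;> simp [State.nat_setN, h.x j hj, hjk]

theorem Rep.setY (h : Rep N ρ s c) {i a : ℕ} (hi : s.nat 26 0 = i ∧ a = 26 ∨ s.nat 27 0 = i ∧ a = 27)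
    {v : Fin 2} (hv : s.nat 22 0 = v) {e : NExpr} (he : e.cost ≤ 20) :
    Runs (.block [.setN 25 (.v a) (.v 22), .letN 31 e]) s 30 fun s' =>
      (Rep N ρ s' { c with y := Function.update c.y i v }) ∧
        s'.nat 31 0 = e.eval (s.setN 25 i v) := by
  have hi' : s.nat a 0 = i := by rcases hi with ⟨h, rfl⟩ | ⟨h, rfl⟩ <;> exact h
  refine Runs.of_loopFree ?_ (hT := by simp [Program.block, Program.maxTime, NExpr.cost]; omega)
  simp only [Program.run, Program.block, NExpr.eval, hi', hv]
  refine ⟨⟨h.r, h.le, h.mark, h.x, fun j hj => ?_, h.re, h.im⟩, by simp [State.nat_setN]⟩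
  by_cases hjk : j = i <;> simp [State.nat_setN, h.y j hj, hjk]

theorem Rep.letN (h : Rep N ρ s c) {a : ℕ} (ha : a ≠ 20 ∧ a ≠ 23 ∧ a ≠ 24 ∧ a ≠ 25) (e : NExpr) {T : ℕ}
    (hT : e.cost + 2 ≤ T) :
    Runs (.letN a e) s T fun s' => Rep N ρ s' c ∧ s' = s.setN a 0 (e.eval s) := by
  refine ⟨_, _, .setN _ _ _ _, by simp only [NExpr.cost]; omega, ?_, rfl⟩
  simp only [NExpr.eval]
  have : ∀ a' ∈ [20, 23, 24, 25], (s.setN a 0 (e.eval s)).nat a' = s.nat a' := by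
    intro a' ha'
    have : a' ≠ a := by rintro rfl; simp at ha'; omega
    funext j
    simp [State.nat_setN, this]
  exact h.of_frame (this _ (by simp)) (this _ (by simp)) (this _ (by simp)) (this _ (by simp)) rfl rfl

/-- The entry used by a multiplication. -/
noncomputable def entry {ι : Type} (transp conj : Bool) (M : Matrix ι ι ℂ) (p q : ι) : ℂ :=
  bif conj then star (bif transp then M q p else M p q) else bif transp then M q p else M p q

theorem Rep.sideOne_row (h : Rep N ρ s c) {ra : ℕ} (hra : ra = 0 ∨ ra = 13) {transp conj : Bool}
    {M : Matrix (Fin 2) (Fin 2) ℂ} (hM : MatOne (s.real ra) (s.nat 28 0) M) {i : ℕ}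
    (hi : s.nat 26 0 = i) (hiN : i < N) :
    Runs (.sideOne 24 ra transp conj) s (180 * (ρ + 1)) fun s' => Rep N ρ s'
      { c with r := c.r / 2, x := Function.update c.x i (Fin.ofNat 2 c.r),
               amp := c.amp * entry transp conj M (c.x i) (Fin.ofNat 2 c.r) } := by
  have hra' : ra ≠ 10 ∧ ra ≠ 11 ∧ ra ≠ 12 := by omega
  refine (((h.letN (a := 30) (by omega) (.get 24 (.v 26)) (T := 10) (by decide)).seq
    (T₂ := 30 * (ρ + 1) + (30 + 90)) fun s₁ ⟨h₁, e₁⟩ =>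
    h₁.bit.seq fun s₂ ⟨⟨h₂, e₂⟩, f₂⟩ => ?_)).mono (by omega) fun _ h => h
  have h26 : s₂.nat 26 0 = i := by rw [f₂.nat 26, e₁]; simp [State.nat_setN, hi]
  have h28 : s₂.nat 28 0 = s.nat 28 0 := by rw [f₂.nat 28, e₁]; simp [State.nat_setN]
  have h30 : s₂.nat 30 0 = c.x i := by
    rw [f₂.nat 30, e₁]; simp [State.nat_setN, NExpr.eval, hi, h.x i hiN]
  have hr : s₂.real ra = s.real ra := by
    rcases hra with rfl | rfl
    · rw [f₂.real 0, e₁]; rfl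
    · rw [f₂.real 13, e₁]; rfl
  refine (h₂.setX (.inl ⟨h26, rfl⟩) e₂ (e := .v 22) (by decide)).frame.seq fun s₃ ⟨⟨h₃, e₃⟩, f₃⟩ => ?_
  have h28' : s₃.nat 28 0 = s.nat 28 0 := by rw [f₃.nat 28, h28]
  have h30' : s₃.nat 30 0 = c.x i := by rw [f₃.nat 30, h30]
  have h31' : s₃.nat 31 0 = Fin.ofNat 2 c.r := by
    rw [e₃]; simp only [NExpr.eval, State.nat_setN]; simpa using e₂
  have hr' : s₃.real ra = s.real ra := by
    rcases hra with rfl | rfl <;> rw [← hr]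
    · exact f₃.real 0
    · exact f₃.real 13
  cases transp
  · exact (h₃.mulEntry hra (entryAddr_eval h28' h30' h31') (z := M (c.x i) (Fin.ofNat 2 c.r))
      (by rw [hr']; exact (hM _ _).1) (by rw [hr']; exact (hM _ _).2))
  · exact (h₃.mulEntry hra (entryAddr_eval h28' h31' h30') (z := M (Fin.ofNat 2 c.r) (c.x i))
      (by rw [hr']; exact (hM _ _).1) (by rw [hr']; exact (hM _ _).2))

theorem Rep.sideOne_col (h : Rep N ρ s c) {ra : ℕ} (hra : ra = 0 ∨ ra = 13) {transp conj : Bool}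
    {M : Matrix (Fin 2) (Fin 2) ℂ} (hM : MatOne (s.real ra) (s.nat 28 0) M) {i : ℕ}
    (hi : s.nat 26 0 = i) (hiN : i < N) :
    Runs (.sideOne 25 ra transp conj) s (180 * (ρ + 1)) fun s' => Rep N ρ s'
      { c with r := c.r / 2, y := Function.update c.y i (Fin.ofNat 2 c.r),
               amp := c.amp * entry transp conj M (c.y i) (Fin.ofNat 2 c.r) } := by
  have hra' : ra ≠ 10 ∧ ra ≠ 11 ∧ ra ≠ 12 := by omega
  refine (((h.letN (a := 30) (by omega) (.get 25 (.v 26)) (T := 10) (by decide)).seq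
    (T₂ := 30 * (ρ + 1) + (30 + 90)) fun s₁ ⟨h₁, e₁⟩ =>
    h₁.bit.seq fun s₂ ⟨⟨h₂, e₂⟩, f₂⟩ => ?_)).mono (by omega) fun _ h => h
  have h26 : s₂.nat 26 0 = i := by rw [f₂.nat 26, e₁]; simp [State.nat_setN, hi]
  have h28 : s₂.nat 28 0 = s.nat 28 0 := by rw [f₂.nat 28, e₁]; simp [State.nat_setN]
  have h30 : s₂.nat 30 0 = c.y i := by
    rw [f₂.nat 30, e₁]; simp [State.nat_setN, NExpr.eval, hi, h.y i hiN]
  have hr : s₂.real ra = s.real ra := by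
    rcases hra with rfl | rfl
    · rw [f₂.real 0, e₁]; rfl
    · rw [f₂.real 13, e₁]; rfl
  refine (h₂.setY (.inl ⟨h26, rfl⟩) e₂ (e := .v 22) (by decide)).frame.seq fun s₃ ⟨⟨h₃, e₃⟩, f₃⟩ => ?_
  have h28' : s₃.nat 28 0 = s.nat 28 0 := by rw [f₃.nat 28, h28]
  have h30' : s₃.nat 30 0 = c.y i := by rw [f₃.nat 30, h30]
  have h31' : s₃.nat 31 0 = Fin.ofNat 2 c.r := by
    rw [e₃]; simp only [NExpr.eval, State.nat_setN]; simpa using e₂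
  have hr' : s₃.real ra = s.real ra := by
    rcases hra with rfl | rfl <;> rw [← hr]
    · exact f₃.real 0
    · exact f₃.real 13
  cases transp
  · exact (h₃.mulEntry hra (entryAddr_eval h28' h30' h31') (z := M (c.y i) (Fin.ofNat 2 c.r))
      (by rw [hr']; exact (hM _ _).1) (by rw [hr']; exact (hM _ _).2))
  · exact (h₃.mulEntry hra (entryAddr_eval h28' h31' h30') (z := M (Fin.ofNat 2 c.r) (c.y i))
      (by rw [hr']; exact (hM _ _).1) (by rw [hr']; exact (hM _ _).2))

theorem Rep.sideTwo_row (h : Rep N ρ s c) {transp conj : Bool}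
    {M : Matrix (Fin 2 × Fin 2) (Fin 2 × Fin 2) ℂ} (hM : MatTwo (s.real 0) (s.nat 28 0) M) {i j : ℕ}
    (hi : s.nat 26 0 = i) (hiN : i < N) (hj : s.nat 27 0 = j) (hjN : j < N) :
    Runs (.sideTwo 24 transp conj) s (300 * (ρ + 1)) fun s' => Rep N ρ s'
      { c with
        r := c.r / 2 / 2
        x := Function.update (Function.update c.x i (Fin.ofNat 2 c.r)) j (Fin.ofNat 2 (c.r / 2))
        amp := c.amp * entry transp conj M (c.x i, c.x j)
          (Fin.ofNat 2 c.r, Fin.ofNat 2 (c.r / 2)) } := by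
  refine (((h.letN (a := 30) (by omega) (.add (.dbl (.get 24 (.v 26))) (.get 24 (.v 27))) (T := 20)
    (by decide)).seq (T₂ := 30 * (ρ + 1) + (30 + (30 * (ρ + 1) + (30 + 90)))) fun s₁ ⟨h₁, e₁⟩ =>
    h₁.bit.seq fun s₂ ⟨⟨h₂, e₂⟩, f₂⟩ => ?_)).mono (by omega) fun _ h => h
  have h26 : s₂.nat 26 0 = i := by rw [f₂.nat 26, e₁]; simp [State.nat_setN, hi]
  have h27 : s₂.nat 27 0 = j := by rw [f₂.nat 27, e₁]; simp [State.nat_setN, hj]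
  have h28 : s₂.nat 28 0 = s.nat 28 0 := by rw [f₂.nat 28, e₁]; simp [State.nat_setN]
  have h30 : s₂.nat 30 0 = 2 * c.x i + c.x j := by
    rw [f₂.nat 30, e₁]; simp [State.nat_setN, NExpr.eval, hi, hj, h.x i hiN, h.x j hjN]; ring
  have hr : s₂.real 0 = s.real 0 := by rw [f₂.real 0, e₁]; rfl
  refine (h₂.setX (.inl ⟨h26, rfl⟩) e₂ (e := .v 22) (by decide)).frame.seq fun s₃ ⟨⟨h₃, e₃⟩, f₃⟩ => ?_
  have h31 : s₃.nat 31 0 = Fin.ofNat 2 c.r := by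
    rw [e₃]; simp only [NExpr.eval, State.nat_setN]; simpa using e₂
  refine h₃.bit.seq fun s₄ ⟨⟨h₄, e₄⟩, f₄⟩ => ?_
  have h27' : s₄.nat 27 0 = j := by rw [f₄.nat 27, f₃.nat 27, h27]
  have h31' : s₄.nat 31 0 = Fin.ofNat 2 c.r := by rw [f₄.nat 31, h31]
  refine (h₄.setX (.inr ⟨h27', rfl⟩) e₄ (e := .add (.dbl (.v 31)) (.v 22)) (by decide)).frame.seq
    fun s₅ ⟨⟨h₅, e₅⟩, f₅⟩ => ?_
  have h28' : s₅.nat 28 0 = s.nat 28 0 := by rw [f₅.nat 28, f₄.nat 28, f₃.nat 28, h28]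
  have h30' : s₅.nat 30 0 = 2 * c.x i + c.x j := by rw [f₅.nat 30, f₄.nat 30, f₃.nat 30, h30]
  have h31'' : s₅.nat 31 0 = 2 * (Fin.ofNat 2 c.r : Fin 2) + (Fin.ofNat 2 (c.r / 2) : Fin 2) := by
    rw [e₅]
    simp only [NExpr.eval, State.nat_setN, show (31 : ℕ) ≠ 24 by decide, show (22 : ℕ) ≠ 24 by decide,
      false_and, if_false, e₄, h31']
    ring
  have hr' : s₅.real 0 = s.real 0 := by rw [f₅.real 0, f₄.real 0, f₃.real 0, hr]
  cases transp
  · exact h₅.mulEntry (.inl rfl) (entryAddr_eval h28' h30' h31'')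
      (z := M (c.x i, c.x j) (Fin.ofNat 2 c.r, Fin.ofNat 2 (c.r / 2)))
      (by rw [hr']; exact (hM (c.x i, c.x j) (_, _)).1) (by rw [hr']; exact (hM (c.x i, c.x j) (_, _)).2)
  · exact h₅.mulEntry (.inl rfl) (entryAddr_eval h28' h31'' h30')
      (z := M (Fin.ofNat 2 c.r, Fin.ofNat 2 (c.r / 2)) (c.x i, c.x j))
      (by rw [hr']; exact (hM (_, _) (c.x i, c.x j)).1) (by rw [hr']; exact (hM (_, _) (c.x i, c.x j)).2)

theorem Rep.sideTwo_col (h : Rep N ρ s c) {transp conj : Bool}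
    {M : Matrix (Fin 2 × Fin 2) (Fin 2 × Fin 2) ℂ} (hM : MatTwo (s.real 0) (s.nat 28 0) M) {i j : ℕ}
    (hi : s.nat 26 0 = i) (hiN : i < N) (hj : s.nat 27 0 = j) (hjN : j < N) :
    Runs (.sideTwo 25 transp conj) s (300 * (ρ + 1)) fun s' => Rep N ρ s'
      { c with
        r := c.r / 2 / 2
        y := Function.update (Function.update c.y i (Fin.ofNat 2 c.r)) j (Fin.ofNat 2 (c.r / 2))
        amp := c.amp * entry transp conj M (c.y i, c.y j)
          (Fin.ofNat 2 c.r, Fin.ofNat 2 (c.r / 2)) } := by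
  refine (((h.letN (a := 30) (by omega) (.add (.dbl (.get 25 (.v 26))) (.get 25 (.v 27))) (T := 20)
    (by decide)).seq (T₂ := 30 * (ρ + 1) + (30 + (30 * (ρ + 1) + (30 + 90)))) fun s₁ ⟨h₁, e₁⟩ =>
    h₁.bit.seq fun s₂ ⟨⟨h₂, e₂⟩, f₂⟩ => ?_)).mono (by omega) fun _ h => h
  have h26 : s₂.nat 26 0 = i := by rw [f₂.nat 26, e₁]; simp [State.nat_setN, hi]
  have h27 : s₂.nat 27 0 = j := by rw [f₂.nat 27, e₁]; simp [State.nat_setN, hj]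
  have h28 : s₂.nat 28 0 = s.nat 28 0 := by rw [f₂.nat 28, e₁]; simp [State.nat_setN]
  have h30 : s₂.nat 30 0 = 2 * c.y i + c.y j := by
    rw [f₂.nat 30, e₁]; simp [State.nat_setN, NExpr.eval, hi, hj, h.y i hiN, h.y j hjN]; ring
  have hr : s₂.real 0 = s.real 0 := by rw [f₂.real 0, e₁]; rfl
  refine (h₂.setY (.inl ⟨h26, rfl⟩) e₂ (e := .v 22) (by decide)).frame.seq fun s₃ ⟨⟨h₃, e₃⟩, f₃⟩ => ?_
  have h31 : s₃.nat 31 0 = Fin.ofNat 2 c.r := by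
    rw [e₃]; simp only [NExpr.eval, State.nat_setN]; simpa using e₂
  refine h₃.bit.seq fun s₄ ⟨⟨h₄, e₄⟩, f₄⟩ => ?_
  have h27' : s₄.nat 27 0 = j := by rw [f₄.nat 27, f₃.nat 27, h27]
  have h31' : s₄.nat 31 0 = Fin.ofNat 2 c.r := by rw [f₄.nat 31, h31]
  refine (h₄.setY (.inr ⟨h27', rfl⟩) e₄ (e := .add (.dbl (.v 31)) (.v 22)) (by decide)).frame.seq
    fun s₅ ⟨⟨h₅, e₅⟩, f₅⟩ => ?_
  have h28' : s₅.nat 28 0 = s.nat 28 0 := by rw [f₅.nat 28, f₄.nat 28, f₃.nat 28, h28]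
  have h30' : s₅.nat 30 0 = 2 * c.y i + c.y j := by rw [f₅.nat 30, f₄.nat 30, f₃.nat 30, h30]
  have h31'' : s₅.nat 31 0 = 2 * (Fin.ofNat 2 c.r : Fin 2) + (Fin.ofNat 2 (c.r / 2) : Fin 2) := by
    rw [e₅]
    simp only [NExpr.eval, State.nat_setN, show (31 : ℕ) ≠ 25 by decide, show (22 : ℕ) ≠ 25 by decide,
      false_and, if_false, e₄, h31']
    ring
  have hr' : s₅.real 0 = s.real 0 := by rw [f₅.real 0, f₄.real 0, f₃.real 0, hr]
  cases transp
  · exact h₅.mulEntry (.inl rfl) (entryAddr_eval h28' h30' h31'')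
      (z := M (c.y i, c.y j) (Fin.ofNat 2 c.r, Fin.ofNat 2 (c.r / 2)))
      (by rw [hr']; exact (hM (c.y i, c.y j) (_, _)).1) (by rw [hr']; exact (hM (c.y i, c.y j) (_, _)).2)
  · exact h₅.mulEntry (.inl rfl) (entryAddr_eval h28' h31'' h30')
      (z := M (Fin.ofNat 2 c.r, Fin.ofNat 2 (c.r / 2)) (c.y i, c.y j))
      (by rw [hr']; exact (hM (_, _) (c.y i, c.y j)).1) (by rw [hr']; exact (hM (_, _) (c.y i, c.y j)).2)

end RealRAM

/-! ### Programs for conjugation by the gates of the circuit. -/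

namespace RealRAM

open QCircuit

variable {n N ρ : ℕ} {s : State} {c : Cfg}

/-- The gate `g` is stored at the positions `p` and `b` of the two inputs. -/
def GateAt (f : ℕ → ℕ) (w : ℕ → ℝ) (p b : ℕ) : Gate n → Prop
  | .one i M => f p = 1 ∧ f (p + 1) = i ∧ MatOne w b M.1
  | .two i j _ M => f p = 2 ∧ f (p + 1) = i ∧ f (p + 2) = j ∧ MatTwo w b M.1

namespace Program

/-- Conjugate by gate number `v 35` or by its inverse. -/
def gateStep (inv : Bool) : Program :=
  .seq (block [.letN 33 (.get 3 (.v 35)), .letN 28 (.get 4 (.v 35)),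
    .letN 26 (.get 0 (.add (.v 33) (.const 1))), .letN 27 (.get 0 (.add (.v 33) (.const 2)))])
  (.ite (.ltN (.get 0 (.v 33)) (.const 2))
    (.ite (.ltN (.const 0) (.get 23 (.v 26)))
      (.seq (sideOne 24 0 inv (!inv)) (sideOne 25 0 inv inv)) .skip)
    (.ite (.ltN (.const 0) (.add (.get 23 (.v 26)) (.get 23 (.v 27))))
      (.seq (fresh 26) (.seq (fresh 27) (.seq (sideTwo 24 inv (!inv)) (sideTwo 25 inv inv)))) .skip))

end Program

/-- The inverse gate is not stored. Its entries are those of the gate read transposed, and the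
complex conjugation moves from the row side to the column side. -/
theorem Rep.gateStep (h : Rep N ρ s c) {inv : Bool} {k p b : ℕ} {g : Gate n} (hnN : n ≤ N)
    (hk : s.nat 35 0 = k) (hp : s.nat 3 k = p) (hb : s.nat 4 k = b)
    (hg : GateAt (s.nat 0) (s.real 0) p b g) :
    Runs (.gateStep inv) s (1000 * (ρ + 1)) fun s' => Rep N ρ s'
      (c.gate (bif inv then g.inv else g)) := by
  have h0 : Runs (.block [.letN 33 (.get 3 (.v 35)), .letN 28 (.get 4 (.v 35)),
      .letN 26 (.get 0 (.add (.v 33) (.const 1))), .letN 27 (.get 0 (.add (.v 33) (.const 2)))])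
      s 50 fun s₁ => Rep N ρ s₁ c ∧ s₁.nat 33 0 = p ∧ s₁.nat 28 0 = b ∧
        s₁.nat 26 0 = s.nat 0 (p + 1) ∧ s₁.nat 27 0 = s.nat 0 (p + 2) := by
    refine Runs.of_loopFree ?_
    simp only [Program.block, Program.run, NExpr.eval]
    refine ⟨h.of_frame ?_ ?_ ?_ ?_ rfl rfl, ?_, ?_, ?_, ?_⟩
    on_goal 5 => simp [State.nat_setN, hk, hp]
    on_goal 5 => simp [State.nat_setN, hk, hb]
    on_goal 5 => simp [State.nat_setN, hk, hp]
    on_goal 5 => simp [State.nat_setN, hk, hp]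
    all_goals funext j; simp [State.nat_setN]
  refine (h0.frame.seq (T₂ := 900 * (ρ + 1)) fun s₁ ⟨⟨h₁, h33, h28, h26, h27⟩, f₁⟩ => ?_).mono
    (by omega) fun _ h => h
  have hn0 : s₁.nat 0 = s.nat 0 := f₁.nat 0
  have hr0 : s₁.real 0 = s.real 0 := f₁.real 0
  cases g with
  | one i M =>
    obtain ⟨g1, g2, g3⟩ := hg
    rw [g2] at h26
    have hiN : (i : ℕ) < N := i.2.trans_le hnN
    refine (Runs.ite (T := 360 * (ρ + 1) + 20) (fun _ => ?_) fun hb => ?_).mono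
      (by simp only [BExpr.cost, NExpr.cost]; omega) fun _ h => h
    swap
    · simp [BExpr.holds, NExpr.eval, h33, hn0, g1] at hb
    refine (Runs.ite (T := 360 * (ρ + 1)) (fun hb => ?_) fun hb => ?_).mono
      (by simp only [BExpr.cost, NExpr.cost]; omega) fun _ h => h
    · have hm : (i : ℕ) ∈ c.mark := by
        by_contra hm
        simp [BExpr.holds, NExpr.eval, h26, h₁.mark i hiN, hm] at hb
      refine ((h₁.sideOne_row (M := M.1) (.inl rfl) (by rw [hr0, h28]; exact g3) h26 hiN).frame.seq
        (T₂ := 180 * (ρ + 1)) fun s₂ ⟨h₂, f₂⟩ => ?_).mono (by omega) fun _ h => h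
      refine (h₂.sideOne_col (M := M.1) (.inl rfl) (by rw [f₂.real 0, f₂.nat 28, hr0, h28]; exact g3)
        (by rw [f₂.nat 26]; exact h26) hiN).mono le_rfl fun s' h' => ?_
      cases inv
      · simpa [Cfg.gate, hm, entry, Cfg.rowOne, Cfg.colOne] using h'
      · simpa [Cfg.gate, hm, entry, Cfg.rowOne, Cfg.colOne, Gate.inv, Matrix.star_apply] using h'
    · have hm : (i : ℕ) ∉ c.mark := by
        intro hm
        simp [BExpr.holds, NExpr.eval, h26, h₁.mark i hiN, hm] at hb
      refine Runs.of_loopFree ?_ (hT := by simp only [Program.maxTime]; omega)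
      cases inv <;> simpa [Program.run, Cfg.gate, Gate.inv, hm] using h₁
  | two i j hij M =>
    obtain ⟨g1, g2, g3, g4⟩ := hg
    rw [g2] at h26
    rw [g3] at h27
    have hiN : (i : ℕ) < N := i.2.trans_le hnN
    have hjN : (j : ℕ) < N := j.2.trans_le hnN
    refine (Runs.ite (T := 800 * (ρ + 1)) (fun hb => ?_) fun _ => ?_).mono
      (by simp only [BExpr.cost, NExpr.cost]; omega) fun _ h => h
    · simp [BExpr.holds, NExpr.eval, h33, hn0, g1] at hb
    refine (Runs.ite (T := 720 * (ρ + 1)) (fun hb => ?_) fun hb => ?_).mono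
      (by simp only [BExpr.cost, NExpr.cost]; omega) fun _ h => h
    · have hm : (i : ℕ) ∈ c.mark ∨ (j : ℕ) ∈ c.mark := by
        by_contra hm
        rw [not_or] at hm
        simp [BExpr.holds, NExpr.eval, h26, h27, h₁.mark i hiN, h₁.mark j hjN, hm] at hb
      refine ((h₁.fresh (.inl rfl) h26 hiN).frame.seq (T₂ := 660 * (ρ + 1))
        fun s₂ ⟨h₂, f₂⟩ => ?_).mono (by omega) fun _ h => h
      refine ((h₂.fresh (.inr rfl) (by rw [f₂.nat 27]; exact h27) hjN).frame.seq
        (T₂ := 600 * (ρ + 1)) fun s₃ ⟨h₃, f₃⟩ => ?_).mono (by omega) fun _ h => h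
      refine ((h₃.sideTwo_row (i := i) (j := j) (M := M.1)
        (by rw [f₃.real 0, f₃.nat 28, f₂.real 0, f₂.nat 28, hr0, h28]; exact g4)
        (by rw [f₃.nat 26, f₂.nat 26]; exact h26) hiN
        (by rw [f₃.nat 27, f₂.nat 27]; exact h27) hjN).frame.seq
        (T₂ := 300 * (ρ + 1)) fun s₄ ⟨h₄, f₄⟩ => ?_).mono (by omega) fun _ h => h
      refine (h₄.sideTwo_col (i := i) (j := j) (M := M.1)
        (by rw [f₄.real 0, f₄.nat 28, f₃.real 0, f₃.nat 28, f₂.real 0, f₂.nat 28, hr0, h28]; exact g4)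
        (by rw [f₄.nat 26, f₃.nat 26, f₂.nat 26]; exact h26) hiN
        (by rw [f₄.nat 27, f₃.nat 27, f₂.nat 27]; exact h27) hjN).mono le_rfl fun s' h' => ?_
      cases inv
      · simpa [Cfg.gate, hm, entry, Cfg.rowTwo, Cfg.colTwo] using h'
      · simpa [Cfg.gate, hm, entry, Cfg.rowTwo, Cfg.colTwo, Gate.inv, Matrix.star_apply] using h'
    · have hm : ¬ ((i : ℕ) ∈ c.mark ∨ (j : ℕ) ∈ c.mark) := by
        rintro (hm | hm)
        · simp [BExpr.holds, NExpr.eval, h26, h27, h₁.mark i hiN, hm] at hb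
        · simp [BExpr.holds, NExpr.eval, h26, h27, h₁.mark j hjN, hm] at hb
      refine Runs.of_loopFree ?_ (hT := by simp only [Program.maxTime]; omega)
      cases inv <;> simpa [Program.run, Cfg.gate, Gate.inv, hm] using h₁

/-- The gates are stored in the memory, in order. -/
structure GatesAt (s : State) (gs : List (Gate n)) : Prop where
  length : s.nat 2 0 = gs.length
  gate : ∀ k (hk : k < gs.length), GateAt (s.nat 0) (s.real 0) (s.nat 3 k) (s.nat 4 k) gs[k]

theorem GatesAt.pers {gs : List (Gate n)} (h : GatesAt s gs) {s' : State} (hs : Pers s s') :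
    GatesAt s' gs := by
  refine ⟨by rw [hs.nat 2]; exact h.length, fun k hk => ?_⟩
  rw [hs.nat 0, hs.real 0, hs.nat 3, hs.nat 4]
  exact h.gate k hk

namespace Program

/-- Conjugate by all gates, the last one first. -/
def gatesBackward : Program :=
  forDown 29 (.v 2) (.seq (.letN 35 (.v 29)) (gateStep false))

/-- Conjugate by the inverses of all gates, the first one first. -/
def gatesForward : Program :=
  forDown 29 (.v 2) (.seq (.letN 35 (.sub (.sub (.v 2) (.v 29)) (.const 1))) (gateStep true))

end Program

theorem Pers.setN {a : ℕ} (ha : 20 ≤ a) (i v : ℕ) : Pers s (s.setN a i v) :=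
  ⟨fun b hb => by funext j; simp [State.nat_setN]; omega, fun _ _ => rfl⟩

theorem Rep.setN (h : Rep N ρ s c) {a : ℕ} (ha : 26 ≤ a) (i v : ℕ) : Rep N ρ (s.setN a i v) c := by
  have : ∀ b < 26, (s.setN a i v).nat b = s.nat b := by
    intro b hb
    funext j
    simp [State.nat_setN]; omega
  exact h.of_frame (this _ (by omega)) (this _ (by omega)) (this _ (by omega)) (this _ (by omega))
    rfl rfl

/-- A loop over the elements of a list that acts on configurations. -/
theorem Runs.forDown_rep {e : NExpr} {body : Program} {m T : ℕ} (F : ℕ → Cfg → Cfg)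
    (he : e.eval s = m) (h : Rep N ρ s c) (hw : body.writesN 29 = false) (hl : body.local = true)
    (hbody : ∀ k < m, ∀ s' c', Pers s s' → Rep N ρ s' c' → s'.nat 29 0 = k →
      Runs body s' T fun s'' => Rep N ρ s'' (F k c')) :
    Runs (.forDown 29 e body) s (e.cost + m * (T + 20) + 20) fun s' =>
      Rep N ρ s' ((List.range m).reverse.foldl (fun c k => F k c) c) := by
  have := Runs.forDown (a := 29) (c := body) (T := T) (s := s) (n := m)
    (fun k s' => Pers s s' ∧ Rep N ρ s' ((((List.range m).drop k).reverse).foldl (fun c k => F k c) c))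
    he hw ⟨Pers.setN (by norm_num) _ _, by
      simpa [List.drop_eq_nil_of_le] using h.setN (a := 29) (by norm_num) 0 m⟩ ?_
  · exact this.mono le_rfl fun s' hs' => by simpa using hs'.2
  · rintro k hk s' ⟨h1, h2⟩ -
    have hp : Pers s (s'.setN 29 0 k) := h1.trans (Pers.setN (by norm_num) _ _)
    refine ((hbody k hk _ _ hp (h2.setN (by norm_num) _ _) (by simp [State.nat_setN])).pers hl).mono
      le_rfl fun s'' hs'' => ⟨hp.trans hs''.2, ?_⟩
    rw [List.drop_eq_getElem_cons (by simpa using hk)]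
    simpa using hs''.1

/-- Apply `f` with entry number `k` of a list, if there is one. -/
def stepAt {α β : Type*} (f : β → α → β) (l : List α) (k : ℕ) (b : β) : β :=
  l[k]?.elim b (f b)

theorem foldl_stepAt {α β : Type*} (f : β → α → β) (l : List α) (b : β) :
    (List.range l.length).foldl (fun b k => stepAt f l k b) b = l.foldl f b := by
  induction l generalizing b with
  | nil => rfl
  | cons a l ih =>
    rw [List.length_cons, List.range_succ_eq_map, List.foldl_cons, List.foldl_map, List.foldl_cons]
    exact ih _

theorem foldl_reverse_stepAt {α β : Type*} (f : β → α → β) (l : List α) (b : β) :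
    (List.range l.length).reverse.foldl (fun b k => stepAt f l k b) b = l.reverse.foldl f b := by
  simp only [List.foldl_reverse]
  induction l with
  | nil => rfl
  | cons a l ih =>
    rw [List.length_cons, List.range_succ_eq_map, List.foldr_cons, List.foldr_map, List.foldr_cons,
      ← ih]
    rfl

/-- Loops count down only; an ascending traversal is obtained by reflecting the index in the body.
-/
theorem foldl_reverse_range {β : Type*} (F : ℕ → β → β) (m : ℕ) (b : β) :
    (List.range m).reverse.foldl (fun b k => F (m - k - 1) b) b =
      (List.range m).foldl (fun b k => F k b) b := by
  have h : (List.range m).reverse.map (fun k => m - 1 - k) = List.range m := by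
    refine List.ext_getElem (by simp) fun i h1 h2 => ?_
    simp at h1 ⊢
    omega
  conv_rhs => rw [← h, List.foldl_map]
  simp only [Nat.sub_right_comm]

theorem Rep.gatesBackward (h : Rep N ρ s c) {gs : List (Gate n)} (hnN : n ≤ N) (hgs : GatesAt s gs) :
    Runs .gatesBackward s ((gs.length + 1) * (1100 * (ρ + 1))) fun s' =>
      Rep N ρ s' (c.gates gs.reverse) := by
  refine (Runs.forDown_rep (T := 1000 * (ρ + 1) + 10) (fun k c => stepAt (fun c g => c.gate g) gs k c)
    (e := .v 2) (m := gs.length) hgs.length h rfl rfl ?_).mono ?_ fun s' h' => ?_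
  · intro k hk s' c' hs' hc' h29
    have hg := hgs.pers hs'
    refine ((hc'.letN (a := 35) (by omega) (.v 29) (T := 10) (by decide)).seq (T₂ := 1000 * (ρ + 1))
      fun s₁ ⟨h₁, e₁⟩ => ?_).mono (by omega) fun _ h => h
    have hp : Pers s' s₁ := by rw [e₁]; exact Pers.setN (by norm_num) _ _
    simp only [stepAt, List.getElem?_eq_getElem hk, Option.elim_some]
    refine h₁.gateStep (inv := false) hnN (k := k) ?_ rfl rfl ((hg.pers hp).gate k hk)
    rw [e₁]; simp [State.nat_setN, NExpr.eval, h29]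
  · simp only [NExpr.cost]; nlinarith
  · rwa [foldl_reverse_stepAt] at h'

theorem Rep.gatesForward (h : Rep N ρ s c) {gs : List (Gate n)} (hnN : n ≤ N) (hgs : GatesAt s gs) :
    Runs .gatesForward s ((gs.length + 1) * (1100 * (ρ + 1))) fun s' =>
      Rep N ρ s' (c.gates (gs.map Gate.inv)) := by
  refine (Runs.forDown_rep (T := 1000 * (ρ + 1) + 20)
    (fun k c => stepAt (fun c g => c.gate g.inv) gs (gs.length - k - 1) c)
    (e := .v 2) (m := gs.length) hgs.length h rfl rfl ?_).mono ?_ fun s' h' => ?_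
  · intro k hk s' c' hs' hc' h29
    have hg := hgs.pers hs'
    refine ((hc'.letN (a := 35) (by omega) (.sub (.sub (.v 2) (.v 29)) (.const 1)) (T := 20)
      (by decide)).seq (T₂ := 1000 * (ρ + 1)) fun s₁ ⟨h₁, e₁⟩ => ?_).mono (by omega) fun _ h => h
    have hp : Pers s' s₁ := by rw [e₁]; exact Pers.setN (by norm_num) _ _
    have hk' : gs.length - k - 1 < gs.length := by omega
    simp only [stepAt, List.getElem?_eq_getElem hk', Option.elim_some]
    refine h₁.gateStep (inv := true) hnN (k := gs.length - k - 1) ?_ rfl rfl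
      ((hg.pers hp).gate _ hk')
    rw [e₁]; simp [State.nat_setN, NExpr.eval, h29, hg.length]
  · simp only [NExpr.cost]; nlinarith
  · rw [foldl_reverse_range (fun k c => stepAt (fun (c : Cfg) (g : Gate n) => c.gate g.inv) gs k c), foldl_stepAt] at h'
    rwa [Cfg.gates, List.foldl_map]

end RealRAM

/-! ### Programs for the defect and the channels. -/

namespace RealRAM

open QCircuit Matrix

variable {n N ρ : ℕ} {s : State} {c : Cfg}

theorem Rep.setR (h : Rep N ρ s c) {a : ℕ} (ha : 12 ≤ a) (i : ℕ) (v : ℝ) : Rep N ρ (s.setR a i v) c := by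
  have : ∀ b < 12, (s.setR a i v).real b = s.real b := by
    intro b hb
    funext j
    simp [State.real_setR]; omega
  exact h.of_frame rfl rfl rfl rfl (this _ (by omega)) (this _ (by omega))

namespace Program

/-- Multiply the amplitude by a real number. -/
def scaleBy (e : RExpr) : Program :=
  block [.letR 14 e, .letR 10 (.mul (.v 10) (.v 14)), .letR 11 (.mul (.v 11) (.v 14))]

/-- Set the bit in register `26` to one. -/
def project : Program :=
  block [.setN 23 (.v 26) (.const 1), .setN 24 (.v 26) (.const 1), .setN 25 (.v 26) (.const 1)]

/-- Compute the defect of the operator stored at `v 28`. -/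
def defect : Program :=
  let e (k : ℕ) : RExpr := .get 0 (.add (.v 28) (.const k))
  let sq (k : ℕ) : RExpr := .mul (e k) (e k)
  let re : RExpr := .add (.add (.mul (e 0) (e 2)) (.mul (e 1) (e 3)))
    (.add (.mul (e 4) (e 6)) (.mul (e 5) (e 7)))
  let im : RExpr := .add (.sub (.mul (e 0) (e 3)) (.mul (e 1) (e 2)))
    (.sub (.mul (e 4) (e 7)) (.mul (e 5) (e 6)))
  block [
    .setR 13 (.const 0) (.sub (.const 1) (.add (.add (sq 0) (sq 1)) (.add (sq 4) (sq 5)))),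
    .setR 13 (.const 1) (.const 0),
    .setR 13 (.const 2) (.sub (.const 0) re),
    .setR 13 (.const 3) (.sub (.const 0) im),
    .setR 13 (.const 4) (.sub (.const 0) re),
    .setR 13 (.const 5) im,
    .setR 13 (.const 6) (.sub (.const 1) (.add (.add (sq 2) (sq 3)) (.add (sq 6) (sq 7)))),
    .setR 13 (.const 7) (.const 0),
    -- The matrix pointer now refers to array `13`, where the defect starts at cell `0`.
    .letN 28 (.const 0)]

end Program

theorem Rep.scale (h : Rep N ρ s c) {e : RExpr} {w : ℝ} (he : e.eval s = w)
    (hT : e.cost ≤ 30 := by decide) :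
    Runs (.scaleBy e) s 60 fun s' => Rep N ρ s' (c.scale w) := by
  refine Runs.of_loopFree ?_
    (hT := by simp [Program.scaleBy, Program.block, Program.maxTime, NExpr.cost, RExpr.cost]; omega)
  refine ⟨h.r, h.le, h.mark, h.x, h.y, ?_, ?_⟩ <;>
  simp [Program.scaleBy, Program.block, Program.run, State.real_setR, RExpr.eval, NExpr.eval, he,
    h.re, h.im, Cfg.scale]

theorem Rep.project (h : Rep N ρ s c) {q : ℕ} (hq : s.nat 26 0 = q) :
    Runs .project s 20 fun s' => Rep N ρ s' (c.project q) := by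
  refine Runs.of_loopFree ?_
  simp only [Program.run, Program.block, NExpr.eval, Cfg.project, Program.project]
  refine ⟨h.r, h.le, ?_, ?_, ?_, h.re, h.im⟩
  · intro j hj
    by_cases hjk : j = q <;> simp [State.nat_setN, hq, h.mark j hj, hjk]
  · intro j hj
    by_cases hjk : j = q <;> simp [State.nat_setN, hq, h.x j hj, hjk]
  · intro j hj
    by_cases hjk : j = q <;> simp [State.nat_setN, hq, h.y j hj, hjk]

theorem Rep.defect (h : Rep N ρ s c) {O : Matrix (Fin 2) (Fin 2) ℂ} {b : ℕ} (hb : s.nat 28 0 = b)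
    (hO : MatOne (s.real 0) b O) : Runs .defect s 600 fun s' =>
      Rep N ρ s' c ∧ s'.nat 28 0 = 0 ∧ MatOne (s'.real 13) 0 (QCircuit.defect O) := by
  have h00 := hO 0 0
  have h01 := hO 0 1
  have h10 := hO 1 0
  have h11 := hO 1 1
  simp only [Fin.val_zero, Fin.val_one, mul_zero, mul_one, zero_add, add_zero, add_assoc,
    Nat.reduceAdd] at h00 h01 h10 h11
  refine Runs.of_loopFree ⟨?_, ?_, ?_⟩
  · simp only [Program.defect, Program.block, Program.run]
    exact Rep.setN (by iterate 8 refine Rep.setR ?_ (by norm_num) _ _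
                       exact h) (by norm_num) _ _
  · simp [Program.defect, Program.block, Program.run, State.nat_setN, NExpr.eval]
  · intro p q
    fin_cases p <;> fin_cases q <;>
    simp [Program.defect, Program.block, Program.run, State.real_setR, RExpr.eval, NExpr.eval, hb,
      h00, h01, h10, h11, QCircuit.defect, Matrix.mul_apply, Fin.sum_univ_two] <;> ring_nf <;> simp

namespace Program

/-- The Kraus operator stored at `v 28`. -/
def krausOp (ra : ℕ) : Program := .seq (sideOne 24 ra false true) (sideOne 25 ra false false)

/-- Position of the observable of the qubit in register `26`. -/
def obsAddr : NExpr := .add (.v 8) (.dbl (.dbl (.dbl (.v 26))))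

def krausDefect : Program :=
  .seq (.letN 28 obsAddr) (.seq defect (.seq (krausOp 13)
    -- Cells `0` and `6` hold the real parts of the diagonal, whose sum is the trace.
    (scaleBy (.div (.const 1) (.add (.get 13 (.const 0)) (.get 13 (.const 6)))))))

/-- The channel on qubit `v 29`. -/
def krausStep : Program :=
  .seq (block [.letN 26 (.v 29), .letN 36 (.add (.v 0) (.v 29))])
    (.ite (.ltN (.const 0) (.add (.get 23 (.v 26)) (.get 23 (.v 36))))
      (.seq (fresh 26) (.ite (.ltN (.const 0) (.get 23 (.v 36))) krausDefect
        (.seq (digit (.const 2)) (.ite (.ltN (.v 22) (.const 1))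
          (.seq (.letN 28 obsAddr) (krausOp 0)) krausDefect)))) .skip)

def channels : Program := forDown 29 (.v 0) krausStep

end Program

theorem Rep.krausOp (h : Rep N ρ s c) {ra : ℕ} (hra : ra = 0 ∨ ra = 13)
    {M : Matrix (Fin 2) (Fin 2) ℂ} (hM : MatOne (s.real ra) (s.nat 28 0) M) {i : ℕ}
    (hi : s.nat 26 0 = i) (hiN : i < N) :
    Runs (.krausOp ra) s (360 * (ρ + 1)) fun s' => Rep N ρ s' ((c.rowOne M i).colOne M i) := by
  refine ((h.sideOne_row hra hM hi hiN).frame.seq (T₂ := 180 * (ρ + 1))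
    fun s₁ ⟨h₁, f₁⟩ => ?_).mono (by omega) fun _ h => h
  have hr : s₁.real ra = s.real ra := by
    rcases hra with rfl | rfl
    · exact f₁.real 0
    · exact f₁.real 13
  exact h₁.sideOne_col hra (M := M) (by rw [hr, f₁.nat 28]; exact hM) (by rw [f₁.nat 26]; exact hi) hiN

/-- The observables are stored in the memory. -/
def ObsAt (s : State) (O : Fin n → Matrix (Fin 2) (Fin 2) ℂ) : Prop :=
  ∀ k : Fin n, MatOne (s.real 0) (s.nat 8 0 + 8 * k) (O k)

theorem ObsAt.pers {O : Fin n → Matrix (Fin 2) (Fin 2) ℂ} (h : ObsAt s O) {s' : State}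
    (hs : Pers s s') : ObsAt s' O := by
  intro k
  rw [hs.real 0, hs.nat 8]
  exact h k

theorem obsAddr_eval {k b : ℕ} (hk : s.nat 26 0 = k) (hb : s.nat 8 0 = b) :
    Program.obsAddr.eval s = b + 8 * k := by
  simp only [Program.obsAddr, NExpr.eval, hk, hb]; ring

theorem Rep.krausDefect (h : Rep N ρ s c) {O : Fin n → Matrix (Fin 2) (Fin 2) ℂ} (hO : ObsAt s O)
    {k : Fin n} (hk : s.nat 26 0 = k) (hkN : k < N) :
    Runs .krausDefect s (1060 * (ρ + 1)) fun s' => Rep N ρ s'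
      (((c.rowOne (QCircuit.defect (O k)) k).colOne (QCircuit.defect (O k)) k).scale
        (1 / (QCircuit.defect (O k)).trace.re)) := by
  refine ((h.letN (a := 28) (by omega) Program.obsAddr (T := 30) (by decide)).seq
    (T₂ := 600 + (360 * (ρ + 1) + 60)) fun s₁ ⟨h₁, e₁⟩ => ?_).mono (by omega) fun _ h => h
  have h28 : s₁.nat 28 0 = s.nat 8 0 + 8 * k := by
    rw [e₁, ← obsAddr_eval hk rfl]; simp [State.nat_setN]
  have h26 : s₁.nat 26 0 = k := by rw [e₁]; simp [State.nat_setN, hk]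
  refine ((h₁.defect (O := O k) h28 (by rw [e₁]; exact hO k)).frame.seq
    (T₂ := 360 * (ρ + 1) + 60) fun s₂ ⟨⟨h₂, z₂, m₂⟩, f₂⟩ => ?_).mono (by omega) fun _ h => h
  have h26' : s₂.nat 26 0 = k := by rw [f₂.nat 26, h26]
  refine (h₂.krausOp (.inr rfl) (by rw [z₂]; exact m₂) h26' hkN).frame.seq
    fun s₃ ⟨h₃, f₃⟩ => h₃.scale ?_
  have a0 := (m₂ 0 0).1
  have a1 := (m₂ 1 1).1
  simp only [Fin.val_zero, Fin.val_one, mul_zero, mul_one, zero_add, Nat.reduceAdd] at a0 a1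
  simp [RExpr.eval, NExpr.eval, f₃.real 13, a0, a1, Matrix.trace, Fin.sum_univ_two]

theorem Rep.krausStep (h : Rep N ρ s c) {O : Fin n → Matrix (Fin 2) (Fin 2) ℂ} (hO : ObsAt s O)
    (hn : s.nat 0 0 = n) (hnN : n + n ≤ N) {k : Fin n} (hk : s.nat 29 0 = k) :
    Runs .krausStep s (1300 * (ρ + 1)) fun s' => Rep N ρ s' (c.kraus n (O k) k) := by
  have hk2 := k.2
  have hkN : (k : ℕ) < N := by omega
  have hkN' : n + k < N := by omega
  have h0 : Runs (.block [.letN 26 (.v 29), .letN 36 (.add (.v 0) (.v 29))]) s 20 fun s' =>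
      Rep N ρ s' c ∧ s'.nat 26 0 = k ∧ s'.nat 36 0 = n + k := by
    refine Runs.of_loopFree ⟨?_, ?_, ?_⟩
    · exact (h.setN (by norm_num) _ _).setN (by norm_num) _ _
    · simp [Program.block, Program.run, State.nat_setN, NExpr.eval, hk]
    · simp [Program.block, Program.run, State.nat_setN, NExpr.eval, hk, hn]
  refine (h0.pers.frame.seq (T₂ := 1200 * (ρ + 1)) fun s₁ ⟨⟨⟨h₁, h26, h36⟩, p₁⟩, f₁⟩ => ?_).mono
    (by omega) fun _ h => h
  refine (Runs.ite (T := 1180 * (ρ + 1)) (fun hb => ?_) fun hb => ?_).mono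
    (by simp only [BExpr.cost, NExpr.cost]; omega) fun _ h => h
  swap
  · have hm : ¬ ((k : ℕ) ∈ c.mark ∨ n + k ∈ c.mark) := by
      rintro (hm | hm)
      · simp [BExpr.holds, NExpr.eval, h26, h36, h₁.mark k hkN, hm] at hb
      · simp [BExpr.holds, NExpr.eval, h26, h36, h₁.mark _ hkN', hm] at hb
    refine Runs.of_loopFree ?_ (hT := by simp only [Program.maxTime]; omega)
    simpa [Program.run, Cfg.kraus, hm] using h₁
  have hm : (k : ℕ) ∈ c.mark ∨ n + k ∈ c.mark := by
    by_contra hm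
    rw [not_or] at hm
    simp [BExpr.holds, NExpr.eval, h26, h36, h₁.mark k hkN, h₁.mark _ hkN', hm] at hb
  simp only [Cfg.kraus, if_pos hm]
  refine ((h₁.fresh (.inl rfl) h26 hkN).pers.frame.seq (T₂ := 1120 * (ρ + 1))
    fun s₂ ⟨⟨h₂, p₂⟩, f₂⟩ => ?_).mono (by omega) fun _ h => h
  have h26' : s₂.nat 26 0 = k := by rw [f₂.nat 26, h26]
  have h36' : s₂.nat 36 0 = n + k := by rw [f₂.nat 36, h36]
  refine (Runs.ite (T := 1110 * (ρ + 1)) (fun hb => ?_) fun hb => ?_).mono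
    (by simp only [BExpr.cost, NExpr.cost]; omega) fun _ h => h
  · have hm' : n + k ∈ (c.fresh k).mark := by
      by_contra hm'
      simp [BExpr.holds, NExpr.eval, h36', h₂.mark _ hkN', hm'] at hb
    rw [if_pos hm']
    exact (h₂.krausDefect ((hO.pers p₁).pers p₂) h26' hkN).mono (by omega) fun _ h => h
  · have hm' : n + k ∉ (c.fresh k).mark := by
      intro hm'
      simp [BExpr.holds, NExpr.eval, h36', h₂.mark _ hkN', hm'] at hb
    rw [if_neg hm']
    refine ((h₂.digit (b := .const 2) rfl two_pos).pers.seq (T₂ := 1080 * (ρ + 1))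
      fun s₃ ⟨⟨⟨h₃, v₃⟩, f₃⟩, p₃⟩ => ?_).mono (by omega) fun _ h => h
    have h26'' : s₃.nat 26 0 = k := by rw [f₃.nat 26, h26']
    have hO₃ := ((hO.pers p₁).pers p₂).pers p₃
    refine (Runs.ite (T := 1060 * (ρ + 1)) (fun hb => ?_) fun hb => ?_).mono
      (by simp only [BExpr.cost, NExpr.cost]; omega) fun _ h => h
    · have h0 : (c.fresh k).r % 2 = 0 := by simpa [BExpr.holds, NExpr.eval, v₃] using hb
      rw [if_pos h0]
      refine ((h₃.letN (a := 28) (by omega) Program.obsAddr (T := 30) (by decide)).seq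
        (T₂ := 360 * (ρ + 1)) fun s₄ ⟨h₄, e₄⟩ => ?_).mono (by omega) fun _ h => h
      refine h₄.krausOp (.inl rfl) ?_ (by rw [e₄]; simp [State.nat_setN, h26'']) hkN
      have h28 : s₄.nat 28 0 = s₃.nat 8 0 + 8 * k := by
        rw [e₄, ← obsAddr_eval h26'' rfl]; simp [State.nat_setN]
      rw [h28, e₄]
      exact hO₃ k
    · have h0 : (c.fresh k).r % 2 ≠ 0 := by simpa [BExpr.holds, NExpr.eval, v₃] using hb
      rw [if_neg h0]
      exact h₃.krausDefect hO₃ h26'' hkN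

theorem Rep.channels (h : Rep N ρ s c) {O : Fin n → Matrix (Fin 2) (Fin 2) ℂ} (hO : ObsAt s O)
    (hn : s.nat 0 0 = n) (hnN : n + n ≤ N) :
    Runs .channels s ((n + 1) * (1400 * (ρ + 1))) fun s' =>
      Rep N ρ s' (c.channels O (List.finRange n).reverse) := by
  refine (Runs.forDown_rep (T := 1300 * (ρ + 1))
    (fun k c => stepAt (fun (c : Cfg) (k : Fin n) => c.kraus n (O k) k) (List.finRange n) k c)
    (e := .v 0) (m := n) hn h rfl rfl ?_).mono ?_ fun s' h' => ?_
  · intro k hk s' c' hs' hc' h29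
    have hk' : (List.finRange n)[k]? = some ⟨k, hk⟩ := by simp [hk]
    simp only [stepAt, hk', Option.elim_some]
    exact hc'.krausStep (hO.pers hs') (by rw [hs'.nat 0, hn]) hnN (k := ⟨k, hk⟩) h29
  · simp only [NExpr.cost]; nlinarith
  · have := foldl_reverse_stepAt (fun (c : Cfg) (k : Fin n) => c.kraus n (O k) k) (List.finRange n) c
    rw [List.length_finRange] at this
    rwa [this] at h'

end RealRAM

/-! ### Programs for the two polynomial factors. -/

namespace RealRAM

open QCircuit Matrix

variable {n N ρ : ℕ} {s : State} {c : Cfg}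

namespace Program

/-- Number of bits plus a constant. -/
def base (k : ℕ) : NExpr := .add (.v 1) (.const k)

/-- The linear factor number `v 29`. -/
def linearStep : Program :=
  .seq (digit (base 1)) (.ite (.ltN (.v 22) (.const 1)) .skip
    (.seq (.letN 26 (.sub (.v 22) (.const 1))) (.seq project
      (scaleBy (.div (.sub (.const 0) (.const 1)) (.add (.ofNat (.v 29)) (.const 1)))))))

def linears : Program := forDown 29 (.v 5) linearStep

def chebStep : Program :=
  .seq (.ite (.ltN (.v 38) (.const 2)) (.letR 14 (.const 1)) (.letR 14 (.const 2)))
    (.seq (digit (base 2))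
      (.ite (.ltN (.v 22) (.const 1))
        (.seq (scaleBy (.mul (.v 14) (.v 8))) (.letN 38 (.sub (.v 38) (.const 1))))
        (.ite (.ltN (.v 22) (base 1))
          (.seq (.letN 26 (.sub (.v 22) (.const 1))) (.seq project (.seq
            (scaleBy (.div (.sub (.const 0) (.v 14)) (.ofNat (.v 1))))
            (.letN 38 (.sub (.v 38) (.const 1))))))
          (.seq (scaleBy (.sub (.const 1) (.v 14))) (.letN 38 (.sub (.v 38) (.const 2)))))))

def cheb : Program :=
  .seq (.letN 38 (.v 6)) (.while (.ltN (.const 0) (.v 38)) chebStep)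

end Program

theorem Rep.linearStep (h : Rep N ρ s c) (hN : s.nat 1 0 = N) {k : ℕ} (hk : s.nat 29 0 = k) :
    Runs .linearStep s (200 * (ρ + 1)) fun s' => Rep N ρ s' (c.linear N k) := by
  refine ((h.digit (b := Program.base 1) (B := N + 1) (by simp [Program.base, NExpr.eval, hN])
    (by omega)).pers.seq (T₂ := 130) fun s₁ ⟨⟨⟨h₁, v₁⟩, f₁⟩, p₁⟩ => ?_).mono (by omega) fun _ h => h
  have h29 : s₁.nat 29 0 = k := by rw [f₁.nat 29, hk]
  refine (Runs.ite (T := 110) (fun hb => ?_) fun hb => ?_).mono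
    (by simp only [BExpr.cost, NExpr.cost]; omega) fun _ h => h
  · have h0 : c.r % (N + 1) = 0 := by simpa [BExpr.holds, NExpr.eval, v₁] using hb
    refine Runs.of_loopFree ?_
    simpa [Program.run, Cfg.linear, h0] using h₁
  · have h0 : c.r % (N + 1) ≠ 0 := by simpa [BExpr.holds, NExpr.eval, v₁] using hb
    simp only [Cfg.linear, if_neg h0]
    refine ((h₁.letN (a := 26) (by omega) (.sub (.v 22) (.const 1)) (T := 20) (by decide)).seq
      (T₂ := 20 + 60) fun s₂ ⟨h₂, e₂⟩ => ?_).mono (by omega) fun _ h => h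
    refine (h₂.project (q := c.r % (N + 1) - 1) ?_).frame.seq fun s₃ ⟨h₃, f₃⟩ => h₃.scale ?_
    · rw [e₂]; simp [State.nat_setN, NExpr.eval, v₁]
    · have : s₃.nat 29 0 = k := by rw [f₃.nat 29, e₂]; simpa [State.nat_setN] using h29
      simp [RExpr.eval, NExpr.eval, this]

theorem Rep.linears (h : Rep N ρ s c) (hN : s.nat 1 0 = N) {m : ℕ} (hm : s.nat 5 0 = m) :
    Runs .linears s ((m + 1) * (300 * (ρ + 1))) fun s' => Rep N ρ s' (c.linears N m) := by
  refine (Runs.forDown_rep (T := 200 * (ρ + 1)) (fun k c => c.linear N k) (e := .v 5) (m := m) hm h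
    rfl rfl fun k _ s' c' hs' hc' h29 => hc'.linearStep (by rw [hs'.nat 1, hN]) h29).mono ?_
    fun s' h' => ?_
  · simp only [NExpr.cost]; nlinarith
  · suffices h : ∀ (m : ℕ) (c : Cfg),
        (List.range m).reverse.foldl (fun c k => c.linear N k) c = c.linears N m by rwa [h] at h'
    intro m
    induction m with
    | zero => intro c; rfl
    | succ m ih => intro c; simpa [List.range_succ, Cfg.linears] using ih _

/-- The definition by recursion makes only tail calls, so the loop keeps the value of the remaining
call invariant. The degree falls by one or two, which is why only `k' < k` is claimed. -/
theorem Rep.chebStep (h : Rep N ρ s c) (hN : s.nat 1 0 = N) {k : ℕ} (hk : s.nat 38 0 = k)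
    (hk0 : 0 < k) {y₀ : ℝ} (hy : s.real 8 0 = y₀) :
    Runs .chebStep s (260 * (ρ + 1)) fun s' => ∃ k' < k, s'.nat 38 0 = k' ∧ ∃ c', Rep N ρ s' c' ∧
      c'.cheb N y₀ k' = c.cheb N y₀ k := by
  have hw : Runs (.ite (.ltN (.v 38) (.const 2)) (.letR 14 (.const 1)) (.letR 14 (.const 2))) s 20
      fun s' => Rep N ρ s' c ∧ s'.real 14 0 = if k < 2 then 1 else 2 := by
    refine Runs.of_loopFree ?_
    by_cases hk2 : k < 2 <;>
    simpa [Program.run, BExpr.holds, NExpr.eval, RExpr.eval, hk, hk2, State.real_setR] using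
      h.setR (by norm_num) _ _
  refine (hw.pers.frame.seq (T₂ := 230 * (ρ + 1)) fun s₁ ⟨⟨⟨h₁, w₁⟩, p₁⟩, f₁⟩ => ?_).mono (by omega)
    fun _ h => h
  refine ((h₁.digit (b := Program.base 2) (B := N + 2)
    (by simp [Program.base, NExpr.eval, p₁.nat 1, hN]) (by omega)).pers.seq (T₂ := 190)
    fun s₂ ⟨⟨⟨h₂, v₂⟩, f₂⟩, p₂⟩ => ?_).mono (by omega) fun _ h => h
  have h38 : s₂.nat 38 0 = k := by rw [f₂.nat 38, f₁.nat 38, hk]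
  have h8 : s₂.real 8 0 = y₀ := by rw [p₂.real 8, p₁.real 8, hy]
  obtain ⟨w, hw'⟩ : ∃ w : ℝ, w = if k < 2 then 1 else 2 := ⟨_, rfl⟩
  have h14 : s₂.real 14 0 = w := by rw [f₂.real 14, w₁, hw']
  have hN₂ : s₂.nat 1 0 = N := by rw [p₂.nat 1, p₁.nat 1, hN]
  rw [Cfg.cheb, if_neg hk0.ne']
  simp only [← hw']
  refine (Runs.ite (T := 170) (fun hb => ?_) fun hb => ?_).mono
    (by simp only [BExpr.cost, NExpr.cost]; omega) fun _ h => h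
  · have h0 : c.r % (N + 2) = 0 := by simpa [BExpr.holds, NExpr.eval, v₂] using hb
    rw [if_pos h0]
    refine ((h₂.scale (e := .mul (.v 14) (.v 8)) (w := w * y₀)
      (by simp only [RExpr.eval, NExpr.eval, h14, h8])).frame.seq (T₂ := 20) fun s₃ ⟨h₃, f₃⟩ => Runs.of_loopFree ?_).mono (by omega) fun _ h => h
    refine ⟨k - 1, by omega, ?_, _, h₃.setN (by norm_num) _ _, rfl⟩
    simp [Program.run, State.nat_setN, NExpr.eval, f₃.nat 38, h38]
  · have h0 : c.r % (N + 2) ≠ 0 := by simpa [BExpr.holds, NExpr.eval, v₂] using hb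
    rw [if_neg h0]
    refine (Runs.ite (T := 150) (fun hb => ?_) fun hb => ?_).mono
      (by simp only [BExpr.cost, NExpr.cost, Program.base]; omega) fun _ h => h
    · have h1 : c.r % (N + 2) < N + 1 := by
        simpa [BExpr.holds, NExpr.eval, v₂, Program.base, hN₂] using hb
      rw [if_pos h1]
      refine ((h₂.letN (a := 26) (by omega) (.sub (.v 22) (.const 1)) (T := 20) (by decide)).seq
        (T₂ := 20 + (60 + 20)) fun s₃ ⟨h₃, e₃⟩ => ?_).mono (by omega) fun _ h => h
      refine (h₃.project (q := c.r % (N + 2) - 1) ?_).frame.seq fun s₄ ⟨h₄, f₄⟩ => ?_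
      · rw [e₃]; simp [State.nat_setN, NExpr.eval, v₂]
      have h14' : s₄.real 14 0 = w := by rw [f₄.real 14, e₃]; exact h14
      have hN₄ : s₄.nat 1 0 = N := by rw [f₄.nat 1, e₃]; simpa [State.nat_setN] using hN₂
      have h38' : s₄.nat 38 0 = k := by rw [f₄.nat 38, e₃]; simpa [State.nat_setN] using h38
      refine ((h₄.scale (e := .div (.sub (.const 0) (.v 14)) (.ofNat (.v 1)))
        (w := -w / N)
        (by simp [RExpr.eval, NExpr.eval, h14', hN₄])).frame.seq fun s₅ ⟨h₅, f₅⟩ =>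
          Runs.of_loopFree ?_)
      refine ⟨k - 1, by omega, ?_, _, h₅.setN (by norm_num) _ _, rfl⟩
      simp [Program.run, State.nat_setN, NExpr.eval, f₅.nat 38, h38']
    · have h1 : ¬ c.r % (N + 2) < N + 1 := by
        simpa [BExpr.holds, NExpr.eval, v₂, Program.base, hN₂] using hb
      rw [if_neg h1]
      refine ((h₂.scale (e := .sub (.const 1) (.v 14)) (w := 1 - w)
      (by simp [RExpr.eval, NExpr.eval, h14])).frame.seq (T₂ := 20) fun s₃ ⟨h₃, f₃⟩ => Runs.of_loopFree ?_).mono (by omega) fun _ h => h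
      refine ⟨k - 2, by omega, ?_, _, h₃.setN (by norm_num) _ _, rfl⟩
      simp [Program.run, State.nat_setN, NExpr.eval, f₃.nat 38, h38]

theorem Rep.cheb (h : Rep N ρ s c) (hN : s.nat 1 0 = N) {k : ℕ} (hk : s.nat 6 0 = k) {y₀ : ℝ}
    (hy : s.real 8 0 = y₀) :
    Runs .cheb s ((k + 1) * (300 * (ρ + 1))) fun s' => Rep N ρ s' (c.cheb N y₀ k) := by
  have h2 := Runs.while (b := .ltN (.const 0) (.v 38)) (c := .chebStep) (T := 260 * (ρ + 1))
    (Q := fun s' => Rep N ρ s' (c.cheb N y₀ k))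
    (fun j s' => s'.nat 38 0 ≤ j ∧ s'.nat 1 0 = N ∧ s'.real 8 0 = y₀ ∧ ∃ c', Rep N ρ s' c' ∧
      c'.cheb N y₀ (s'.nat 38 0) = c.cheb N y₀ k) ?_ k (s.setN 38 0 k)
      ⟨by simp [State.nat_setN], by simpa [State.nat_setN] using hN, hy, c, h.setN (by norm_num) _ _,
        by simp [State.nat_setN]⟩
  · refine ((h.letN (a := 38) (by omega) (.v 6) (T := 20) (by decide)).seq
      (T₂ := k * (260 * (ρ + 1) + 20) + 20)
      (Q' := fun s' => Rep N ρ s' (c.cheb N y₀ k)) fun s₁ hs₁ => ?_).mono ?_ fun _ h => h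
    · have : NExpr.eval s (.v 6) = k := hk
      rw [this] at hs₁
      rw [hs₁.2]
      refine h2.mono ?_ fun _ h => h
      simp only [BExpr.cost, NExpr.cost]
      exact add_le_add (Nat.mul_le_mul_left _ (by omega)) (by omega)
    · nlinarith
  · rintro j s' ⟨i1, i2, i3, c', i4, i5⟩
    by_cases h0 : s'.nat 38 0 = 0
    · left
      refine ⟨by simp [BExpr.holds, NExpr.eval, h0], ?_⟩
      rw [h0, Cfg.cheb, if_pos rfl] at i5
      rwa [← i5]
    · right
      refine ⟨by simp [BExpr.holds, NExpr.eval]; omega, j - 1, by omega, ?_⟩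
      refine (i4.chebStep i2 rfl (by omega) i3).pers.mono le_rfl ?_
      rintro s'' ⟨⟨k', hk', r1, c'', r2, r3⟩, p⟩
      refine ⟨by omega, by rw [p.nat 1, i2], by rw [p.real 8, i3], c'', r2, ?_⟩
      rw [r1, r3, i5]

end RealRAM

/-! ### Start and end of a path. -/

namespace RealRAM

open QCircuit Matrix

variable {n N ρ : ℕ} {s : State} {c : Cfg}

namespace Program

/-- Start the path with counter `v 7`. -/
def reset : Program :=
  .seq (forDown 29 (.v 1) (block [.setN 23 (.v 29) (.const 0), .setN 24 (.v 29) (.const 0),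
    .setN 25 (.v 29) (.const 0)]))
    (block [.letN 20 (.v 7), .letR 10 (.const 1), .letR 11 (.const 0)])

/-- Add the contribution of the path to the sum. -/
def collect : Program :=
  .seq (forDown 29 (.v 0) (.ite (.and (.ltN (.const 0) (.get 23 (.v 29)))
    (.ltN (.const 0) (.add (.get 24 (.v 29)) (.get 25 (.v 29))))) (.letR 10 (.const 0)) .skip))
    (.ite (.ltN (.v 20) (.const 1)) (.letR 6 (.add (.v 6) (.v 10))) .skip)

end Program

theorem runs_reset (hN : s.nat 1 0 = N) {r : ℕ} (hr : s.nat 7 0 = r) (hρ : r ≤ ρ) :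
    Runs .reset s ((N + 1) * 70) fun s' => Rep N ρ s' ⟨r, ∅, 0, 0, 1⟩ := by
  have h1 := Runs.forDown (s := s) (e := .v 1) (a := 29) (n := N) (T := 20)
    (c := .block [.setN 23 (.v 29) (.const 0), .setN 24 (.v 29) (.const 0),
      .setN 25 (.v 29) (.const 0)])
    (fun k s' => s'.nat 7 0 = r ∧ ∀ j < N, k ≤ j → s'.nat 23 j = 0 ∧ s'.nat 24 j = 0 ∧ s'.nat 25 j = 0)
    hN rfl ⟨by simpa [State.nat_setN] using hr, fun j hj hj' => by omega⟩ ?_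
  · refine (h1.seq (T₂ := 20) fun s₁ ⟨h7, h⟩ => Runs.of_loopFree ?_).mono ?_ fun _ h => h
    · refine ⟨?_, hρ, ?_, ?_, ?_, ?_, ?_⟩
      · simp [Program.run, Program.block, State.nat_setN, NExpr.eval, h7]
      · intro j hj; simpa [Program.run, Program.block, State.nat_setN] using (h j hj (by omega)).1
      · intro j hj; simpa [Program.run, Program.block, State.nat_setN] using (h j hj (by omega)).2.1
      · intro j hj; simpa [Program.run, Program.block, State.nat_setN] using (h j hj (by omega)).2.2
      · simp [Program.run, Program.block, State.real_setR, RExpr.eval, NExpr.eval]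
      · simp [Program.run, Program.block, State.real_setR, RExpr.eval, NExpr.eval]
    · simp only [NExpr.cost]; omega
  · rintro k hk s' ⟨h7, h⟩ -
    refine Runs.of_loopFree ⟨?_, fun j hj hj' => ?_⟩
    · simpa [Program.run, Program.block, State.nat_setN] using h7
    · by_cases hjk : j = k
      · simp [Program.run, Program.block, State.nat_setN, NExpr.eval, hjk]
      · simpa [Program.run, Program.block, State.nat_setN, NExpr.eval, hjk] using h j hj (by omega)

/-- Real parts are enough, because the sum over all paths is real. -/
theorem Rep.collect (h : Rep N ρ s c) (hn : s.nat 0 0 = n) (hnN : n ≤ N) {v : ℝ}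
    (hv : s.real 6 0 = v) :
    Runs .collect s ((n + 1) * 70) fun s' => s'.real 6 0 = v + (c.final n).re := by
  have h1 := Runs.forDown (s := s) (e := .v 0) (a := 29) (n := n) (T := 25)
    (c := .ite (.and (.ltN (.const 0) (.get 23 (.v 29)))
      (.ltN (.const 0) (.add (.get 24 (.v 29)) (.get 25 (.v 29))))) (.letR 10 (.const 0)) .skip)
    (fun k s' => s'.nat 20 0 = c.r ∧ (∀ j < N, s'.nat 23 j = if j ∈ c.mark then 1 else 0) ∧
      (∀ j < N, s'.nat 24 j = c.x j) ∧ (∀ j < N, s'.nat 25 j = c.y j) ∧ s'.real 6 0 = v ∧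
      s'.real 10 0 = if ∀ j < n, k ≤ j → j ∈ c.mark → c.x j = 0 ∧ c.y j = 0 then c.amp.re else 0)
    hn rfl ?_ ?_
  · refine (h1.seq (T₂ := 20) (Q' := fun s' => s'.real 6 0 = v + (c.final n).re)
      fun s₁ ⟨i1, _, _, _, i5, i6⟩ => Runs.of_loopFree ?_).mono ?_ fun _ h => h
    · by_cases h0 : c.r = 0
      · simp [Program.run, BExpr.holds, NExpr.eval, RExpr.eval, i1, h0, State.real_setR, i5, i6,
          Cfg.final, apply_ite Complex.re]
      · simp [Program.run, BExpr.holds, NExpr.eval, i1, h0, i5, Cfg.final]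
    · simp only [NExpr.cost]; omega
  · refine ⟨?_, ?_, ?_, ?_, hv, ?_⟩
    · simpa [State.nat_setN] using h.r
    · simpa [State.nat_setN] using h.mark
    · simpa [State.nat_setN] using h.x
    · simpa [State.nat_setN] using h.y
    · rw [if_pos fun j hj hj' => absurd hj' (by omega)]
      exact h.re
  · rintro k hk s' ⟨i1, i2, i3, i4, i5, i6⟩ -
    have hkN : k < N := by omega
    have hstep : (∀ j < n, k ≤ j → j ∈ c.mark → c.x j = 0 ∧ c.y j = 0) ↔
        (∀ j < n, k + 1 ≤ j → j ∈ c.mark → c.x j = 0 ∧ c.y j = 0) ∧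
          (k ∈ c.mark → c.x k = 0 ∧ c.y k = 0) := by
      refine ⟨fun h => ⟨fun j hj hj' => h j hj (by omega), h k hk le_rfl⟩, fun h j hj hj' => ?_⟩
      rcases hj'.eq_or_lt with rfl | hlt
      · exact h.2
      · exact h.1 j hj hlt
    have hb : BExpr.holds (s'.setN 29 0 k) (.and (.ltN (.const 0) (.get 23 (.v 29)))
        (.ltN (.const 0) (.add (.get 24 (.v 29)) (.get 25 (.v 29))))) ↔
        ¬ (k ∈ c.mark → c.x k = 0 ∧ c.y k = 0) := by
      simp only [BExpr.holds, NExpr.eval, State.nat_setN]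
      simp only [Nat.reduceEqDiff, false_and, if_true, if_false,
        i2 k hkN, i3 k hkN, i4 k hkN, and_self]
      by_cases hm : k ∈ c.mark <;> simp [hm] <;> omega
    refine Runs.of_loopFree ?_
    by_cases hk0 : k ∈ c.mark → c.x k = 0 ∧ c.y k = 0
    · rw [Program.run, if_neg (by rw [hb]; exact not_not.2 hk0)]
      refine ⟨?_, ?_, ?_, ?_, i5, ?_⟩
      · simpa [Program.run, State.nat_setN] using i1
      · simpa [Program.run, State.nat_setN] using i2
      · simpa [Program.run, State.nat_setN] using i3
      · simpa [Program.run, State.nat_setN] using i4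
      · rw [if_congr (hstep.trans (and_iff_left hk0)) rfl rfl]
        exact i6
    · rw [Program.run, if_pos (by rw [hb]; exact hk0)]
      refine ⟨?_, ?_, ?_, ?_, ?_, ?_⟩
      · simpa [Program.run, State.nat_setN] using i1
      · simpa [Program.run, State.nat_setN] using i2
      · simpa [Program.run, State.nat_setN] using i3
      · simpa [Program.run, State.nat_setN] using i4
      · simpa [Program.run, State.real_setR] using i5
      · simp [Program.run, State.real_setR, RExpr.eval, NExpr.eval, hstep, hk0]

end RealRAM

/-! ### One path, and the sum over all paths. -/

namespace RealRAM

open QCircuit Matrix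

variable {n d N ρ : ℕ} {s : State} {c : Cfg}

namespace Program

/-- The two polynomial factors. -/
def start : Program := .seq reset (.seq linears cheb)

/-- One path for the probability of the output `0ⁿ`. -/
def outputPath : Program := .seq start (.seq gatesBackward collect)

/-- One path for the squared mean value. -/
def meanPath : Program := .seq start (.seq gatesForward (.seq channels (.seq gatesBackward collect)))

/-- Sum over all paths. -/
def pathSum (p : Program) : Program :=
  .seq (block [.letN 7 (.const 0), .letR 6 (.const 0)])
    (.while (.ltR (.ofNat (.v 7)) (.v 5)) (.seq p (.letN 7 (.add (.v 7) (.const 1)))))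

end Program

/-- What a path reads of the memory. -/
structure Setup (s : State) (n N m D : ℕ) (gs : List (Gate n)) : Prop where
  gates : GatesAt s gs
  nat0 : s.nat 0 0 = n
  nat1 : s.nat 1 0 = N
  nat5 : s.nat 5 0 = m
  nat6 : s.nat 6 0 = D
  real8 : s.real 8 0 = 1 + (m : ℝ) / N

/-- The two memories agree except in scratch arrays, in the counter and in the sum of the paths. -/
structure Kept (s s' : State) : Prop where
  nat (a : ℕ) (ha : a < 20 ∧ a ≠ 7 := by norm_num) : s'.nat a = s.nat a
  real (a : ℕ) (ha : a < 10 ∧ a ≠ 6 := by norm_num) : s'.real a = s.real a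

theorem Kept.trans {s s' s'' : State} (h : Kept s s') (h' : Kept s' s'') : Kept s s'' :=
  ⟨fun a ha => (h'.nat a ha).trans (h.nat a ha), fun a ha => (h'.real a ha).trans (h.real a ha)⟩

theorem Pers.kept {s s' : State} (h : Pers s s') : Kept s s' :=
  ⟨fun a ha => h.nat a ha.1, fun a ha => h.real a ha.1⟩

theorem GatesAt.kept {gs : List (Gate n)} (h : GatesAt s gs) {s' : State} (hs : Kept s s') :
    GatesAt s' gs := by
  refine ⟨by rw [hs.nat 2]; exact h.length, fun k hk => ?_⟩
  rw [hs.nat 0, hs.real 0, hs.nat 3, hs.nat 4]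
  exact h.gate k hk

theorem Setup.kept {m D : ℕ} {gs : List (Gate n)} (h : Setup s n N m D gs) {s' : State}
    (hs : Kept s s') : Setup s' n N m D gs :=
  ⟨h.gates.kept hs, by rw [hs.nat 0, h.nat0], by rw [hs.nat 1, h.nat1], by rw [hs.nat 5, h.nat5],
    by rw [hs.nat 6, h.nat6], by rw [hs.real 8, h.real8]⟩

theorem ObsAt.kept {O : Fin n → Matrix (Fin 2) (Fin 2) ℂ} (h : ObsAt s O) {s' : State}
    (hs : Kept s s') : ObsAt s' O := by
  intro k
  rw [hs.real 0, hs.nat 8]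
  exact h k

variable {m D : ℕ} {gs : List (Gate n)}

theorem Setup.start (h : Setup s n N m D gs) {r : ℕ} (hr : s.nat 7 0 = r) (hρ : r ≤ ρ) :
    Runs .start s ((N + m + D + 3) * (300 * (ρ + 1))) fun s' => Rep N ρ s'
      (((⟨r, ∅, 0, 0, 1⟩ : Cfg).linears N m).cheb N (1 + (m : ℝ) / N) D) := by
  refine ((runs_reset h.nat1 hr hρ).pers.seq
    (T₂ := (m + 1) * (300 * (ρ + 1)) + (D + 1) * (300 * (ρ + 1))) fun s₁ ⟨h₁, p₁⟩ => ?_).mono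
    (by nlinarith) fun _ h => h
  have g₁ := h.kept p₁.kept
  refine (h₁.linears g₁.nat1 g₁.nat5).pers.seq fun s₂ ⟨h₂, p₂⟩ => ?_
  have g₂ := g₁.kept p₂.kept
  exact h₂.cheb g₂.nat1 g₂.nat6 g₂.real8

theorem Setup.outputPath {V : QCircuit n d} (h : Setup s n N m D (gateList V)) (hN : n ≤ N) {r : ℕ}
    (hr : s.nat 7 0 = r) (hρ : r ≤ ρ) :
    Runs .outputPath s ((N + m + D + n + (gateList V).length + 5) * (4000 * (ρ + 1))) fun s' =>
      s'.real 6 0 = s.real 6 0 + (pathTotal N m D (pathOutput V) r).re := by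
  refine ((h.start hr hρ).pers.seq (T₂ := ((gateList V).length + 1) * (1100 * (ρ + 1)) + (n + 1) * 70)
    fun s₁ ⟨h₁, p₁⟩ => ?_).mono (by nlinarith) fun _ h => h
  have g₁ := h.kept p₁.kept
  refine (h₁.gatesBackward hN g₁.gates).pers.seq fun s₂ ⟨h₂, p₂⟩ => ?_
  have g₂ := g₁.kept p₂.kept
  exact h₂.collect g₂.nat0 hN (by rw [p₂.real 6, p₁.real 6])

theorem Setup.meanPath {U : QCircuit n d} {O : Fin n → Matrix (Fin 2) (Fin 2) ℂ}
    (h : Setup s n N m D (gateList U)) (hO : ObsAt s O) (hN : n + n ≤ N) {r : ℕ}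
    (hr : s.nat 7 0 = r) (hρ : r ≤ ρ) :
    Runs .meanPath s ((N + m + D + n + (gateList U).length + 5) * (4000 * (ρ + 1))) fun s' =>
      s'.real 6 0 = s.real 6 0 + (pathTotal N m D (pathMean U O) r).re := by
  refine ((h.start hr hρ).pers.seq (T₂ := ((gateList U).length + 1) * (1100 * (ρ + 1)) +
    ((n + 1) * (1400 * (ρ + 1)) + (((gateList U).length + 1) * (1100 * (ρ + 1)) + (n + 1) * 70)))
    fun s₁ ⟨h₁, p₁⟩ => ?_).mono (by nlinarith) fun _ h => h
  have g₁ := h.kept p₁.kept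
  refine (h₁.gatesForward (by omega) g₁.gates).pers.seq fun s₂ ⟨h₂, p₂⟩ => ?_
  have g₂ := g₁.kept p₂.kept
  refine (h₂.channels ((hO.kept p₁.kept).kept p₂.kept) g₂.nat0 hN).pers.seq fun s₃ ⟨h₃, p₃⟩ => ?_
  have g₃ := g₂.kept p₃.kept
  refine (h₃.gatesBackward (by omega) g₃.gates).pers.seq fun s₄ ⟨h₄, p₄⟩ => ?_
  have g₄ := g₃.kept p₄.kept
  exact h₄.collect g₄.nat0 (by omega) (by rw [p₄.real 6, p₃.real 6, p₂.real 6, p₁.real 6])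

/-- The number of paths is kept as a real number, since only reals can be multiplied in one step;
the counter is converted for the comparison. `Env` collects what a path reads, so that one loop
serves both algorithms. -/
theorem runs_pathSum {p : Program} {Env : State → Prop} {R T : ℕ} {F : ℕ → ℂ}
    (hwN : ∀ a < 20, p.writesN a = false) (hwR : ∀ a < 10, a ≠ 6 → p.writesR a = false)
    (hEnv : ∀ s s', Env s → Kept s s' → Env s')
    (hp : ∀ s r, Env s → s.nat 7 0 = r → r < R →
      Runs p s T fun s' => s'.real 6 0 = s.real 6 0 + (F r).re)
    (hs : Env s) (hR : s.real 5 0 = R) :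
    Runs (.pathSum p) s (R * (T + 20) + 30) fun s' =>
      s'.real 6 0 = ∑ r ∈ Finset.range R, (F r).re ∧ Kept s s' := by
  have h0 : Runs (.block [.letN 7 (.const 0), .letR 6 (.const 0)]) s 10 fun s' =>
      s'.nat 7 0 = 0 ∧ s'.real 6 0 = 0 ∧ Kept s s' := by
    refine Runs.of_loopFree ⟨?_, ?_, ?_, ?_⟩
    · simp [Program.run, Program.block, State.nat_setN, NExpr.eval]
    · simp [Program.run, Program.block, State.real_setR, RExpr.eval, NExpr.eval]
    · intro a ha
      funext j
      simp [Program.run, Program.block, State.nat_setN, ha.2]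
    · intro a ha
      funext j
      simp [Program.run, Program.block, State.real_setR, ha.2]
  refine (h0.seq (T₂ := R * (T + 20) + 20) fun s₁ ⟨i1, i2, i3⟩ => ?_).mono (by omega) fun _ h => h
  have h2 := Runs.while (b := .ltR (.ofNat (.v 7)) (.v 5))
    (c := .seq p (.letN 7 (.add (.v 7) (.const 1)))) (T := T + 10)
    (Q := fun s' => s'.real 6 0 = ∑ r ∈ Finset.range R, (F r).re ∧ Kept s s')
    (fun k s' => k + s'.nat 7 0 = R ∧ Kept s s' ∧
      s'.real 6 0 = ∑ r ∈ Finset.range (s'.nat 7 0), (F r).re) ?_ R s₁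
      ⟨by omega, i3, by simp [i1, i2]⟩
  · exact h2.mono (by
      simp only [BExpr.cost, RExpr.cost, NExpr.cost]
      exact add_le_add (Nat.mul_le_mul_left _ (by omega)) (by omega)) fun _ h => h
  · rintro k s' ⟨j1, j2, j3⟩
    have hR' : s'.real 5 0 = R := by rw [j2.real 5, hR]
    rcases k with _ | k
    · left
      rw [zero_add] at j1
      exact ⟨by simp [BExpr.holds, NExpr.eval, RExpr.eval, hR', j1], by rw [j3, j1], j2⟩
    · right
      refine ⟨?_, k, rfl, ?_⟩
      · simp only [BExpr.holds, NExpr.eval, RExpr.eval, hR']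
        exact_mod_cast (by omega)
      · refine (hp s' _ (hEnv s s' hs j2) rfl (by omega)).frame.seq fun s₂ ⟨k1, k2⟩ =>
          Runs.of_loopFree ?_
        have hK : Kept s' s₂ :=
          ⟨fun a ha => k2.nat a (hwN a ha.1), fun a ha => k2.real a (hwR a ha.1 ha.2)⟩
        have h7 : s₂.nat 7 0 = s'.nat 7 0 := by rw [k2.nat 7 (hwN 7 (by norm_num))]
        have h7' : (Program.run (.letN 7 (.add (.v 7) (.const 1))) s₂).nat 7 0 = s'.nat 7 0 + 1 := by
          simp [Program.run, State.nat_setN, NExpr.eval, h7]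
        refine ⟨by rw [h7']; omega, (j2.trans hK).trans ⟨fun a ha => ?_, fun a ha => rfl⟩, ?_⟩
        · funext j
          simp [Program.run, State.nat_setN, ha.2]
        · rw [h7', Finset.sum_range_succ, ← j3, ← k1]
          rfl

end RealRAM

/-! ### Reading the input -/

namespace RealRAM

open QCircuit Matrix

variable {n d N ρ : ℕ} {s : State}

/-- The list `l` is stored from position `p` on. -/
def Reads {α : Type*} (f : ℕ → α) (p : ℕ) (l : List α) : Prop :=
  ∀ i (h : i < l.length), f (p + i) = l[i]

theorem reads_cons {α : Type*} {f : ℕ → α} {p : ℕ} {a : α} {l : List α} :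
    Reads f p (a :: l) ↔ f p = a ∧ Reads f (p + 1) l := by
  constructor
  · intro h
    refine ⟨h 0 (by simp), fun i hi => ?_⟩
    have := h (i + 1) (by simpa using hi)
    rw [add_assoc, add_comm 1 i, this]
    rfl
  · rintro ⟨h1, h2⟩ i hi
    rcases i with _ | i
    · exact h1
    · have := h2 i (by simpa using hi)
      rw [show p + (i + 1) = p + 1 + i by omega, this]
      rfl

theorem reads_append {α : Type*} {f : ℕ → α} {p : ℕ} {l l' : List α} :
    Reads f p (l ++ l') ↔ Reads f p l ∧ Reads f (p + l.length) l' := by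
  induction l generalizing p with
  | nil => simp [Reads]
  | cons a l ih =>
    rw [List.cons_append, reads_cons, ih, reads_cons, List.length_cons, and_assoc, add_assoc,
      add_comm 1]

theorem Reads.matOne {f : ℕ → ℝ} {b : ℕ} {M : Matrix (Fin 2) (Fin 2) ℂ}
    (h : Reads f b (entriesOne M)) : MatOne f b M := by
  simp only [entriesOne, entries, List.flatMap_cons, List.flatMap_nil, List.append_nil,
    List.cons_append, List.nil_append, reads_cons, add_assoc, Nat.reduceAdd] at h
  intro p q
  fin_cases p <;> fin_cases q <;> simp [add_assoc, h]

theorem Reads.matTwo {f : ℕ → ℝ} {b : ℕ} {M : Matrix (Fin 2 × Fin 2) (Fin 2 × Fin 2) ℂ}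
    (h : Reads f b (entriesTwo M)) : MatTwo f b M := by
  simp only [entriesTwo, entries, List.flatMap_cons, List.flatMap_nil, List.append_nil,
    List.cons_append, List.nil_append, reads_cons, add_assoc, Nat.reduceAdd] at h
  rintro ⟨p, p'⟩ ⟨q, q'⟩
  fin_cases p <;> fin_cases p' <;> fin_cases q <;> fin_cases q' <;> simp [add_assoc, h]

theorem Reads.gateAt {f : ℕ → ℕ} {w : ℕ → ℝ} {p b : ℕ} {g : Gate n} (h : Reads f p g.natCode)
    (h' : Reads w b g.realCode) : GateAt f w p b g := by
  cases g with
  | one i M =>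
    simp only [Gate.natCode, reads_cons] at h
    exact ⟨h.1, h.2.1, h'.matOne⟩
  | two i j hij M =>
    simp only [Gate.natCode, reads_cons, add_assoc] at h
    exact ⟨h.1, h.2.1, h.2.2.1, h'.matTwo⟩

theorem Reads.obs {f : ℕ → ℝ} {b : ℕ} {l : List (Matrix (Fin 2) (Fin 2) ℂ)}
    (h : Reads f b (l.flatMap entriesOne)) (k : ℕ) (hk : k < l.length) :
    MatOne f (b + 8 * k) l[k] := by
  induction l generalizing b k with
  | nil => simp at hk
  | cons M l ih =>
    rw [List.flatMap_cons, reads_append] at h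
    rcases k with _ | k
    · exact h.1.matOne
    · have := ih h.2 k (by simpa using hk)
      rw [mul_add, mul_one, add_comm (8 * k), ← add_assoc]
      exact this

namespace Program

def parseGate : Program :=
  block [.setN 3 (.v 2) (.v 9), .setN 4 (.v 2) (.v 11), .letN 2 (.add (.v 2) (.const 1)),
    .ite (.ltN (.get 0 (.v 9)) (.const 2))
      (block [.letN 9 (.add (.v 9) (.const 2)), .letN 11 (.add (.v 11) (.const 8))])
      (block [.letN 9 (.add (.v 9) (.const 3)), .letN 11 (.add (.v 11) (.const 32))])]

def parseLayer : Program :=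
  .seq (.letN 9 (.add (.v 9) (.const 1))) (forDown 12 (.get 0 (.sub (.v 9) (.const 1))) parseGate)

/-- Locate all gates and the observables in the input. -/
def parse : Program :=
  .seq (block [.letN 9 (.const 2), .letN 11 (.const 1), .letN 2 (.const 0)])
    (.seq (forDown 10 (.get 0 (.const 1)) parseLayer) (.letN 8 (.v 11)))

end Program

/-- The gates `gs` have been located, and `x`, `y` remain to be read. -/
structure Parsed (f : ℕ → ℕ) (w : ℕ → ℕ → ℝ) (s : State) (gs : List (Gate n)) (x : List ℕ)
    (y : List ℝ) : Prop where
  nat : s.nat 0 = f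
  real : s.real = w
  gates : GatesAt s gs
  x : Reads f (s.nat 9 0) x
  y : Reads (w 0) (s.nat 11 0) y

variable {f : ℕ → ℕ} {w : ℕ → ℕ → ℝ} {gs : List (Gate n)} {x : List ℕ} {y : List ℝ}

theorem Parsed.congr (h : Parsed f w s gs x y) {s' : State}
    (hn : ∀ a ∈ [0, 2, 3, 4, 9, 11], s'.nat a = s.nat a) (hr : s'.real = s.real) :
    Parsed f w s' gs x y := by
  refine ⟨?_, ?_, ⟨?_, ?_⟩, ?_, ?_⟩
  · rw [hn 0 (by simp), h.nat]
  · rw [hr, h.real]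
  · rw [hn 2 (by simp), h.gates.length]
  · rw [hn 0 (by simp), hn 3 (by simp), hn 4 (by simp), hr]; exact h.gates.gate
  · rw [hn 9 (by simp)]; exact h.x
  · rw [hn 11 (by simp)]; exact h.y

theorem Parsed.setN (h : Parsed f w s gs x y) {a : ℕ} (ha : a ∉ [0, 2, 3, 4, 9, 11]) (i v : ℕ) :
    Parsed f w (s.setN a i v) gs x y := by
  refine h.congr (fun b hb => ?_) rfl
  have : b ≠ a := by rintro rfl; exact ha hb
  funext j
  simp [State.nat_setN, this]

theorem Parsed.gate {g : Gate n} (h : Parsed f w s gs (g.natCode ++ x) (g.realCode ++ y)) :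
    Runs .parseGate s 80 fun s' => Parsed f w s' (gs ++ [g]) x y := by
  obtain ⟨h1, h2, ⟨h3, h4⟩, h5, h6⟩ := h
  rw [reads_append] at h5 h6
  have hg := h5.1.gateAt h6.1
  -- The kind of the gate fixes how far both reading positions advance: a matrix of size two has `8`
  -- real entries, one of size four has `32`.
  have hc : (f (s.nat 9 0) < 2 ∧ g.natCode.length = 2 ∧ g.realCode.length = 8) ∨
      (¬ f (s.nat 9 0) < 2 ∧ g.natCode.length = 3 ∧ g.realCode.length = 32) := by
    cases g with
    | one i M => exact .inl ⟨by rw [hg.1]; norm_num, rfl, rfl⟩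
    | two i j hij M => exact .inr ⟨by rw [hg.1]; norm_num, rfl, rfl⟩
  refine Runs.of_loopFree ?_
  set s' := Program.run .parseGate s with hs'
  have e0 : s'.nat 0 = f := by
    rw [← h1]
    funext j
    rcases hc with ⟨hc, -, -⟩ | ⟨hc, -, -⟩ <;>
    simp [hs', Program.parseGate, Program.block, Program.run, NExpr.eval, BExpr.holds,
      State.nat_setN, h1, hc]
  have er : s'.real = w := by
    rw [← h2]
    rcases hc with ⟨hc, -, -⟩ | ⟨hc, -, -⟩ <;>
    simp [hs', Program.parseGate, Program.block, Program.run, NExpr.eval, BExpr.holds,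
      State.nat_setN, h1, hc]
  have e3 : ∀ j, s'.nat 3 j = if j = gs.length then s.nat 9 0 else s.nat 3 j := by
    intro j
    rcases hc with ⟨hc, -, -⟩ | ⟨hc, -, -⟩ <;>
    simp [hs', Program.parseGate, Program.block, Program.run, NExpr.eval, BExpr.holds,
      State.nat_setN, h1, hc, h3]
  have e4 : ∀ j, s'.nat 4 j = if j = gs.length then s.nat 11 0 else s.nat 4 j := by
    intro j
    rcases hc with ⟨hc, -, -⟩ | ⟨hc, -, -⟩ <;>
    simp [hs', Program.parseGate, Program.block, Program.run, NExpr.eval, BExpr.holds,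
      State.nat_setN, h1, hc, h3]
  have e2 : s'.nat 2 0 = gs.length + 1 := by
    rcases hc with ⟨hc, -, -⟩ | ⟨hc, -, -⟩ <;>
    simp [hs', Program.parseGate, Program.block, Program.run, NExpr.eval, BExpr.holds,
      State.nat_setN, h1, hc, h3]
  have e9 : s'.nat 9 0 = s.nat 9 0 + g.natCode.length := by
    rcases hc with ⟨hc, hc', -⟩ | ⟨hc, hc', -⟩ <;>
    simp [hs', Program.parseGate, Program.block, Program.run, NExpr.eval, BExpr.holds,
      State.nat_setN, h1, hc, hc']
  have e11 : s'.nat 11 0 = s.nat 11 0 + g.realCode.length := by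
    rcases hc with ⟨hc, -, hc'⟩ | ⟨hc, -, hc'⟩ <;>
    simp [hs', Program.parseGate, Program.block, Program.run, NExpr.eval, BExpr.holds,
      State.nat_setN, h1, hc, hc']
  refine ⟨e0, er, ⟨by simp [e2], fun k hk => ?_⟩, by rw [e9]; exact h5.2, by rw [e11]; exact h6.2⟩
  rw [e0, er, e3, e4]
  by_cases hkl : k = gs.length
  · subst hkl
    simpa using hg
  · have hk' : k < gs.length := by simp at hk; omega
    rw [if_neg hkl, if_neg hkl, List.getElem_append_left hk', ← h1, ← h2]
    exact h4 k hk'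

theorem Parsed.layer {hs : List (Gate n)} (hl : hs.length ≤ n)
    (h : Parsed f w s gs (hs.length :: hs.flatMap Gate.natCode ++ x)
      (hs.flatMap Gate.realCode ++ y)) :
    Runs .parseLayer s ((n + 1) * 100) fun s' => Parsed f w s' (gs ++ hs) x y := by
  obtain ⟨h1, h2, h3, h5, h6⟩ := h
  rw [List.cons_append, reads_cons] at h5
  have h0 : Runs (.letN 9 (.add (.v 9) (.const 1))) s 10 fun s' =>
      Parsed f w s' gs (hs.flatMap Gate.natCode ++ x) (hs.flatMap Gate.realCode ++ y) ∧
        s'.nat 0 (s'.nat 9 0 - 1) = hs.length := by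
    refine Runs.of_loopFree ⟨⟨?_, ?_, ⟨?_, ?_⟩, ?_, ?_⟩, ?_⟩
    · rw [← h1]; funext j; simp [Program.run, State.nat_setN]
    · exact h2
    · simpa [Program.run, State.nat_setN] using h3.length
    · have h0 : (s.setN 9 0 (s.nat 9 0 + 1)).nat 0 = s.nat 0 := by funext j; simp [State.nat_setN]
      simpa [Program.run, State.nat_setN, NExpr.eval, h0] using h3.gate
    · simpa [Program.run, State.nat_setN, NExpr.eval] using h5.2
    · simpa [Program.run, State.nat_setN] using h6
    · simpa [Program.run, State.nat_setN, NExpr.eval, h1] using h5.1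
  refine (h0.seq (T₂ := hs.length * 100 + 30) fun s₁ ⟨i1, i2⟩ => ?_).mono (by omega) fun _ h => h
  have := Runs.forDown (a := 12) (e := .get 0 (.sub (.v 9) (.const 1))) (c := .parseGate) (s := s₁)
    (n := hs.length) (T := 80)
    (fun k s' => Parsed f w s' (gs ++ hs.take (hs.length - k))
      ((hs.drop (hs.length - k)).flatMap Gate.natCode ++ x)
      ((hs.drop (hs.length - k)).flatMap Gate.realCode ++ y)) (by simpa [NExpr.eval] using i2) rfl
    (by simpa using i1.setN (a := 12) (by simp) 0 hs.length) ?_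
  · refine this.mono (by simp only [NExpr.cost]; omega) fun s' h' => by simpa using h'
  · intro k hk s' h' _
    have hlt : hs.length - (k + 1) < hs.length := by omega
    have hk1 : hs.length - k = hs.length - (k + 1) + 1 := by omega
    rw [List.drop_eq_getElem_cons hlt, ← hk1, List.flatMap_cons, List.flatMap_cons,
      List.append_assoc, List.append_assoc] at h'
    have h'' := (h'.setN (a := 12) (by simp) 0 k).gate
    have e : hs.take (hs.length - k) = hs.take (hs.length - (k + 1)) ++ [hs[hs.length - (k + 1)]] := by
      rw [hk1, List.take_succ_eq_append_getElem hlt]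
    rw [e, ← List.append_assoc]
    exact h''

/-- Every gate has a qubit, and gates of a layer share none. This bounds the time for reading a
layer, whatever its list of gates. -/
theorem Gate.length_le_card (hs : List (Gate n))
    (h : hs.Pairwise fun g h => Disjoint g.qubits h.qubits) : hs.length ≤ n := by
  suffices H : hs.length ≤ (hs.foldr (fun (g : Gate n) A => g.qubits ∪ A) ∅).card by
    refine H.trans ((Finset.card_le_univ _).trans ?_)
    simp
  induction hs with
  | nil => simp
  | cons g hs ih =>
    rw [List.pairwise_cons] at h
    have hd : Disjoint g.qubits (hs.foldr (fun (g : Gate n) A => g.qubits ∪ A) ∅) := by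
      have h1 := h.1
      clear ih h
      induction hs with
      | nil => simp
      | cons k hs ih =>
        rw [List.foldr_cons, Finset.disjoint_union_right]
        exact ⟨h1 k (by simp), ih fun a ha => h1 a (by simp [ha])⟩
    have hg : 0 < g.qubits.card := by
      cases g <;> simp [Gate.qubits]
    rw [List.foldr_cons, Finset.card_union_of_disjoint hd, List.length_cons]
    have := ih h.2
    omega

theorem length_gateList_le (U : QCircuit n d) : (gateList U).length ≤ d * n := by
  rw [gateList, List.length_flatMap]
  refine (List.sum_le_card_nsmul _ n ?_).trans (by simp)
  simp only [List.mem_map]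
  rintro _ ⟨l, -, rfl⟩
  exact Gate.length_le_card _ l.disjoint

theorem runs_parse {U : QCircuit n d} {y : List ℝ} {δ : ℝ} (hx : Reads (s.nat 0) 0 U.natCode)
    (hy : Reads (s.real 0) 0 (δ :: (U.realCode ++ y))) :
    Runs .parse s ((d + 1) * ((n + 1) * 200)) fun s' => GatesAt s' (gateList U) ∧
      Reads (s.real 0) (s'.nat 8 0) y ∧ s'.nat 0 = s.nat 0 ∧ s'.real = s.real := by
  obtain ⟨f, hf⟩ : ∃ f, s.nat 0 = f := ⟨_, rfl⟩
  obtain ⟨w, hw⟩ : ∃ w, s.real = w := ⟨_, rfl⟩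
  rw [hf, natCode, reads_append] at hx
  rw [hw, reads_cons] at hy
  simp only [reads_cons, zero_add, List.length_cons, List.length_nil, Nat.reduceAdd] at hx hy
  set ls := List.ofFn U with hls
  have hl : ls.length = d := by simp [hls]
  -- Reading starts behind `n` and `d` in the one input and behind `δ` in the other.
  have h0 : Runs (.block [.letN 9 (.const 2), .letN 11 (.const 1), .letN 2 (.const 0)]) s 10 fun s' =>
      Parsed f w s' ([] : List (Gate n))
        (ls.flatMap fun l => l.gates.length :: l.gates.flatMap Gate.natCode) (U.realCode ++ y) := by
    refine Runs.of_loopFree ⟨?_, hw, ⟨?_, ?_⟩, ?_, ?_⟩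
    · rw [← hf]; funext j; simp [Program.run, Program.block, State.nat_setN]
    · simp [Program.run, Program.block, State.nat_setN, NExpr.eval]
    · simp
    · simpa [Program.run, Program.block, State.nat_setN, NExpr.eval] using hx.2
    · simpa [Program.run, Program.block, State.nat_setN, NExpr.eval] using hy.2
  refine (h0.seq (T₂ := (d * ((n + 1) * 100 + 20) + 30) + 10) fun s₁ i1 => ?_).mono (by nlinarith)
    fun _ h => h
  have := Runs.forDown (a := 10) (e := .get 0 (.const 1)) (c := .parseLayer) (s := s₁)
    (n := d) (T := (n + 1) * 100)
    (fun k s' => Parsed f w s' ((ls.take (d - k)).flatMap Layer.gates)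
      ((ls.drop (d - k)).flatMap fun l => l.gates.length :: l.gates.flatMap Gate.natCode)
      (((ls.drop (d - k)).flatMap fun l => l.gates.flatMap Gate.realCode) ++ y))
    (by simpa [NExpr.eval, i1.nat] using hx.1.2.1) rfl
    (by simpa [hls, realCode] using i1.setN (a := 10) (by simp) 0 d) ?_
  · refine (this.mono (by simp only [NExpr.cost]; omega) fun _ h => h).seq fun s₂ h₂ =>
      Runs.of_loopFree ?_
    have h2 : ls.take d = ls := by rw [← hl, List.take_length]
    simp only [Nat.sub_zero, h2] at h₂
    have h3 : ls.drop d = [] := by rw [← hl, List.drop_length]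
    simp only [h3, List.flatMap_nil, List.nil_append] at h₂
    have h4 := h₂.setN (a := 8) (by simp) 0 (s₂.nat 11 0)
    refine ⟨h4.gates, ?_, by rw [hf]; exact h4.nat, by rw [hw]; exact h4.real⟩
    rw [hw]
    simpa [Program.run, State.nat_setN, NExpr.eval] using h₂.y
  · intro k hk s' h' _
    have hlt : d - (k + 1) < ls.length := by omega
    have hk1 : d - k = d - (k + 1) + 1 := by omega
    rw [List.drop_eq_getElem_cons hlt, ← hk1, List.flatMap_cons, List.flatMap_cons,
      List.append_assoc] at h'
    have h'' := (h'.setN (a := 10) (by simp) 0 k).layer (Gate.length_le_card _ (Layer.disjoint _))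
    have e : ls.take (d - k) = ls.take (d - (k + 1)) ++ [ls[d - (k + 1)]] := by
      rw [hk1, List.take_succ_eq_append_getElem hlt]
    rw [e, List.flatMap_append]
    simpa using h''

end RealRAM

/-! ### The parameters of the path sum -/

namespace RealRAM

open QCircuit Matrix

variable {n d N ρ : ℕ} {s : State}

namespace Program

/-- Multiply the number of paths by the contribution of one factor. -/
def grow : Program :=
  .letR 5 (.mul (.v 5) (.mul (.add (.ofNat (.v 1)) (.const 2)) (.const 16777216)))

/-- Number of bits and precision of the path sum. -/
def initParams (mean : Bool) : Program :=
  block [.letN 1 (bif mean then .add (.v 0) (.v 0) else .v 0),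
    .letR 1 (bif mean then .div (.mul (.v 0) (.v 0)) (.const 4) else .v 0),
    .letN 5 (.const 0), .letN 6 (.const 0), .letR 7 (.const 1), .letR 2 (.const 1),
    .letR 5 (.const 1)]

/-- Determine the number of linear factors. -/
def linearParams : Program :=
  .while (.and (.ltN (.v 5) (.v 1)) (.ltR (.mul (.v 1) (.v 7)) (.const 1)))
    (block [.letN 5 (.add (.v 5) (.const 1)), .letR 7 (.mul (.v 7) (.const 2)),
      .letR 2 (.mul (.v 2) (.sub (.div (.ofNat (.v 1)) (.ofNat (.v 5))) (.const 1))), grow])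

/-- Determine the degree of the Chebyshev polynomial. -/
def chebParams : Program :=
  .seq (block [.letR 8 (.add (.const 1) (.div (.ofNat (.v 5)) (.ofNat (.v 1)))), .letR 3 (.const 1),
    .letR 4 (.v 8)])
    (.while (.ltR (.mul (.v 3) (.v 1)) (.v 2))
      (block [.letR 9 (.sub (.mul (.mul (.const 2) (.v 8)) (.v 4)) (.v 3)), .letR 3 (.v 4),
        .letR 4 (.v 9), .letN 6 (.add (.v 6) (.const 1)), grow]))

/-- Raise the number of paths to the power given by the light cones. -/
def conePower (mean : Bool) : Program :=
  forDown 12 (.get 0 (.const 1)) (bif mean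
    then block [.letR 5 (.mul (.v 5) (.v 5)), .letR 5 (.mul (.v 5) (.v 5))]
    else .letR 5 (.mul (.v 5) (.v 5)))

def params (mean : Bool) : Program :=
  .seq (initParams mean) (.seq linearParams (.seq chebParams (conePower mean)))

end Program

/-- `m` is the least number with `ε * 2 ^ m ≥ 1`, or `N` if that is smaller. -/
structure IsLinearDegree (N : ℕ) (ε : ℝ) (m : ℕ) : Prop where
  le : m ≤ N
  large : m = N ∨ 1 ≤ ε * 2 ^ m
  lt : ∀ k < m, ε * 2 ^ k < 1

/-- `D` is the least degree for which the Chebyshev polynomial is large enough. -/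
structure IsChebDegree (N : ℕ) (ε : ℝ) (m D : ℕ) : Prop where
  large : rootBound N m ≤ chebyshevT D (1 + (m : ℝ) / N) * ε
  lt : ∀ k < D, chebyshevT k (1 + (m : ℝ) / N) * ε < rootBound N m

/-- What the choice of the parameters keeps. -/
structure KeptInput (s s' : State) : Prop where
  nat (a : ℕ) (ha : a ∈ [0, 2, 3, 4, 8] := by simp) : s'.nat a = s.nat a
  real : s'.real 0 = s.real 0

theorem Frame.keptInput {c : Program} {s s' : State} (h : Frame c s s')
    (hn : ∀ a ∈ [0, 2, 3, 4, 8], c.writesN a = false) (hr : c.writesR 0 = false) : KeptInput s s' :=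
  ⟨fun a ha => h.nat a (hn a ha), h.real 0 hr⟩

theorem runs_initParams {mean : Bool} (hn : s.nat 0 0 = n) {δ : ℝ} (hδ : s.real 0 0 = δ) :
    Runs (.initParams mean) s 60 fun s' => s'.nat 1 0 = (bif mean then n + n else n) ∧
      s'.real 1 0 = (bif mean then δ * δ / 4 else δ) ∧ s'.nat 5 0 = 0 ∧ s'.nat 6 0 = 0 ∧
      s'.real 7 0 = 1 ∧ s'.real 2 0 = 1 ∧ s'.real 5 0 = 1 := by
  cases mean <;> refine Runs.of_loopFree ?_ <;>
  simp [Program.initParams, Program.run, Program.block, State.nat_setN, State.real_setR, NExpr.eval,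
    RExpr.eval, hn, hδ]

/-- Number of paths per power of the light cones. -/
def pathBase (N : ℕ) : ℕ := (N + 2) * 16777216

theorem runs_linearParams {ε : ℝ} {m : ℕ} (hm : IsLinearDegree N ε m) (h1 : s.nat 1 0 = N)
    (h1' : s.real 1 0 = ε) (h5 : s.nat 5 0 = 0) (h6 : s.nat 6 0 = 0) (h7 : s.real 7 0 = 1)
    (h2 : s.real 2 0 = 1) (h5' : s.real 5 0 = 1) :
    Runs .linearParams s (m * 100 + 20) fun s' => s'.nat 1 0 = N ∧ s'.real 1 0 = ε ∧ s'.nat 5 0 = m ∧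
      s'.nat 6 0 = 0 ∧ s'.real 2 0 = rootBound N m ∧ s'.real 5 0 = (pathBase N : ℝ) ^ m := by
  have := Runs.while (b := .and (.ltN (.v 5) (.v 1)) (.ltR (.mul (.v 1) (.v 7)) (.const 1)))
    (c := .block [.letN 5 (.add (.v 5) (.const 1)), .letR 7 (.mul (.v 7) (.const 2)),
      .letR 2 (.mul (.v 2) (.sub (.div (.ofNat (.v 1)) (.ofNat (.v 5))) (.const 1))), .grow])
    (T := 60)
    (Q := fun s' => s'.nat 1 0 = N ∧ s'.real 1 0 = ε ∧ s'.nat 5 0 = m ∧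
      s'.nat 6 0 = 0 ∧ s'.real 2 0 = rootBound N m ∧ s'.real 5 0 = (pathBase N : ℝ) ^ m)
    (fun k s' => ∃ j, j + k = m ∧ s'.nat 1 0 = N ∧ s'.real 1 0 = ε ∧ s'.nat 5 0 = j ∧
      s'.nat 6 0 = 0 ∧ s'.real 2 0 = rootBound N j ∧ s'.real 5 0 = (pathBase N : ℝ) ^ j ∧
      s'.real 7 0 = 2 ^ j) ?_ m s
    ⟨0, by omega, h1, h1', h5, h6, by simpa [rootBound] using h2, by simpa using h5', by simpa using h7⟩
  · exact this.mono (by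
      simp only [BExpr.cost, RExpr.cost, NExpr.cost]
      exact add_le_add (Nat.mul_le_mul_left _ (by omega)) (by omega)) fun _ h => h
  · rintro k s' ⟨j, hj, i1, i2, i3, i4, i5, i6, i7⟩
    rcases k with _ | k
    · obtain rfl : j = m := by omega
      refine .inl ⟨?_, i1, i2, i3, i4, i5, i6⟩
      simp only [BExpr.holds, NExpr.eval, RExpr.eval, i1, i2, i3, i7]
      rintro ⟨h1, h2⟩
      rcases hm.large with h | h
      · omega
      · norm_num at h2; linarith
    · refine .inr ⟨?_, k, rfl, Runs.of_loopFree ⟨j + 1, by omega, ?_⟩⟩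
      · simp only [BExpr.holds, NExpr.eval, RExpr.eval, i1, i2, i3, i7]
        have := hm.le
        exact ⟨by omega, by simpa using hm.lt j (by omega)⟩
      · simp [Program.run, Program.block, Program.grow, State.nat_setN, State.real_setR, NExpr.eval,
          RExpr.eval, i1, i2, i3, i4, i5, i6, i7, rootBound, Finset.prod_range_succ, pow_succ, pathBase]

theorem runs_chebParams {ε : ℝ} {m D : ℕ} (hD : IsChebDegree N ε m D) (h1 : s.nat 1 0 = N)
    (h1' : s.real 1 0 = ε) (h5 : s.nat 5 0 = m) (h6 : s.nat 6 0 = 0)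
    (h2 : s.real 2 0 = rootBound N m) (h5' : s.real 5 0 = (pathBase N : ℝ) ^ m) :
    Runs .chebParams s (D * 100 + 60) fun s' => s'.nat 1 0 = N ∧ s'.nat 5 0 = m ∧ s'.nat 6 0 = D ∧
      s'.real 8 0 = 1 + (m : ℝ) / N ∧ s'.real 3 0 = chebyshevT D (1 + (m : ℝ) / N) ∧
      s'.real 5 0 = (pathBase N : ℝ) ^ (m + D) := by
  obtain ⟨y, hy⟩ : ∃ y : ℝ, 1 + (m : ℝ) / N = y := ⟨_, rfl⟩
  have hD1 := hD.large
  have hD2 := hD.lt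
  rw [hy] at hD1 hD2 ⊢
  have h0 : Runs (.block [.letR 8 (.add (.const 1) (.div (.ofNat (.v 5)) (.ofNat (.v 1)))),
      .letR 3 (.const 1), .letR 4 (.v 8)]) s 20 fun s' => s'.nat 1 0 = N ∧ s'.real 1 0 = ε ∧
        s'.nat 5 0 = m ∧ s'.nat 6 0 = 0 ∧ s'.real 2 0 = rootBound N m ∧
        s'.real 5 0 = (pathBase N : ℝ) ^ m ∧ s'.real 8 0 = y ∧ s'.real 3 0 = 1 ∧ s'.real 4 0 = y := by
    refine Runs.of_loopFree ?_
    simp [Program.run, Program.block, State.real_setR, NExpr.eval, RExpr.eval, h1, h1', h5, h6, h2,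
      h5', hy]
  refine (h0.seq (T₂ := D * 100 + 20) fun s₁ ⟨a1, a2, a3, a4, a5, a6, a7, a8, a9⟩ => ?_).mono
    (by omega) fun _ h => h
  have := Runs.while (b := .ltR (.mul (.v 3) (.v 1)) (.v 2))
    (c := .block [.letR 9 (.sub (.mul (.mul (.const 2) (.v 8)) (.v 4)) (.v 3)), .letR 3 (.v 4),
        .letR 4 (.v 9), .letN 6 (.add (.v 6) (.const 1)), .grow]) (T := 60)
    (Q := fun s' => s'.nat 1 0 = N ∧ s'.nat 5 0 = m ∧ s'.nat 6 0 = D ∧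
      s'.real 8 0 = y ∧ s'.real 3 0 = chebyshevT D y ∧ s'.real 5 0 = (pathBase N : ℝ) ^ (m + D))
    (fun k s' => ∃ j, j + k = D ∧ s'.nat 1 0 = N ∧ s'.real 1 0 = ε ∧ s'.nat 5 0 = m ∧
      s'.nat 6 0 = j ∧ s'.real 2 0 = rootBound N m ∧ s'.real 5 0 = (pathBase N : ℝ) ^ (m + j) ∧
      s'.real 8 0 = y ∧ s'.real 3 0 = chebyshevT j y ∧ s'.real 4 0 = chebyshevT (j + 1) y) ?_ D s₁
    ⟨0, by omega, a1, a2, a3, a4, a5, by simpa using a6, a7, by simpa [chebyshevT] using a8,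
      by simpa [chebyshevT] using a9⟩
  · exact this.mono (by
      simp only [BExpr.cost, RExpr.cost, NExpr.cost]
      exact add_le_add (Nat.mul_le_mul_left _ (by omega)) (by omega)) fun _ h => h
  · rintro k s' ⟨j, hj, i1, i2, i3, i4, i5, i6, i7, i8, i9⟩
    rcases k with _ | k
    · obtain rfl : j = D := by omega
      refine .inl ⟨?_, i1, i3, i4, i7, i8, i6⟩
      simp only [BExpr.holds, NExpr.eval, RExpr.eval, i2, i5, i8, not_lt]
      exact hD1
    · refine .inr ⟨?_, k, rfl, Runs.of_loopFree ⟨j + 1, by omega, ?_⟩⟩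
      · simp only [BExpr.holds, NExpr.eval, RExpr.eval, i2, i5, i8]
        exact hD2 j (by omega)
      · simp [Program.run, Program.block, Program.grow, State.nat_setN, State.real_setR, NExpr.eval,
          RExpr.eval, i1, i2, i3, i4, i5, i6, i7, i8, i9, pathBase, chebyshevT, ← add_assoc, pow_succ]

/-- One squaring per layer gives the exponent `2 ^ d`, two give `4 ^ d`. -/
theorem runs_conePower {mean : Bool} {R : ℝ} (hd : s.nat 0 1 = d) (hR : s.real 5 0 = R) :
    Runs (.conePower mean) s (d * 60 + 30) fun s' =>
      s'.real 5 0 = R ^ ((bif mean then 4 else 2) ^ d) := by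
  have := Runs.forDown (s := s) (a := 12) (e := .get 0 (.const 1)) (n := d) (T := 30) (c := bif mean
    then .block [.letR 5 (.mul (.v 5) (.v 5)), .letR 5 (.mul (.v 5) (.v 5))]
    else .letR 5 (.mul (.v 5) (.v 5)))
    (fun k s' => s'.real 5 0 = R ^ ((bif mean then 4 else 2) ^ (d - k))) hd (by cases mean <;> rfl)
    (by simpa using hR) ?_
  · exact this.mono (by simp only [NExpr.cost]; omega) fun _ h => by simpa using h
  · intro k hk s' h' _
    have e : d - k = d - (k + 1) + 1 := by omega
    generalize d - (k + 1) = j at h' e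
    subst R
    cases mean
    · refine Runs.of_loopFree ?_
      simp only [cond_false] at h'
      simp only [Program.run, State.real_setR, State.real_setN, RExpr.eval, NExpr.eval, h', e, cond_false]
      simp only [and_self, if_true]
      ring
    · refine Runs.of_loopFree ?_
      simp only [cond_true] at h'
      simp only [Program.run, Program.block, State.real_setR, State.real_setN, RExpr.eval, NExpr.eval,
        h', e, cond_true]
      simp only [and_self, if_true]
      ring

theorem runs_params {mean : Bool} (hn : s.nat 0 0 = n) (hd : s.nat 0 1 = d) {δ ε : ℝ}
    (hδ : s.real 0 0 = δ) (hN : N = bif mean then n + n else n)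
    (hε : ε = bif mean then δ * δ / 4 else δ) {m D : ℕ} (hm : IsLinearDegree N ε m)
    (hD : IsChebDegree N ε m D) {gs : List (Gate n)} (hgs : GatesAt s gs) :
    Runs (.params mean) s ((m + D + d + 2) * 100) fun s' => Setup s' n N m D gs ∧
      s'.real 3 0 = chebyshevT D (1 + (m : ℝ) / N) ∧
      s'.real 5 0 = ((pathBase N : ℝ) ^ (m + D)) ^ ((bif mean then 4 else 2) ^ d) ∧
      KeptInput s s' := by
  suffices h : Runs (.params mean) s ((m + D + d + 2) * 100) fun s' => s'.nat 1 0 = N ∧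
      s'.nat 5 0 = m ∧ s'.nat 6 0 = D ∧ s'.real 8 0 = 1 + (m : ℝ) / N ∧
      s'.real 3 0 = chebyshevT D (1 + (m : ℝ) / N) ∧
      s'.real 5 0 = ((pathBase N : ℝ) ^ (m + D)) ^ ((bif mean then 4 else 2) ^ d) by
    refine h.frame.mono le_rfl fun s' ⟨⟨a1, a2, a3, a4, a5, a6⟩, f⟩ => ?_
    have k : KeptInput s s' := f.keptInput (by cases mean <;> decide) (by cases mean <;> rfl)
    refine ⟨⟨⟨by rw [k.nat 2, hgs.length], ?_⟩, by rw [k.nat 0, hn], a1, a2, a3, a4⟩, a5, a6, k⟩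
    rw [k.nat 0, k.nat 3, k.nat 4, k.real]
    exact hgs.gate
  refine (((runs_initParams (mean := mean) hn hδ).frame.seq
    (T₂ := (m * 100 + 20) + ((D * 100 + 60) + (d * 60 + 30)))
    fun s₁ ⟨⟨a1, a2, a3, a4, a5, a6, a7⟩, f₁⟩ => ?_)).mono (by omega) fun _ h => h
  rw [← hN] at a1
  rw [← hε] at a2
  refine (runs_linearParams hm a1 a2 a3 a4 a5 a6 a7).frame.seq
    fun s₂ ⟨⟨b1, b2, b3, b4, b5, b6⟩, f₂⟩ => ?_
  refine (runs_chebParams hD b1 b2 b3 b4 b5 b6).frame.seq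
    fun s₃ ⟨⟨c1, c2, c3, c4, c5, c6⟩, f₃⟩ => ?_
  have hd' : s₃.nat 0 1 = d := by
    rw [f₃.nat 0, f₂.nat 0, f₁.nat 0, hd]
  refine (runs_conePower (mean := mean) hd' c6).frame.mono le_rfl fun s' ⟨e, f₄⟩ => ?_
  have w4 : ∀ a ∈ [1, 5, 6], (Program.conePower mean).writesN a = false := by cases mean <;> decide
  have w4' : ∀ a ∈ [3, 8], (Program.conePower mean).writesR a = false := by cases mean <;> decide
  exact ⟨by rw [f₄.nat 1 (w4 _ (by simp)), c1], by rw [f₄.nat 5 (w4 _ (by simp)), c2],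
    by rw [f₄.nat 6 (w4 _ (by simp)), c3], by rw [f₄.real 8 (w4' _ (by simp)), c4],
    by rw [f₄.real 3 (w4' _ (by simp)), c5], e⟩

end RealRAM

/-! ### The two algorithms -/

namespace RealRAM

open QCircuit Matrix

variable {n d N ρ : ℕ} {s : State}

namespace Program

/-- The path sum: real array `6` gets the sum, real array `3` its normalization. -/
def sumProgram (mean : Bool) : Program :=
  .seq parse (.seq (params mean) (pathSum (bif mean then meanPath else outputPath)))

/-- Bisection for the square root of the number in real array `7`. -/
def bisect : Program :=
  .seq (block [.letR 2 (.const 0), .letR 4 (.const 2)])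
    (.seq (.while (.ltR (.v 0) (.mul (.const 2) (.sub (.v 4) (.v 2))))
      (.seq (.letR 9 (.div (.add (.v 2) (.v 4)) (.const 2)))
        (.ite (.ltR (.v 7) (.mul (.v 9) (.v 9))) (.letR 4 (.v 9)) (.letR 2 (.v 9)))))
      (.letR 0 (.v 2)))

def meanProgram : Program := .seq (sumProgram true) (.seq (.letR 7 (.div (.v 6) (.v 3))) bisect)

def outputProgram : Program := .seq (sumProgram false) (.letR 0 (.div (.v 6) (.v 3)))

end Program

theorem runs_sumProgram {mean : Bool} {U : QCircuit n d} {O : List ℝ} {δ ε : ℝ}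
    (hx : Reads (s.nat 0) 0 U.natCode) (hy : Reads (s.real 0) 0 (δ :: (U.realCode ++ O)))
    (hN : N = bif mean then n + n else n) (hε : ε = bif mean then δ * δ / 4 else δ) {m D R : ℕ}
    (hm : IsLinearDegree N ε m) (hD : IsChebDegree N ε m D)
    (hR : R = (pathBase N ^ (m + D)) ^ ((bif mean then 4 else 2) ^ d)) {F : ℕ → ℂ}
    (hp : ∀ s r, Setup s n N m D (gateList U) → Reads (s.real 0) (s.nat 8 0) O → s.nat 7 0 = r →
      r ≤ R → Runs (bif mean then Program.meanPath else Program.outputPath) s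
        ((N + m + D + n + (gateList U).length + 5) * (4000 * (R + 1))) fun s' =>
        s'.real 6 0 = s.real 6 0 + (F r).re) :
    Runs (.sumProgram mean) s ((d + 1) * ((n + 1) * 200) + ((m + D + d + 2) * 100 +
      (R * ((N + m + D + n + (gateList U).length + 5) * (4000 * (R + 1)) + 20) + 30))) fun s' =>
      s'.real 6 0 = ∑ r ∈ Finset.range R, (F r).re ∧
      s'.real 3 0 = chebyshevT D (1 + (m : ℝ) / N) ∧ s'.real 0 0 = δ := by
  have hn : s.nat 0 0 = n := hx 0 (by simp [natCode])
  have hd : s.nat 0 1 = d := hx 1 (by simp [natCode])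
  have hδ : s.real 0 0 = δ := hy 0 (by simp)
  refine (runs_parse hx hy).seq fun s₁ ⟨a1, a2, a3, a4⟩ => ?_
  refine (runs_params (mean := mean) (by rw [a3, hn]) (by rw [a3, hd]) (by rw [a4, hδ]) hN hε hm hD
    a1).seq fun s₂ ⟨b1, b2, b3, b4⟩ => ?_
  refine (runs_pathSum (R := R) (F := F)
    (Env := fun s => Setup s n N m D (gateList U) ∧ Reads (s.real 0) (s.nat 8 0) O)
    ?_ ?_ ?_ ?_ ⟨b1, ?_⟩ ?_).mono le_rfl fun s₃ ⟨c1, c2⟩ => ⟨c1, ?_, ?_⟩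
  · intro a ha
    cases mean <;> interval_cases a <;> rfl
  · intro a ha ha'
    cases mean <;> interval_cases a <;> first | rfl | exact absurd rfl ha'
  · rintro s s' ⟨h1, h2⟩ hs
    exact ⟨h1.kept hs, by rw [hs.real 0, hs.nat 8]; exact h2⟩
  · rintro s r ⟨h1, h2⟩ h3 h4
    exact hp s r h1 h2 h3 h4.le
  · rw [b4.real, b4.nat 8, a4]
    exact a2
  · rw [b3, hR]
    push_cast
    rfl
  · rw [c2.real 3, b2]
  · rw [c2.real 0, b4.real, a4, hδ]

/-- The root lies in `[0, 2]`, and the loop stops once the interval is no longer than `δ / 2`, after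
at most `K` halvings. A slightly negative `q` does no harm: its root is zero by convention, and
every test then lowers the upper end. -/
theorem runs_bisect {q δ : ℝ} (h7 : s.real 7 0 = q) (hδ : s.real 0 0 = δ) (hq : q ≤ 4) {K : ℕ}
    (hK : 4 ≤ δ * 2 ^ K) :
    Runs .bisect s (K * 60 + 60) fun s' => |s'.real 0 0 - √q| ≤ δ / 2 := by
  have h0 : Runs (.block [.letR 2 (.const 0), .letR 4 (.const 2)]) s 20 fun s' =>
      s'.real 7 0 = q ∧ s'.real 0 0 = δ ∧ s'.real 2 0 = 0 ∧ s'.real 4 0 = 2 := by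
    refine Runs.of_loopFree ?_
    simp [Program.run, Program.block, State.real_setR, NExpr.eval, RExpr.eval, h7, hδ]
  refine (h0.seq (T₂ := (K * 60 + 20) + 20) fun s₁ ⟨a1, a2, a3, a4⟩ => ?_).mono (by omega) fun _ h => h
  have := Runs.while (b := .ltR (.v 0) (.mul (.const 2) (.sub (.v 4) (.v 2))))
    (c := .seq (.letR 9 (.div (.add (.v 2) (.v 4)) (.const 2)))
        (.ite (.ltR (.v 7) (.mul (.v 9) (.v 9))) (.letR 4 (.v 9)) (.letR 2 (.v 9)))) (T := 40)
    (Q := fun s' => |s'.real 2 0 - √q| ≤ δ / 2)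
    (fun k s' => ∃ j, j + k = K ∧ s'.real 7 0 = q ∧ s'.real 0 0 = δ ∧ 0 ≤ s'.real 2 0 ∧
      s'.real 2 0 ≤ √q ∧ √q ≤ s'.real 4 0 ∧ (s'.real 4 0 - s'.real 2 0) * 2 ^ j = 2) ?_ K s₁
    ⟨0, by omega, a1, a2, a3.ge, by rw [a3]; exact Real.sqrt_nonneg _, ?_, by rw [a3, a4]; norm_num⟩
  · refine (this.mono (by
      simp only [BExpr.cost, RExpr.cost, NExpr.cost]
      exact add_le_add (Nat.mul_le_mul_left _ (by omega)) (by omega)) fun _ h => h).seq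
      fun s' h' => Runs.of_loopFree ?_
    simpa [Program.run, State.real_setR, NExpr.eval, RExpr.eval] using h'
  · rintro k s' ⟨j, hj, i1, i2, i3, i4, i5, i6⟩
    by_cases hb : δ < 2 * (s'.real 4 0 - s'.real 2 0)
    · right
      have hjK : j < K := by
        by_contra hjK
        obtain rfl : j = K := by omega
        have h1 : δ * 2 ^ j < 2 * (s'.real 4 0 - s'.real 2 0) * 2 ^ j := by gcongr
        linarith
      refine ⟨by simpa [BExpr.holds, NExpr.eval, RExpr.eval, i2] using hb, k - 1, by omega, ?_⟩
      refine Runs.of_loopFree ⟨j + 1, by omega, ?_⟩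
      obtain ⟨z, hz⟩ : ∃ z, (s'.real 2 0 + s'.real 4 0) / 2 = z := ⟨_, rfl⟩
      have hz0 : 0 ≤ z := by have := i3.trans (i4.trans i5); linarith
      by_cases hlt : q < z * z
      · have hs : √q ≤ z := by rw [Real.sqrt_le_left hz0]; nlinarith
        have hz' : z = (s'.real 2 0 + s'.real 4 0) / 2 := hz.symm
        simp [Program.run, BExpr.holds, State.real_setR, NExpr.eval, RExpr.eval, hz, i1, hlt, i2, i3,
          i4, hs]
        rw [hz', pow_succ]; linarith
      · have hs : z ≤ √q := Real.le_sqrt_of_sq_le (by nlinarith)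
        have hz' : z = (s'.real 2 0 + s'.real 4 0) / 2 := hz.symm
        simp [Program.run, BExpr.holds, State.real_setR, NExpr.eval, RExpr.eval, hz, i1, hlt, i2, hz0,
          i5, hs]
        rw [hz', pow_succ]; linarith
    · left
      refine ⟨by simpa [BExpr.holds, NExpr.eval, RExpr.eval, i2] using hb, ?_⟩
      rw [abs_le]
      constructor <;> linarith
  · rw [a4, Real.sqrt_le_left (by norm_num)]
    linarith

theorem reads_getD {α : Type*} {f : ℕ → α} {l : List α} {a : α} (h : ∀ i, f i = l.getD i a) :
    Reads f 0 l := by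
  intro i hi
  rw [h, zero_add, List.getD_eq_getElem _ _ hi]

theorem sum_re_pathTotal {m D R : ℕ} {K : Cfg → ℂ} {v : ℝ} {R' : ℕ}
    (hv : PathSum (pathTotal N m D K) R' v) (hR : R' ≤ R) :
    ∑ r ∈ Finset.range R, (pathTotal N m D K r).re = v := by
  rw [← Complex.re_sum, (hv.mono hR).2, Complex.ofReal_re]

/-- The constant in `pathBase` is `64 ^ 4`, which absorbs the factor four of the light cones of the
mean value. Raising `N + 2` to the power `E'` as well is wasteful, but lets the program form the
whole bound by repeated squaring. -/
theorem pathCount_le {E E' m D : ℕ} (hE : E ≤ 4 * E') (hE' : 0 < E') :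
    (N + 2) ^ (m + D) * 64 ^ (E * (m + D)) ≤ (pathBase N ^ (m + D)) ^ E' := by
  rw [pathBase, mul_pow, mul_pow, ← pow_mul, ← pow_mul]
  refine Nat.mul_le_mul (Nat.pow_le_pow_right (by omega) ?_) ?_
  · exact Nat.le_mul_of_pos_right _ hE'
  · rw [show 16777216 = 64 ^ 4 by norm_num, ← pow_mul]
    refine Nat.pow_le_pow_right (by norm_num) ?_
    nlinarith [Nat.zero_le (m + D)]

theorem outputProgram_spec (V : QCircuit n d) {δ : ℝ} {m D R : ℕ}
    (hm : IsLinearDegree n δ m) (hD : IsChebDegree n δ m D)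
    (hR : R = (pathBase n ^ (m + D)) ^ (2 ^ d)) :
    ∃ (q : ℝ) (t : ℕ), Outputs .outputProgram V.natCode (δ :: V.realCode) q t ∧
      t ≤ (d + 1) * ((n + 1) * 200) + ((m + D + d + 2) * 100 +
        (R * ((n + m + D + n + (gateList V).length + 5) * (4000 * (R + 1)) + 20) + 30)) + 10 ∧
      |q - ‖zeroElement V.op‖ ^ 2| ≤ δ := by
  obtain ⟨v, hv, hv'⟩ := pathTotal_spec (hasLaw_output V) hm.le hD.large
  have hs := runs_sumProgram (s := initial V.natCode (δ :: V.realCode)) (mean := false) (U := V)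
    (O := []) (N := n) (reads_getD (a := 0) fun i => by simp [initial])
    (reads_getD (a := 0) fun i => by simp [initial])
    rfl rfl hm hD hR (F := pathTotal n m D (pathOutput V))
    fun s r h1 _ h3 h4 => h1.outputPath le_rfl h3 h4
  obtain ⟨s', t, h1, h2, h3⟩ := hs.seq (c' := .letR 0 (.div (.v 6) (.v 3))) (T₂ := 10)
    (Q' := fun s' => s'.real 0 0 = v / chebyshevT D (1 + (m : ℝ) / n)) fun s₁ ⟨a1, a2, a3⟩ => by
      refine Runs.of_loopFree ?_
      rw [sum_re_pathTotal hv (by rw [hR]; exact pathCount_le (by omega) (by positivity))] at a1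
      simp [Program.run, State.real_setR, RExpr.eval, NExpr.eval, a1, a2]
  exact ⟨_, t, ⟨s', h1, h3⟩, h2, hv'⟩

/-- Square roots of nonnegative numbers differ by at most the root of the difference; a negative `q`
has root zero, and then `p ≤ η`. -/
theorem abs_sqrt_sub_le {q p η : ℝ} (hp : 0 ≤ p) (h : |q - p ^ 2| ≤ η ^ 2) (hη : 0 ≤ η) :
    |√q - p| ≤ η := by
  rw [abs_le] at h ⊢
  constructor
  · have : p ≤ √q + η := by
      rcases le_total p η with h1 | h1
      · have := Real.sqrt_nonneg q
        linarith
      · have : p - η ≤ √q := Real.le_sqrt_of_sq_le (by nlinarith)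
        linarith
    linarith
  · have : √q ≤ p + η := by
      rw [Real.sqrt_le_left (by linarith)]
      nlinarith
    linarith

theorem norm_meanValue_sq_le_one (U : QCircuit n d) {O : Fin n → Matrix (Fin 2) (Fin 2) ℂ}
    (hO : ∀ j, IsKraus (O j)) : ‖meanValue U O‖ ^ 2 ≤ 1 := by
  obtain ⟨Ω, _, P, S, ω₀, hP, hsum, -, -, hp, -⟩ := hasLaw_mean U hO
  rw [← hp, ← hsum]
  exact Finset.single_le_sum (fun ω _ => hP ω) (Finset.mem_univ ω₀)

/-- The error is split evenly: precision `δ² / 4` for the square costs `δ / 2` after the root, and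
the bisection adds another `δ / 2`. -/
theorem meanProgram_spec (U : QCircuit n d) {O : Fin n → Matrix (Fin 2) (Fin 2) ℂ}
    (hO : ∀ j, IsKraus (O j)) {δ : ℝ} (hδ : 0 ≤ δ) (hδ1 : δ ≤ 1) {m D R K : ℕ}
    (hm : IsLinearDegree (n + n) (δ * δ / 4) m) (hD : IsChebDegree (n + n) (δ * δ / 4) m D)
    (hR : R = (pathBase (n + n) ^ (m + D)) ^ (4 ^ d)) (hK : 4 ≤ δ * 2 ^ K) :
    ∃ (E : ℝ) (t : ℕ),
      Outputs .meanProgram U.natCode (δ :: (U.realCode ++ obsCode O)) E t ∧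
      t ≤ (d + 1) * ((n + 1) * 200) + ((m + D + d + 2) * 100 +
        (R * (((n + n) + m + D + n + (gateList U).length + 5) * (4000 * (R + 1)) + 20) + 30)) +
          (10 + (K * 60 + 60)) ∧
      |E - ‖meanValue U O‖| ≤ δ := by
  obtain ⟨v, hv, hv'⟩ := pathTotal_spec (hasLaw_mean U hO) hm.le hD.large
  set u := chebyshevT D (1 + (m : ℝ) / (n + n : ℕ)) with hu
  have hs := runs_sumProgram (s := initial U.natCode (δ :: (U.realCode ++ obsCode O))) (mean := true)
    (U := U) (O := obsCode O) (N := n + n) (reads_getD (a := 0) fun i => by simp [initial])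
    (reads_getD (a := 0) fun i => by simp [initial])
    rfl rfl hm hD hR (F := pathTotal (n + n) m D (pathMean U O)) fun s r h1 h2 h3 h4 => by
      refine h1.meanPath (fun k => ?_) le_rfl h3 h4
      have := h2.obs k (by simp)
      simpa using this
  have hμ := norm_meanValue_sq_le_one U hO
  have hq : v / u ≤ 4 := by
    have h1 := (abs_le.1 hv').2
    nlinarith
  obtain ⟨s', t, h1, h2, h3⟩ := hs.seq
    (c' := .seq (.letR 7 (.div (.v 6) (.v 3))) .bisect) (T₂ := 10 + (K * 60 + 60))
    (Q' := fun s' => |s'.real 0 0 - √(v / u)| ≤ δ / 2) fun s₁ ⟨a1, a2, a3⟩ => by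
      rw [sum_re_pathTotal hv (by rw [hR]; exact pathCount_le (E' := 4 ^ d) (by omega) (by positivity))] at a1
      have h7 : Runs (.letR 7 (.div (.v 6) (.v 3))) s₁ 10 fun s' => s'.real 7 0 = v / u ∧
          s'.real 0 0 = δ := by
        refine Runs.of_loopFree ?_
        simp [Program.run, State.real_setR, RExpr.eval, NExpr.eval, a1, a2, a3, hu]
      exact h7.seq fun s₂ ⟨b1, b2⟩ => runs_bisect b1 b2 hq hK
  refine ⟨_, t, ⟨s', h1, rfl⟩, h2, ?_⟩
  have h4 := abs_sqrt_sub_le (norm_nonneg _) (hv'.trans_eq (by ring : _ = (δ / 2) ^ 2)) (by linarith)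
  calc |s'.real 0 0 - ‖meanValue U O‖|
      ≤ |s'.real 0 0 - √(v / u)| + |√(v / u) - ‖meanValue U O‖| := abs_sub_le _ _ _
    _ ≤ δ := by linarith

end RealRAM

/-! ### The running time -/

namespace RealRAM

open QCircuit Matrix Real

theorem exists_isLinearDegree (N : ℕ) (ε : ℝ) : ∃ m, IsLinearDegree N ε m := by
  classical
  have h : ∃ k, k = N ∨ 1 ≤ ε * 2 ^ k := ⟨N, .inl rfl⟩
  refine ⟨Nat.find h, Nat.find_min' h (.inl rfl), Nat.find_spec h, fun k hk => ?_⟩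
  have := Nat.find_min h hk
  push Not at this
  exact this.2

variable {N m : ℕ} {ε : ℝ}

theorem IsLinearDegree.pos (h : IsLinearDegree N ε m) (hN : 0 < N) (hε : ε < 1) : 0 < m := by
  rcases h.large with h1 | h1
  · omega
  · by_contra h0
    obtain rfl : m = 0 := by omega
    simp at h1
    linarith

/-- Minimality gives `(m - 1) log 2 ≤ log ε⁻¹`, and `log 2 ≤ log ε⁻¹` pays for the missing one. -/
theorem IsLinearDegree.le_log (h : IsLinearDegree N ε m) (h0 : 0 < ε) (hε : ε ≤ 1 / 2) :
    (m : ℝ) ≤ 3 * log ε⁻¹ := by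
  have hl := log_two_gt_d9
  have hL : log 2 ≤ log ε⁻¹ := by
    apply log_le_log (by norm_num)
    rw [le_inv_comm₀ (by norm_num) h0]
    linarith
  rcases m with _ | m
  · rw [Nat.cast_zero]; linarith
  · have h1 := h.lt m (by omega)
    have h2 : (m : ℝ) * log 2 ≤ log ε⁻¹ := by
      rw [← log_pow]
      apply log_le_log (by positivity)
      rw [le_inv_comm₀ (by positivity) h0, ← one_div, le_div_iff₀ (by positivity)]
      exact h1.le
    push_cast
    nlinarith

theorem half_le_log_one_add {t : ℝ} (h0 : 0 ≤ t) (h1 : t ≤ 1) : t / 2 ≤ log (1 + t) := by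
  refine le_trans ?_ (le_log_one_add_of_nonneg h0)
  rw [div_le_div_iff₀ (by norm_num) (by linarith)]
  nlinarith

/-- The root factors cost at most `N ^ m`, and `ε ≥ 2 ^ (-m)`, so a Chebyshev value of `(2 N) ^ m`
suffices. With `t = √(m / N)` one has `√(m N) * t = m`, and `log (1 + t) ≥ t / 2` shows that the
assumed degree gives even `(2 N) ^ (2 m) / 2`. -/
theorem rootBound_le_chebyshevT_mul (hm : m < N) (hm0 : 0 < m) (hε : 1 ≤ ε * 2 ^ m) {k : ℕ}
    (hk : 4 * log (2 * N) * √(m * N) ≤ k) :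
    rootBound N m ≤ chebyshevT k (1 + (m : ℝ) / N) * ε := by
  have hN : (0 : ℝ) < N := by exact_mod_cast (by omega : 0 < N)
  have hN1 : (1 : ℝ) ≤ N := by exact_mod_cast (by omega : 1 ≤ N)
  have hmN : (m : ℝ) ≤ N := by exact_mod_cast hm.le
  have hε0 : 0 < ε := by
    by_contra h
    have : ε * 2 ^ m ≤ 0 := mul_nonpos_of_nonpos_of_nonneg (not_lt.1 h) (by positivity)
    linarith
  set t := √((m : ℝ) / N) with ht
  have ht0 : 0 ≤ t := sqrt_nonneg _
  have ht1 : t ≤ 1 := by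
    rw [ht, sqrt_le_one]
    exact (div_le_one hN).2 hmN
  have hlog : 0 ≤ log (2 * N) := log_nonneg (by linarith)
  have hst : √(m * N) * t = m := by
    rw [ht, ← sqrt_mul (by positivity)]
    rw [show (m : ℝ) * N * (m / N) = m ^ 2 by field_simp]
    exact sqrt_sq (by positivity)
  have h1 : (2 * (N : ℝ)) ^ (2 * m) ≤ (1 + t) ^ k := by
    rw [← log_le_log_iff (by positivity) (by positivity), log_pow, log_pow]
    have h2 := half_le_log_one_add ht0 ht1
    have h3 : 4 * log (2 * N) * √(m * N) * t ≤ k * t := by gcongr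
    rw [mul_assoc, hst] at h3
    have h4 : (k : ℝ) * (t / 2) ≤ k * log (1 + t) := by gcongr
    push_cast
    linarith
  have h2 : (2 : ℝ) ≤ (2 * N) ^ m := by
    calc (2 : ℝ) ≤ 2 * N := by linarith
      _ = (2 * N) ^ 1 := (pow_one _).symm
      _ ≤ (2 * N) ^ m := pow_le_pow_right₀ (by linarith) hm0
  have h3 := pow_le_chebyshevT (k := k) (e := (m : ℝ) / N) (by positivity)
  calc rootBound N m ≤ (N : ℝ) ^ m := rootBound_le hm.le
    _ ≤ (N : ℝ) ^ m * (ε * 2 ^ m) := le_mul_of_one_le_right (by positivity) hε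
    _ = (2 * N) ^ m * ε := by rw [mul_pow]; ring
    _ ≤ ((2 * N) ^ (2 * m) / 2) * ε := by
      gcongr
      rw [two_mul m, pow_add]
      nlinarith
    _ ≤ ((1 + t) ^ k / 2) * ε := by gcongr
    _ ≤ _ := by gcongr

theorem exists_isChebDegree (h : IsLinearDegree N ε m) (hN : 0 < N) (h0 : 0 < ε) (hε : ε < 1) :
    ∃ D, IsChebDegree N ε m D ∧ (D : ℝ) ≤ 4 * log (2 * N) * √(m * N) + 1 := by
  classical
  have hN1 : (1 : ℝ) ≤ N := by exact_mod_cast hN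
  have hpos : 0 ≤ 4 * log (2 * N) * √(m * N) := by
    have : 0 ≤ log (2 * N) := log_nonneg (by linarith)
    positivity
  have hk : rootBound N m ≤ chebyshevT ⌈4 * log (2 * N) * √(m * N)⌉₊ (1 + (m : ℝ) / N) * ε := by
    rcases h.le.eq_or_lt with rfl | hlt
    · rw [rootBound_self hN]
      exact mul_nonneg (by linarith [(one_le_chebyshevT ⌈4 * log (2 * m) * √(m * m)⌉₊
        (y := 1 + (m : ℝ) / m) (by linarith [show (0 : ℝ) ≤ m / m by positivity])).1]) h0.le
    · exact rootBound_le_chebyshevT_mul hlt (h.pos hN hε) (h.large.resolve_left hlt.ne) (Nat.le_ceil _)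
  have hex : ∃ k, rootBound N m ≤ chebyshevT k (1 + (m : ℝ) / N) * ε := ⟨_, hk⟩
  refine ⟨Nat.find hex, ⟨Nat.find_spec hex, fun k hk => not_le.1 (Nat.find_min hex hk)⟩, ?_⟩
  refine le_trans ?_ (Nat.ceil_lt_add_one hpos).le
  exact_mod_cast Nat.find_min' hex hk

/-- A bound for the total degree. -/
theorem degree_le {n D : ℕ} {ℓ : ℝ} (hn : 0 < n) (hN : 0 < N) (hNn : N ≤ 2 * n) (h0 : 0 < ε)
    (hε : ε ≤ 1 / 2) (hℓ : log 2 ≤ ℓ) (hεℓ : log ε⁻¹ ≤ 4 * ℓ) (h : IsLinearDegree N ε m)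
    (hD : (D : ℝ) ≤ 4 * log (2 * N) * √(m * N) + 1) :
    ((m + D : ℕ) : ℝ) ≤ 5 * √(n * ℓ) * (2 + 4 * log (4 * n)) := by
  have hl := log_two_gt_d9
  have hn1 : (1 : ℝ) ≤ n := by exact_mod_cast hn
  have hN1 : (1 : ℝ) ≤ N := by exact_mod_cast hN
  have hNn' : (N : ℝ) ≤ 2 * n := by exact_mod_cast hNn
  have hm3 : (m : ℝ) ≤ 12 * ℓ := (h.le_log h0 hε).trans (by linarith)
  have hmN : (m : ℝ) ≤ N := by exact_mod_cast h.le
  -- Here `m N ≤ 12 ℓ * 2 n = 24 n ℓ`, which is less than `25 n ℓ`.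
  have hS : √(m * N) ≤ 5 * √(n * ℓ) := by
    rw [sqrt_le_left (by positivity), mul_pow, sq_sqrt (by nlinarith)]
    nlinarith [mul_le_mul hm3 hNn' (by positivity) (by linarith)]
  have hmS : (m : ℝ) ≤ √(m * N) := le_sqrt_of_sq_le (by nlinarith)
  have h1S : 1 ≤ 5 * √(n * ℓ) := by
    have : 1 / 5 ≤ √(n * ℓ) := le_sqrt_of_sq_le (by nlinarith)
    linarith
  have hlog : log (2 * N) ≤ log (4 * n) := log_le_log (by positivity) (by linarith)
  have hlog0 : 0 ≤ log (4 * n) := log_nonneg (by linarith)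
  have h4 : 4 * log (2 * N) * √(m * N) ≤ 4 * log (4 * n) * (5 * √(n * ℓ)) := by gcongr
  push_cast
  nlinarith

/-- The running time in terms of the number of paths. -/
theorem time_le_pow {n d D g K R E : ℕ} (hN : n ≤ N) (hd : d ≤ E) (hE : 0 < E) (hm : 0 < m) (hg : g ≤ d * n)
    (hR : R = (pathBase N ^ (m + D)) ^ E) :
    (d + 1) * ((n + 1) * 200) + ((m + D + d + 2) * 100 +
        (R * ((N + m + D + n + g + 5) * (4000 * (R + 1)) + 20) + 30)) + (10 + (K * 60 + 60)) ≤
      R ^ 5 + 60 * K := by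
  have hb : 2 ≤ pathBase N := by rw [pathBase]; omega
  have hbN : N + 16777216 ≤ pathBase N := by rw [pathBase]; omega
  have hK0 : m + D ≠ 0 := by omega
  have h1 : pathBase N ≤ R := by
    rw [hR, ← pow_mul]
    exact Nat.le_self_pow (by positivity) _
  have h2 : m + D ≤ R := by
    rw [hR]
    exact (Nat.lt_pow_self hb).le.trans (Nat.le_self_pow hE.ne' _)
  have h3 : E ≤ R := by
    rw [hR]
    exact (Nat.lt_pow_self (n := E) hb).le.trans
      (Nat.pow_le_pow_left (Nat.le_self_pow hK0 _) _)
  have hR0 : 16777216 ≤ R := by omega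
  have hnR : n ≤ R := by omega
  have hdR : d ≤ R := by omega
  have hgR : g ≤ R * R := hg.trans (Nat.mul_le_mul hdR hnR)
  have e1 : (d + 1) * ((n + 1) * 200) ≤ (R + 1) * ((R + 1) * 200) := by gcongr
  have e2 : (m + D + d + 2) * 100 ≤ (R + R + 2) * 100 := by gcongr
  have e3 : R * ((N + m + D + n + g + 5) * (4000 * (R + 1)) + 20) ≤
      R * ((R + R + R + R * R + 5) * (4000 * (R + 1)) + 20) := by
    have e : N + m + D + n + g + 5 ≤ R + R + R + R * R + 5 := by omega
    gcongr
  -- The leading term is `4000 R ^ 4`, and `R ≥ 2 ^ 24` absorbs all the constants into one more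
  -- power.
  have e4 : (R + 1) * ((R + 1) * 200) + ((R + R + 2) * 100 +
      (R * ((R + R + R + R * R + 5) * (4000 * (R + 1)) + 20) + 30)) + 70 ≤ R ^ 5 := by
    have : 16777216 * R ^ 4 ≤ R ^ 5 := by rw [pow_succ R 4, mul_comm]; gcongr
    refine le_trans ?_ this
    nlinarith [sq_nonneg R, pow_pos (show 0 < R by omega) 3, pow_pos (show 0 < R by omega) 2,
      Nat.mul_le_mul hR0 (le_refl (R ^ 3)), Nat.mul_le_mul hR0 (le_refl (R ^ 2)),
      Nat.mul_le_mul hR0 (le_refl R)]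
  omega

/-- The fifth power multiplies the logarithm to `13775 X ≤ 14000 X`, and the bisection term is
linear in `ℓ ≤ f²`, hence far smaller than the same exponential. The constant `40000` covers the
passage to base two and the sum of both terms. -/
theorem rpow_softO_of_log_le {R K : ℕ} {ℓ f : ℝ} (hR0 : 0 < R) (hf : 8 / 10 ≤ f) (hℓ : ℓ ≤ f ^ 2)
    (hR : log R ≤ 2755 * (f * log (2 + f) ^ 2)) (hK : (K : ℝ) ≤ 8 * ℓ) :
    ((R ^ 5 + 60 * K : ℕ) : ℝ) ≤ (2 : ℝ) ^ softO 40000 2 f := by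
  have hl := log_two_gt_d9
  have hRpos : (0 : ℝ) < R := by exact_mod_cast hR0
  have hlam2 : log 2 ≤ log (2 + f) := log_le_log (by norm_num) (by linarith)
  rw [softO]
  have hlamsq : 48 / 100 ≤ log (2 + f) ^ 2 := by nlinarith
  have hfX : f ≤ 3 * (f * log (2 + f) ^ 2) := by nlinarith
  generalize f * log (2 + f) ^ 2 = X at *
  have hR5 : (R : ℝ) ^ 5 ≤ exp (14000 * X) := by
    rw [← log_le_iff_le_exp (by positivity), log_pow]
    push_cast
    linarith
  have hKf : 60 * (K : ℝ) ≤ exp (14000 * X) := by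
    have h1 : f ^ 2 ≤ 2 * exp f := by
      have := quadratic_le_exp_of_nonneg (x := f) (by linarith)
      nlinarith
    have h2 : (960 : ℝ) ≤ exp 31 ^ 2 := by nlinarith [add_one_le_exp (31 : ℝ)]
    rw [← exp_nat_mul] at h2
    calc 60 * (K : ℝ) ≤ 480 * ℓ := by linarith
      _ ≤ 960 * exp f := by linarith
      _ ≤ exp ((2 : ℕ) * 31) * exp f := by gcongr
      _ = exp ((2 : ℕ) * 31 + f) := (exp_add _ _).symm
      _ ≤ exp (14000 * X) := exp_le_exp.2 (by push_cast; linarith)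
  calc ((R ^ 5 + 60 * K : ℕ) : ℝ) = (R : ℝ) ^ 5 + 60 * K := by push_cast; ring
    _ ≤ 2 * exp (14000 * X) := by linarith
    _ ≤ exp 1 * exp (14000 * X) := by
      gcongr
      linarith [add_one_le_exp (1 : ℝ)]
    _ = exp (1 + 14000 * X) := (exp_add _ _).symm
    _ ≤ exp (log 2 * (40000 * X)) := exp_le_exp.2 (by nlinarith)
    _ = 2 ^ (40000 * X) := by rw [rpow_def_of_pos (by norm_num)]

theorem natCast_le_rpow_softO {n D R E K : ℕ} {ℓ : ℝ} (hn : 0 < n) (hN : 0 < N) (hNn : N ≤ 2 * n)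
    (h0 : 0 < ε) (hε : ε ≤ 1 / 2) (hℓ : log 2 ≤ ℓ) (hεℓ : log ε⁻¹ ≤ 4 * ℓ)
    (h : IsLinearDegree N ε m) (hD : (D : ℝ) ≤ 4 * log (2 * N) * √(m * N) + 1) (hE : 0 < E)
    (hR : R = (pathBase N ^ (m + D)) ^ E) (hK : (K : ℝ) ≤ 8 * ℓ) :
    ((R ^ 5 + 60 * K : ℕ) : ℝ) ≤ (2 : ℝ) ^ softO 40000 2 (E * √(n * ℓ)) := by
  have hl := log_two_gt_d9
  have hl' := log_two_lt_d9
  have hn1 : (1 : ℝ) ≤ n := by exact_mod_cast hn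
  have hE1 : (1 : ℝ) ≤ E := by exact_mod_cast hE
  have hNn' : (N : ℝ) ≤ 2 * n := by exact_mod_cast hNn
  set S := √(n * ℓ) with hS
  have hS2 : S ^ 2 = n * ℓ := sq_sqrt (by nlinarith)
  have hS0 : 0 ≤ S := sqrt_nonneg _
  set f := E * S with hf
  have hSf : S ≤ f := by nlinarith
  have hf8 : 8 / 10 ≤ f := by
    refine le_trans (le_sqrt_of_sq_le ?_) hSf
    nlinarith
  have hf2 : n * ℓ ≤ f ^ 2 := by rw [← hS2]; gcongr
  set lam := log (2 + f) with hlam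
  have hlam2 : log 2 ≤ lam := log_le_log (by norm_num) (by linarith)
  -- Logarithms of `n` count as logarithms of `f`, because `f ^ 2 ≥ n ℓ ≥ n log 2`.
  have hlog4 : log (4 * n) ≤ 4 * lam := by
    rw [hlam, show (4 : ℝ) * log (2 + f) = ((4 : ℕ) : ℝ) * log (2 + f) by norm_num, ← log_pow]
    apply log_le_log (by positivity)
    have h1 : (2 + f) ^ 2 ≥ 8 * f := by nlinarith [sq_nonneg (f - 2)]
    have h2 : (2 + f) ^ 4 ≥ (8 * f) ^ 2 := by
      rw [show (2 + f) ^ 4 = ((2 + f) ^ 2) ^ 2 by ring]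
      gcongr
    nlinarith
  have hlog0 : 0 ≤ log (4 * n) := log_nonneg (by linarith)
  -- The factor is `2 + 4 * (4 λ)`, and `2 ≤ 3 λ`. The constant `2755` below is `5 * 19 * 29`.
  have hdeg : ((m + D : ℕ) : ℝ) ≤ 5 * S * (19 * lam) :=
    (degree_le hn hN hNn h0 hε hℓ hεℓ h hD).trans (by
      gcongr
      linarith)
  have hbase : log (pathBase N) ≤ 29 * lam := by
    have h1 : ((pathBase N : ℕ) : ℝ) ≤ 4 * n * 2 ^ 24 := by
      rw [pathBase]
      push_cast
      nlinarith
    calc log (pathBase N) ≤ log (4 * n * 2 ^ 24) :=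
          log_le_log (by exact_mod_cast (by rw [pathBase]; omega)) h1
      _ = log (4 * n) + 24 * log 2 := by
          rw [log_mul (by positivity) (by positivity), log_pow]; norm_num
      _ ≤ _ := by linarith
  have hlogR : log R ≤ 2755 * (f * lam ^ 2) := by
    rw [hR]
    push_cast
    rw [log_pow, log_pow]
    calc (E : ℝ) * (((m + D : ℕ) : ℝ) * log (pathBase N))
        ≤ E * ((5 * S * (19 * lam)) * (29 * lam)) := by
          have : 0 ≤ log (pathBase N : ℝ) := log_nonneg (by exact_mod_cast (by rw [pathBase]; omega))
          have : 0 ≤ lam := by linarith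
          gcongr
      _ = 2755 * (f * lam ^ 2) := by rw [hf]; ring
  have hRpos : 0 < R := by rw [hR, pathBase]; positivity
  exact rpow_softO_of_log_le hRpos hf8 (by nlinarith) hlogR hK

end RealRAM

/-! ### Positive observables and the choice of the number of halvings. -/

namespace QCircuit

open Matrix Real RealRAM

variable {n d : ℕ}

open scoped MatrixOrder in
theorem _root_.Matrix.PosSemidef.exists_eq_conjTranspose_mul_self {A : Matrix (Fin 2) (Fin 2) ℂ}
    (hA : A.PosSemidef) : ∃ B : Matrix (Fin 2) (Fin 2) ℂ, A = Bᴴ * B := by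
  refine ⟨CFC.sqrt A, ?_⟩
  have h := (CFC.sqrt_nonneg A).posSemidef.1
  rw [h.eq, CFC.sqrt_mul_sqrt_self A hA.nonneg]

/-- Factoring each `O j` as `Bᴴ B` turns the observable into `(tensor B)ᴴ * tensor B`, so the mean
value is a diagonal entry of a positive matrix. -/
theorem meanValue_nonneg (U : QCircuit n d) {O : Fin n → Matrix (Fin 2) (Fin 2) ℂ}
    (hO : ∀ j, (O j).PosSemidef) : 0 ≤ meanValue U O := by
  have h : ∀ j, ∃ B : Matrix (Fin 2) (Fin 2) ℂ, O j = Bᴴ * B := fun j =>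
    (hO j).exists_eq_conjTranspose_mul_self
  choose B hB using h
  have e : (op U)ᴴ * tensor O * op U = (tensor B * op U)ᴴ * (tensor B * op U) := by
    rw [funext hB, ← tensor_mul, ← tensor_conjTranspose, conjTranspose_mul]
    simp only [Matrix.mul_assoc]
  rw [meanValue, e]
  exact (posSemidef_conjTranspose_mul_self _).diag_nonneg

theorem exists_nat_mul_two_pow {δ : ℝ} (h0 : 0 < δ) (h1 : log 2 ≤ log δ⁻¹) :
    ∃ K : ℕ, 4 ≤ δ * 2 ^ K ∧ (K : ℝ) ≤ 8 * log δ⁻¹ := by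
  have hl := log_two_gt_d9
  have e : log (4 * δ⁻¹) = 2 * log 2 + log δ⁻¹ := by
    rw [log_mul (by norm_num) (by positivity), show (4 : ℝ) = 2 ^ 2 by norm_num, log_pow]
    norm_num
  refine ⟨⌈log (4 * δ⁻¹) / log 2⌉₊, ?_, ?_⟩
  · have h2 := Nat.le_ceil (log (4 * δ⁻¹) / log 2)
    rw [div_le_iff₀ (by linarith), ← log_pow, log_le_log_iff (by positivity) (by positivity),
      ← div_eq_mul_inv, div_le_iff₀ h0, mul_comm, div_eq_mul_inv] at h2
    exact h2
  · refine (Nat.ceil_lt_add_one (div_nonneg (by linarith) (by linarith))).le.trans ?_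
    rw [e, add_div, mul_div_assoc, div_self (by linarith)]
    have : log δ⁻¹ / log 2 ≤ 2 * log δ⁻¹ := by
      rw [div_le_iff₀ (by linarith)]
      nlinarith
    linarith

end QCircuit

theorem mainTheorem4 :
    (∃ (P : RealRAM.Program) (C : ℝ) (k : ℕ),
      ∀ (n d : ℕ) (U : QCircuit n d) (O : Fin n → Matrix (Fin 2) (Fin 2) ℂ) (δ : ℝ),
        0 < n → (∀ j, QCircuit.qubitNorm (O j) = 1) → 0 < δ → δ < 1 / 2 →
        ∃ (E : ℝ) (t : ℕ),
          RealRAM.Outputs P U.natCode (δ :: (U.realCode ++ QCircuit.obsCode O)) E t ∧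
          (t : ℝ) ≤ (2 : ℝ) ^ softO C k (4 ^ d * √(n * Real.log δ⁻¹)) ∧
          |E - ‖U.meanValue O‖| ≤ δ ∧
          ((∀ j, (O j).PosSemidef) → ‖(E : ℂ) - U.meanValue O‖ ≤ δ)) ∧
    (∃ (P : RealRAM.Program) (C : ℝ) (k : ℕ),
      ∀ (n d : ℕ) (V : QCircuit n d) (δ : ℝ), 0 < n → 0 < δ → δ < 1 / 2 →
        ∃ (q : ℝ) (t : ℕ),
          RealRAM.Outputs P V.natCode (δ :: V.realCode) q t ∧
          (t : ℝ) ≤ (2 : ℝ) ^ softO C k (2 ^ d * √(n * Real.log δ⁻¹)) ∧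
          |q - ‖QCircuit.zeroElement V.op‖ ^ 2| ≤ δ) := by
  have hlog : ∀ δ : ℝ, 0 < δ → δ < 1 / 2 → Real.log 2 ≤ Real.log δ⁻¹ := by
    intro δ h0 h1
    apply Real.log_le_log (by norm_num)
    rw [le_inv_comm₀ (by norm_num) h0]
    linarith
  refine ⟨⟨.meanProgram, 40000, 2, fun n d U O δ hn hO h0 h1 => ?_⟩,
    ⟨.outputProgram, 40000, 2, fun n d V δ hn h0 h1 => ?_⟩⟩
  · have hℓ := hlog δ h0 h1
    have hε0 : 0 < δ * δ / 4 := by positivity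
    have hε : δ * δ / 4 ≤ 1 / 2 := by nlinarith
    -- The left side is `2 log 2 + 2 log δ⁻¹`, and `δ < 1 / 2`.
    have hεℓ : Real.log (δ * δ / 4)⁻¹ ≤ 4 * Real.log δ⁻¹ := by
      rw [inv_div, div_eq_mul_inv, mul_inv, Real.log_mul (by norm_num) (by positivity),
        Real.log_mul (by positivity) (by positivity), show (4 : ℝ) = 2 ^ 2 by norm_num, Real.log_pow]
      push_cast
      linarith
    obtain ⟨m, hm⟩ := RealRAM.exists_isLinearDegree (n + n) (δ * δ / 4)
    obtain ⟨D, hD, hD'⟩ := RealRAM.exists_isChebDegree hm (by omega) hε0 (by linarith)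
    obtain ⟨K, hK, hK'⟩ := QCircuit.exists_nat_mul_two_pow h0 hℓ
    obtain ⟨E, t, hout, ht, hE⟩ := RealRAM.meanProgram_spec U
      (fun j => QCircuit.isKraus_of_qubitNorm (hO j)) h0.le (by linarith) hm hD rfl hK
    refine ⟨E, t, hout, ?_, hE, fun hpos => ?_⟩
    · refine le_trans (Nat.cast_le.2 (ht.trans (RealRAM.time_le_pow (E := 4 ^ d) (by omega)
        (Nat.lt_pow_self (by norm_num)).le (by positivity) (hm.pos (by omega) (by linarith))
        (RealRAM.length_gateList_le U) rfl))) ?_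
      have := RealRAM.natCast_le_rpow_softO (E := 4 ^ d) hn (by omega) (by omega) hε0 hε hℓ hεℓ hm hD'
        (by positivity) rfl hK'
      rwa [Nat.cast_pow, Nat.cast_ofNat] at this
    · have hmean : U.meanValue O = (‖U.meanValue O‖ : ℂ) := by
        have := Complex.norm_of_nonneg' (QCircuit.meanValue_nonneg U hpos)
        exact this.symm
      rw [hmean, ← Complex.ofReal_sub, Complex.norm_real, Real.norm_eq_abs]
      simpa using hE
  · have hℓ := hlog δ h0 h1
    obtain ⟨m, hm⟩ := RealRAM.exists_isLinearDegree n δ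
    obtain ⟨D, hD, hD'⟩ := RealRAM.exists_isChebDegree hm hn h0 (by linarith)
    obtain ⟨q, t, hout, ht, hq⟩ := RealRAM.outputProgram_spec V hm hD rfl
    refine ⟨q, t, hout, ?_, hq⟩
    -- No root is taken in this case, so there are no halvings to pay for.
    have ht' := RealRAM.time_le_pow (E := 2 ^ d) (K := 0) (D := D) (N := n) le_rfl
      (Nat.lt_pow_self (by norm_num)).le (by positivity) (hm.pos hn (by linarith))
      (RealRAM.length_gateList_le V) rfl
    refine le_trans (Nat.cast_le.2 (le_trans (ht.trans (Nat.add_le_add_left (by norm_num) _)) ht')) ?_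
    have := RealRAM.natCast_le_rpow_softO (E := 2 ^ d) (K := 0) (N := n) hn hn (by omega) h0 h1.le hℓ
      (by have := Real.log_two_gt_d9; linarith) hm hD' (by positivity) rfl
      (by have := Real.log_two_gt_d9; rw [Nat.cast_zero]; linarith)
    rwa [Nat.cast_pow, Nat.cast_ofNat] at this
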